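/- **Setting.** Let $\mathcal H$ be a complex Hilbert space with inner product $(\cdot,\cdot)$, linear in the second argument, and put $\varphi^*=(\varphi,\cdot)\in\mathcal H^*$. Let $\mathcal F=\bigoplus_{n\ge0}\mathrm{Sym}\,\mathcal H^{\otimes n}$ be the Fock space with vacuum $|0\rangle$ and creation and annihilation operators $a^\pm[f]$, $[a^-[f],a^+[g]]=(f,g)$, and let $S\subset\mathcal F$ be the set of all $\Psi$ with $\sup_n n^m\|\Psi_n\|<\infty$ for every $m$. Regard $\mathcal H$ as a real space with the form $\omega(f,g)=i((f,g)-(g,f))$ and put $\Omega[f]=-i(a^+[f]-a^-[f])$. Let $\mathcal L\subset\mathcal H$ be a real subspace of finite dimension $k$ that is isotropic for $\omega$, with a translation-invariant (Haar) measure $\mu$. For $\Phi,\Psi\in S$ put $$\langle\Phi,\Psi\rangle=\int_{\mathcal L}d\mu(\varphi)\,(\Phi,e^{i\Omega[\varphi]}\Psi),\qquad \Phi\sim\Psi\iff\langle\Phi-\Psi,\Phi-\Psi\rangle=0 .$$ Let $B$ be a self-adjoint, possibly unbounded, operator in $\mathcal H$ with domain $D(B)$. For a symmetric Hilbert–Schmidt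 operator $M:\mathcal H^*\to\mathcal H$ (symmetric: $(f,Mg^*)=(g,Mf^*)$) write $a^+Ma^+=\sum_{p,q}a^+[f_p]\,(f_p,Mf_q^*)\,a^+[f_q]$ for an orthonormal basis $(f_p)$, and let $a^-M^*a^-$ be its formal adjoint. We write $M\in D(B)\otimes D(B)$ if $M$ maps into $D(B)$ and $BM$ is Hilbert–Schmidt. Let $A:\mathcal H^*\to\mathcal H$ be symmetric, Hilbert–Schmidt, with $A\in D(B)\otimes D(B)$, let $\varepsilon\in\mathbb C$, and let $$H=\tfrac12a^+Aa^++a^+Ba^-+\tfrac12a^-A^*a^-+\varepsilon,\qquad L\varphi=-iB\varphi-iA\varphi^*\quad(\varphi\in D(B)),$$ where $a^+Ba^-$ is the second quantization of $B$. Assume that $\mathcal L\subset D(B)$, $L\mathcal L\subset\mathcal L$ and $\operatorname{Im}\varepsilon=-\frac12\operatorname{Tr}L|_{\mathcal L}$. Let $\mathcal L^{\perp\omega}=\{\chi\in\mathcal H:\omega(\chi,\varphi)=0\ \text{for all}\ \varphi\in\mathcal L\}$, and let $\mathcal R=\mathcal L^{\perp\omega}/\mathcal L$ carry the norm $\|[\chi]\|_{\mathcal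 R}=\inf_{\varphi\in\mathcal L}\|\chi+\varphi\|$. **Lemma.** Let $M:\mathcal H^*\to\mathcal H$ be a symmetric Hilbert–Schmidt operator with $\|M\|<1$ and $M\in D(B)\otimes D(B)$, and suppose that the Gaussian vector $\Psi_M=\exp[\frac12a^+Ma^+]|0\rangle$ is an eigenfunction of $H$ in the physical Hilbert space: $\Psi_M\not\sim0$ and $H\Psi_M\sim E\Psi_M$ for some number $E$. Then the classical linear system $\dot\chi=L\chi$ is stable in $\mathcal R$: for every $r>0$ there is $\delta>0$ such that every solution $\chi:\mathbb R\to\mathcal H$ (a norm-continuous weak solution; classical solutions are included) with $\chi(0)\in\mathcal L^{\perp\omega}$ and $\|[\chi(0)]\|_{\mathcal R}<\delta$ satisfies $\chi(t)\in\mathcal L^{\perp\omega}$ and $\|[\chi(t)]\|_{\mathcal R}<r$ for all $t\in\mathbb R$. -/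

import Mathlib

open MeasureTheory Filter Topology
open scoped InnerProductSpace

noncomputable section

namespace ConstrainedFock

variable {ι H : Type*} [NormedAddCommGroup H] [InnerProductSpace ℂ H]

/-! ### Fock space over the one-particle space `H`

An orthonormal basis `b` of `H` identifies `H^{⊗n}` with `ℓ²(ι^n)`.  A family `Ψ` of functions
`Ψ n : (Fin n → ι) → ℂ` lists the coordinates of the components of a vector of the direct sum. -/

/-- Families of `n`-particle coordinate functions, without summability or symmetry conditions. -/
abbrev Family (ι : Type*) := (n : ℕ) → (Fin n → ι) → ℂ

/-- Membership in the Fock space `⊕ₙ Sym H^{⊗n}`. -/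
structure IsFock (Ψ : Family ι) : Prop where
  symm : ∀ (n : ℕ) (σ : Equiv.Perm (Fin n)) (i : Fin n → ι), Ψ n (i ∘ σ) = Ψ n i
  summable : Summable fun x : (n : ℕ) × (Fin n → ι) => ‖Ψ x.1 x.2‖ ^ 2

/-- The norm `‖Ψₙ‖` of the `n`-particle component. -/
def sectorNorm (Ψ : Family ι) (n : ℕ) : ℝ := √(∑' i, ‖Ψ n i‖ ^ 2)

/-- The space `S` of Fock vectors with `sup_n n^m ‖Ψₙ‖ < ∞` for every `m`. -/
structure IsSchwartz (Ψ : Family ι) : Prop extends IsFock Ψ where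
  decay : ∀ m : ℕ, ∃ C : ℝ, ∀ n : ℕ, (n : ℝ) ^ m * sectorNorm Ψ n ≤ C

/-- The inner product of the Fock space, linear in the second argument. -/
def fockInner (Φ Ψ : Family ι) : ℂ :=
  ∑' x : (n : ℕ) × (Fin n → ι), starRingEnd ℂ (Φ x.1 x.2) * Ψ x.1 x.2

/-- The vacuum vector. -/
def vacuum : Family ι := fun n _ => if n = 0 then 1 else 0

/-- The creation operator `a⁺[f]`; on symmetric `Ψₙ` it is `√(n+1) Sym (f ⊗ Ψₙ)`. -/
def creation (b : HilbertBasis ι ℂ H) (f : H) (Ψ : Family ι) : Family ι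
  | 0, _ => 0
  | n + 1, i => ((√(n + 1 : ℝ))⁻¹ : ℝ) *
      ∑ j : Fin (n + 1), ⟪b (i j), f⟫_ℂ * Ψ n (fun l => i (j.succAbove l))

/-- The annihilation operator `a⁻[f]`, adjoint to `a⁺[f]` on symmetric families. -/
def annihilation (b : HilbertBasis ι ℂ H) (f : H) (Ψ : Family ι) : Family ι :=
  fun n i => (√(n + 1 : ℝ) : ℝ) * ∑' p : ι, ⟪f, b p⟫_ℂ * Ψ (n + 1) (Fin.cons p i)

/-- The field operator `Ω[f] = -i (a⁺[f] - a⁻[f])`. -/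
def fieldOp (b : HilbertBasis ι ℂ H) (f : H) (Ψ : Family ι) : Family ι :=
  (-Complex.I) • (creation b f Ψ - annihilation b f Ψ)

/-- Truncation to at most `N` particles. -/
def truncate (N : ℕ) (Ψ : Family ι) : Family ι := fun n i => if n ≤ N then Ψ n i else 0

/-- The unitary operator `exp(iΩ[f])`: the exponential series converges on vectors with boundedly
many particles (they are analytic vectors of `Ω[f]`), and the operator is extended from these to
the Fock space by continuity. -/
def weyl (b : HilbertBasis ι ℂ H) (f : H) (Ψ : Family ι) : Family ι := fun n i =>
  limUnder atTop fun N : ℕ => ∑' m : ℕ, ((m.factorial : ℂ))⁻¹ *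
    ((fun Φ : Family ι => Complex.I • fieldOp b f Φ)^[m] (truncate N Ψ)) n i

/-! ### Quadratic forms in the creation and annihilation operators

A linear operator `M : H* → H` is given as the conjugate-linear operator `φ ↦ M φ*` of `H`, where
`φ* = (φ, ·)`.  Its kernel has the matrix `(b p, M (b q)*)`. -/

/-- `a⁺Ma⁺ = ∑ a⁺[b p] (b p, M (b q)*) a⁺[b q]`. -/
def createPair (b : HilbertBasis ι ℂ H) (M : H →L⋆[ℂ] H) (Ψ : Family ι) : Family ι := fun n i =>
  ∑' x : ι × ι, ⟪b x.1, M (b x.2)⟫_ℂ * creation b (b x.1) (creation b (b x.2) Ψ) n i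

/-- `a⁻M*a⁻`, the formal adjoint of `a⁺Ma⁺` for symmetric `M`. -/
def annihilatePair (b : HilbertBasis ι ℂ H) (M : H →L⋆[ℂ] H) (Ψ : Family ι) : Family ι :=
  fun n i => ∑' x : ι × ι, starRingEnd ℂ ⟪b x.1, M (b x.2)⟫_ℂ *
    annihilation b (b x.1) (annihilation b (b x.2) Ψ) n i

/-- The inner product `(h₁ ⊗ ⋯ ⊗ hₙ, T)` in `H^{⊗n}`. -/
def tensorPairing (b : HilbertBasis ι ℂ H) {n : ℕ} (h : Fin n → H) (T : (Fin n → ι) → ℂ) : ℂ :=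
  ∑' i : Fin n → ι, (∏ l, ⟪h l, b (i l)⟫_ℂ) * T i

/-- The graph of the operator `a⁺Ba⁻` (the second quantization of `B`).  For self-adjoint `B` the
operator `∑ⱼ 1 ⊗ ⋯ ⊗ B ⊗ ⋯ ⊗ 1` is essentially self-adjoint on the algebraic tensor product of
copies of `D(B)`; its closure is its adjoint, whose graph is described here. -/
def IsSecondQuantization (b : HilbertBasis ι ℂ H) (B : H →ₗ.[ℂ] H) (Ψ Ξ : Family ι) : Prop :=
  IsFock Ψ ∧ IsFock Ξ ∧ ∀ (n : ℕ) (h : Fin n → B.domain),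
    ∑ j, tensorPairing b (Function.update (fun l => (h l : H)) j (B (h j))) (Ψ n) =
      tensorPairing b (fun l => (h l : H)) (Ξ n)

/-- The Gaussian vector `Ψ_M = exp(½ a⁺Ma⁺)|0⟩`; in each sector one term of the series survives. -/
def gaussian (b : HilbertBasis ι ℂ H) (M : H →L⋆[ℂ] H) : Family ι := fun n i =>
  ∑' m : ℕ, ((m.factorial : ℂ))⁻¹ *
    ((fun Φ : Family ι => (1 / 2 : ℂ) • createPair b M Φ)^[m] vacuum) n i

/-- Symmetry of the kernel: `(f, M g*) = (g, M f*)`. -/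
def IsSymmKernel (M : H →L⋆[ℂ] H) : Prop := ∀ f g : H, ⟪f, M g⟫_ℂ = ⟪g, M f⟫_ℂ

/-- `M` is Hilbert–Schmidt, maps into `D(B)`, and `B M` is Hilbert–Schmidt.  For symmetric `M` this
says that the kernel lies in the domains of `B ⊗ 1` and `1 ⊗ B`, which holds for every kernel in
`D(B) ⊗ D(B)`, be the tensor product algebraic or completed in the graph norm. -/
def HasKernelInDomain (b : HilbertBasis ι ℂ H) (B : H →ₗ.[ℂ] H) (M : H →L⋆[ℂ] H) : Prop :=
  (Summable fun p => ‖M (b p)‖ ^ 2) ∧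
    ∃ h : ∀ f : H, M f ∈ B.domain, Summable fun p => ‖B ⟨M (b p), h (b p)⟩‖ ^ 2

/-! ### The classical phase space and the constrained quadratic system -/

/-- The symplectic form `ω(f, g) = i ((f, g) - (g, f))` on `H` regarded as a real space. -/
def sympl (f g : H) : ℂ := Complex.I * (⟪f, g⟫_ℂ - ⟪g, f⟫_ℂ)

/-- The skew-orthogonal complement `ℒ^{⊥ω}`. -/
def skewOrthogonal (ℒ : Submodule ℝ H) : Submodule ℝ H where
  carrier := {χ | ∀ φ ∈ ℒ, sympl χ φ = 0}
  zero_mem' := by intro φ _; simp [sympl]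
  add_mem' := by
    intro x y hx hy φ hφ
    have h₁ := hx φ hφ
    have h₂ := hy φ hφ
    simp only [sympl, inner_add_left, inner_add_right] at h₁ h₂ ⊢
    linear_combination h₁ + h₂
  smul_mem' := by
    intro c x hx φ hφ
    have h₁ := hx φ hφ
    have hc : c • x = (c : ℂ) • x := rfl
    simp only [sympl, hc, inner_smul_left, inner_smul_right, Complex.conj_ofReal] at h₁ ⊢
    linear_combination (c : ℂ) * h₁

/-- The reduced phase space `ℛ = ℒ^{⊥ω} / ℒ`, with the quotient (semi)norm
`‖[χ]‖ = inf ‖χ + φ‖`, `φ ∈ ℒ`. -/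
abbrev Reduced (ℒ : Submodule ℝ H) : Type _ :=
  skewOrthogonal ℒ ⧸ ℒ.submoduleOf (skewOrthogonal ℒ)

/-- The class `[χ] ∈ ℛ` of `χ ∈ ℒ^{⊥ω}`. -/
def toReduced (ℒ : Submodule ℝ H) (χ : H) (hχ : χ ∈ skewOrthogonal ℒ) : Reduced ℒ :=
  Submodule.Quotient.mk ⟨χ, hχ⟩

/-- The generator `L φ = -i B φ - i A φ*` of the classical system, on `D(B)`; the second component
of `(φ, φ*)` evolves by the conjugate expression. -/
def generator (B : H →ₗ.[ℂ] H) (A : H →L⋆[ℂ] H) : B.domain →ₗ[ℝ] H where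
  toFun φ := -(Complex.I • B φ) - Complex.I • A φ
  map_add' x y := by
    simp only [B.map_add, Submodule.coe_add, map_add, smul_add]
    abel
  map_smul' c x := by
    have hB : B (c • x) = (c : ℂ) • B x := B.map_smul (c : ℂ) x
    have hA : A ((c • x : B.domain) : H) = (c : ℂ) • A x := by
      have h := A.map_smulₛₗ (c : ℂ) (x : H)
      rwa [Complex.conj_ofReal] at h
    have hc : ∀ v : H, (RingHom.id ℝ) c • v = (c : ℂ) • v := fun _ => rfl
    rw [hB, hA, hc, smul_sub, smul_neg, smul_comm (c : ℂ), smul_comm (c : ℂ)]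

/-- A quadratic Hamiltonian `½ a⁺Aa⁺ + a⁺Ba⁻ + ½ a⁻A*a⁻ + ε` together with a finite-dimensional
isotropic plane `ℒ` of constraints that is compatible with it. -/
structure QuadraticSystem [CompleteSpace H] (b : HilbertBasis ι ℂ H) where
  B : H →ₗ.[ℂ] H
  A : H →L⋆[ℂ] H
  ε : ℂ
  ℒ : Submodule ℝ H
  selfAdjoint : IsSelfAdjoint B
  symmA : IsSymmKernel A
  kernelA : HasKernelInDomain b B A
  finiteDimensional : FiniteDimensional ℝ ℒ
  isotropic : ∀ φ ∈ ℒ, ∀ ψ ∈ ℒ, sympl φ ψ = 0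
  le_domain : ∀ φ ∈ ℒ, φ ∈ B.domain
  invariant : ∀ φ : ℒ, generator B A ⟨φ, le_domain φ φ.2⟩ ∈ ℒ
  im_ε : ε.im = -(1 / 2) * LinearMap.trace ℝ ℒ
    (LinearMap.codRestrict ℒ
      (generator B A ∘ₗ
        LinearMap.codRestrict (B.domain.restrictScalars ℝ) ℒ.subtype (fun φ => le_domain φ φ.2))
      invariant)

namespace QuadraticSystem

variable [CompleteSpace H] {b : HilbertBasis ι ℂ H} (Q : QuadraticSystem b)

/-- The graph of the Hamiltonian on `S ∩ D(a⁺Ba⁻)`, with values in `S`: `H Ψ = Θ`. -/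
def IsHamiltonianImage (Ψ Θ : Family ι) : Prop :=
  IsSchwartz Ψ ∧ IsSchwartz Θ ∧ ∃ Ξ : Family ι, IsSecondQuantization b Q.B Ψ Ξ ∧
    Θ = (1 / 2 : ℂ) • createPair b Q.A Ψ + Ξ + (1 / 2 : ℂ) • annihilatePair b Q.A Ψ + Q.ε • Ψ

/-- The inner product `⟨Φ, Ψ⟩ = ∫_ℒ dμ(φ) (Φ, exp(iΩ[φ]) Ψ)` on `S`. -/
def physInner [MeasurableSpace H] (μ : Measure Q.ℒ) (Φ Ψ : Family ι) : ℂ :=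
  ∫ φ : Q.ℒ, fockInner Φ (weyl b (φ : H) Ψ) ∂μ

/-- Equivalence `Φ ∼ Ψ`: the difference has zero physical norm. -/
def Equivalent [MeasurableSpace H] (μ : Measure Q.ℒ) (Φ Ψ : Family ι) : Prop :=
  Q.physInner μ (Φ - Ψ) (Φ - Ψ) = 0

/-- `[Ψ]` is an eigenvector of the Hamiltonian in the physical Hilbert space. -/
def IsEigenvector [MeasurableSpace H] (μ : Measure Q.ℒ) (Ψ : Family ι) : Prop :=
  ¬ Q.Equivalent μ Ψ 0 ∧
    ∃ (E : ℂ) (Θ : Family ι), Q.IsHamiltonianImage Ψ Θ ∧ Q.Equivalent μ Θ (E • Ψ)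

/-- Solutions of `χ' = L χ`, in the weak sense: the equation holds after pairing with the elements
of `D(B)`, where `B` is moved to the test vector.  These are the classical solutions and, more
generally, the orbits `t ↦ u_t χ₀`, `χ₀ ∈ H`, of the continuous extension of the classical flow. -/
def IsSolution (χ : ℝ → H) : Prop :=
  Continuous χ ∧ ∀ (h : Q.B.domain) (t : ℝ),
    HasDerivAt (fun s => ⟪(h : H), χ s⟫_ℂ)
      (-(Complex.I * ⟪Q.B h, χ t⟫_ℂ) - Complex.I * ⟪(h : H), Q.A (χ t)⟫_ℂ) t

/-- Lyapunov stability in the reduced space `ℛ`, for all times of both signs; it includes that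
solutions starting in `ℒ^{⊥ω}` remain there, so that they define curves in `ℛ`. -/
def IsStable : Prop :=
  ∀ r > (0 : ℝ), ∃ δ > (0 : ℝ), ∀ χ : ℝ → H, Q.IsSolution χ →
    ∀ h₀ : χ 0 ∈ skewOrthogonal Q.ℒ, ‖toReduced Q.ℒ (χ 0) h₀‖ < δ →
      ∀ t : ℝ, ∃ h : χ t ∈ skewOrthogonal Q.ℒ, ‖toReduced Q.ℒ (χ t) h‖ < r

end QuadraticSystem

end ConstrainedFock

end

/-! Write `D v = a⁻[v] - a⁺[M v*]`. It annihilates `Ψ_M`, and it commutes with the constraints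
`Ω[φ]`, `φ ∈ ℒ`, when `v` is admissible: `(v, φ - M φ*) = 0` for all `φ ∈ ℒ`. Hence the adjoint of
`D v` for the Fock inner product is also its adjoint for the physical form. This form is positive
semidefinite, so null vectors are orthogonal to everything. Since
`(D v)² (H - E) Ψ_M = (v, R v*) Ψ_M` with the Riccati operator `R = A + B M + M B̄ + M A* M`, moving
`(D v)²` to the other side of `⟨Ψ_M, (D v)² (H - E) Ψ_M⟩` gives `(v, R v*) = 0` for the admissible
`v` in `D(B)`.

Every `χ ∈ ℒ^{⊥ω}` is `v + M v* + φ` with `v` admissible and `φ ∈ ℒ`, and `‖v‖² - ‖M v*‖²` is a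
function of the class of `χ` in `ℛ`, comparable to the square of its norm because `‖M‖ < 1`. Its
derivative along `χ' = L χ` is, up to a factor, the imaginary part of `(v, R v*)`, so it is
conserved. Weak solutions are reduced to classical ones by averaging over short time intervals. -/

noncomputable section

namespace ConstrainedFock

section NormedSpaces

variable {E F : Type*} [NormedAddCommGroup E] [NormedAddCommGroup F]

theorem exists_rightInverse_one_add {𝕜 : Type*} [NontriviallyNormedField 𝕜] [NormedSpace 𝕜 E]
    [CompleteSpace E] {T : E →L[𝕜] E} (hT : ‖T‖ < 1) :
    ∃ G : E →L[𝕜] E, ∀ x, G x + T (G x) = x := by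
  obtain ⟨u, hu⟩ := isUnit_one_sub_of_norm_lt_one (x := -T) (by rwa [norm_neg])
  refine ⟨(↑u⁻¹ : E →L[𝕜] E), fun x => ?_⟩
  have h := congrArg (fun S : E →L[𝕜] E => S x) u.mul_inv
  rw [hu] at h
  simpa using h

theorem exists_continuousLinearMap_apply_apply_eq {𝕜 : Type*} [NontriviallyNormedField 𝕜]
    [CompleteSpace 𝕜] [NormedSpace 𝕜 E] [NormedSpace 𝕜 F] [FiniteDimensional 𝕜 F]
    {S : Submodule 𝕜 E} (Λ : E →L[𝕜] F)
    (hinj : ∀ x ∈ S, Λ x = 0 → x = 0) (hdim : Module.finrank 𝕜 S = Module.finrank 𝕜 F) :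
    ∃ P : E →L[𝕜] S, ∀ x, Λ (P x) = Λ x := by
  have hker : Function.Injective (Λ.toLinearMap ∘ₗ S.subtype) :=
    (injective_iff_map_eq_zero _).2 fun x hx => Subtype.ext (hinj x x.2 hx)
  let e : S ≃ₗ[𝕜] F := LinearEquiv.ofInjectiveOfFinrankEq _ hker hdim
  exact ⟨LinearMap.toContinuousLinearMap e.symm.toLinearMap ∘L Λ,
    fun x => e.apply_symm_apply (Λ x)⟩

theorem dual_eq_zero_of_hasDerivAt {V : Type*} [AddCommGroup V] [Module ℝ V]
    [FiniteDimensional ℝ V] (Λ : V →ₗ[ℝ] V) {x : ℝ → Module.Dual ℝ V}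
    (hx : ∀ t v, HasDerivAt (fun s => x s v) (x t (Λ v)) t) {t₀ : ℝ} (h₀ : x t₀ = 0) : x = 0 := by
  let bs := Module.finBasis ℝ V
  let G : (Fin (Module.finrank ℝ V) → ℝ) →L[ℝ] (Fin (Module.finrank ℝ V) → ℝ) :=
    ContinuousLinearMap.pi fun j => ∑ l, bs.repr (Λ (bs j)) l • ContinuousLinearMap.proj l
  have hcoord : ∀ t, HasDerivAt (fun s j => x s (bs j)) (G fun j => x t (bs j)) t := by
    refine fun t => hasDerivAt_pi.2 fun j => ?_
    have h := hx t (bs j)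
    rw [← bs.sum_repr (Λ (bs j)), map_sum] at h
    simpa [G] using h
  have hzero : (fun s j => x s (bs j)) = 0 :=
    ODE_solution_unique_univ (v := fun _ => G) (s := fun _ => Set.univ) (t₀ := t₀)
      (fun _ => G.lipschitz.lipschitzOnWith) (fun t => ⟨hcoord t, Set.mem_univ _⟩)
      (fun t => ⟨by simp, Set.mem_univ _⟩) (by ext j; simp [h₀])
  exact funext fun t => bs.ext fun j => congrFun (congrFun hzero t) j

variable [NormedSpace ℝ E] [CompleteSpace E]

theorem hasDerivAt_integral_add_const {f : ℝ → E} (hf : Continuous f) (ε t : ℝ) :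
    HasDerivAt (fun u => ∫ s in u..u + ε, f s) (f (t + ε) - f t) t := by
  have hint : ∀ u, HasDerivAt (fun u => ∫ s in (0 : ℝ)..u, f s) (f u) u := fun u =>
    intervalIntegral.integral_hasDerivAt_right (hf.intervalIntegrable _ _)
      (hf.stronglyMeasurableAtFilter _ _) hf.continuousAt
  refine (((hint (t + ε)).comp_add_const t ε).sub (hint t)).congr_of_eventuallyEq
    (Eventually.of_forall fun u => ?_)
  exact (intervalIntegral.integral_interval_sub_left (hf.intervalIntegrable _ _)
    (hf.intervalIntegrable _ _)).symm

theorem tendsto_inv_smul_integral_add {f : ℝ → E} (hf : Continuous f) (t : ℝ) :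
    Tendsto (fun ε : ℝ => ε⁻¹ • ∫ s in t..t + ε, f s) (𝓝[≠] 0) (𝓝 (f t)) := by
  have h : HasDerivAt (fun u => ∫ s in t..u, f s) (f t) t :=
    intervalIntegral.integral_hasDerivAt_right (hf.intervalIntegrable _ _)
      (hf.stronglyMeasurableAtFilter _ _) hf.continuousAt
  simpa using h.tendsto_slope_zero

end NormedSpaces

section SelfAdjoint

variable {H : Type*} [NormedAddCommGroup H] [InnerProductSpace ℂ H] [CompleteSpace H]
  {B : H →ₗ.[ℂ] H}

theorem exists_apply_eq_of_isSelfAdjoint (hB : IsSelfAdjoint B) {x w : H}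
    (h : ∀ y : B.domain, ⟪w, y⟫_ℂ = ⟪x, B y⟫_ℂ) : ∃ hx : x ∈ B.domain, B ⟨x, hx⟩ = w := by
  have hle : B.adjoint ≤ B := le_of_eq hB
  have hx : x ∈ B.adjoint.domain := B.mem_adjoint_domain_of_exists x ⟨w, h⟩
  refine ⟨hle.1 hx, ?_⟩
  rw [← hle.2 (x := ⟨x, hx⟩) rfl]
  exact LinearPMap.adjoint_apply_eq hB.dense_domain _ h

theorem inner_apply_of_isSelfAdjoint (hB : IsSelfAdjoint B) (x y : B.domain) :
    ⟪B x, (y : H)⟫_ℂ = ⟪(x : H), B y⟫_ℂ := by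
  have h := LinearPMap.adjoint_isFormalAdjoint hB.dense_domain
  rw [LinearPMap.isSelfAdjoint_def.1 hB] at h
  exact h x y

theorem im_inner_apply_self_of_isSelfAdjoint (hB : IsSelfAdjoint B) (x : B.domain) :
    (⟪(x : H), B x⟫_ℂ).im = 0 := by
  rw [← Complex.conj_eq_iff_im, inner_conj_symm, inner_apply_of_isSelfAdjoint hB]

end SelfAdjoint

section ConjugateLinear

attribute [local instance] InnerProductSpace.complexToReal

variable {H : Type*} [NormedAddCommGroup H] [InnerProductSpace ℂ H]

/-- A conjugate-linear operator, such as `φ ↦ M φ*`, regarded as a real-linear operator. -/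
def toRealCLM (M : H →L⋆[ℂ] H) : H →L[ℝ] H where
  toFun := M
  map_add' := M.map_add
  map_smul' c x := by
    have h := M.map_smulₛₗ (c : ℂ) x
    rwa [Complex.conj_ofReal] at h
  cont := M.continuous

@[simp]
theorem toRealCLM_apply (M : H →L⋆[ℂ] H) (x : H) : toRealCLM M x = M x := rfl

theorem norm_toRealCLM_le (M : H →L⋆[ℂ] H) : ‖toRealCLM M‖ ≤ ‖M‖ :=
  ContinuousLinearMap.opNorm_le_bound _ (norm_nonneg _) M.le_opNorm

theorem real_inner_eq_re (x y : H) : ⟪x, y⟫_ℝ = (⟪x, y⟫_ℂ).re := rfl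

theorem IsSymmKernel.real_inner_apply {M : H →L⋆[ℂ] H} (hM : IsSymmKernel M) (x y : H) :
    ⟪M x, y⟫_ℝ = ⟪x, M y⟫_ℝ := by
  rw [real_inner_comm, real_inner_eq_re, real_inner_eq_re, hM]

theorem sympl_eq_zero_iff {f g : H} : sympl f g = 0 ↔ (⟪g, f⟫_ℂ).im = 0 := by
  rw [sympl, mul_eq_zero, or_iff_right Complex.I_ne_zero, ← inner_conj_symm, ← neg_eq_zero,
    neg_sub, Complex.sub_conj]
  simp

theorem mem_skewOrthogonal {ℒ : Submodule ℝ H} {χ : H} :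
    χ ∈ skewOrthogonal ℒ ↔ ∀ φ ∈ ℒ, (⟪φ, χ⟫_ℂ).im = 0 :=
  forall₂_congr fun _ _ => sympl_eq_zero_iff

/-- The real-linear functional `χ ↦ Im (φ, χ)`, up to normalization `ω(χ, φ)`. -/
def imInner (φ : H) : H →L[ℝ] ℝ := Complex.imCLM ∘L (innerSL ℂ φ).restrictScalars ℝ

@[simp]
theorem imInner_apply (φ χ : H) : imInner φ χ = (⟪φ, χ⟫_ℂ).im := rfl

theorem intervalIntegral_mem_skewOrthogonal [CompleteSpace H] {ℒ : Submodule ℝ H} {χ : ℝ → H}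
    (hχ : Continuous χ) (hmem : ∀ t, χ t ∈ skewOrthogonal ℒ) (a c : ℝ) :
    ∫ s in a..c, χ s ∈ skewOrthogonal ℒ := by
  refine mem_skewOrthogonal.2 fun φ hφ => ?_
  rw [← imInner_apply, ← (imInner φ).intervalIntegral_comp_comm (hχ.intervalIntegrable a c)]
  simp only [imInner_apply, mem_skewOrthogonal.1 (hmem _) φ hφ, intervalIntegral.integral_zero]

theorem mem_skewOrthogonal_of_hasDerivAt {ℒ : Submodule ℝ H} {χ : ℝ → H} {χ' : H} {t : ℝ}
    (hχ : HasDerivAt χ χ' t) (hmem : ∀ t, χ t ∈ skewOrthogonal ℒ) : χ' ∈ skewOrthogonal ℒ := by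
  refine mem_skewOrthogonal.2 fun φ hφ => ?_
  have h := (imInner φ).hasFDerivAt.comp_hasDerivAt t hχ
  have hzero : imInner φ ∘ χ = fun _ => 0 := funext fun s => mem_skewOrthogonal.1 (hmem s) φ hφ
  rw [hzero] at h
  exact h.unique (hasDerivAt_const t 0)

/-- The vectors `v` for which `a⁻[v] - a⁺[M v*]` commutes with the constraints `Ω[φ]`, `φ ∈ ℒ`. -/
def IsAdmissible (M : H →L⋆[ℂ] H) (ℒ : Submodule ℝ H) (v : H) : Prop :=
  ∀ φ ∈ ℒ, ⟪v, φ - M φ⟫_ℂ = 0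

/-- A bounded choice of the vector `v` in the decomposition `χ = v + M v* + φ` of the elements `χ`
of `ℒ^{⊥ω}`, with `v` admissible and `φ ∈ ℒ`. -/
def IsReduction (M : H →L⋆[ℂ] H) (ℒ : Submodule ℝ H) (V : H →L[ℝ] H) : Prop :=
  ∀ χ ∈ skewOrthogonal ℒ, IsAdmissible M ℒ (V χ) ∧ ∃ φ ∈ ℒ, χ = V χ + M (V χ) + φ

theorem IsAdmissible.real_inner_sub_apply {M : H →L⋆[ℂ] H} (hs : IsSymmKernel M)
    {ℒ : Submodule ℝ H} {v φ : H} (hv : IsAdmissible M ℒ v) (hφ : φ ∈ ℒ) :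
    ⟪v - M v, φ⟫_ℝ = 0 := by
  rw [inner_sub_left, hs.real_inner_apply, ← inner_sub_right, real_inner_eq_re, hv φ hφ,
    Complex.zero_re]

theorem IsAdmissible.real_inner_sub_add {M : H →L⋆[ℂ] H} (hs : IsSymmKernel M)
    {ℒ : Submodule ℝ H} {v φ : H} (hv : IsAdmissible M ℒ v) (hφ : φ ∈ ℒ) (w : H) :
    ⟪v - M v, w + M w + φ⟫_ℝ = ⟪v, w⟫_ℝ - ⟪M v, M w⟫_ℝ := by
  rw [inner_add_right, hv.real_inner_sub_apply hs hφ, inner_sub_left, inner_add_right,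
    inner_add_right, hs.real_inner_apply v w]
  ring

theorem IsAdmissible.one_sub_norm_mul_norm_le {M : H →L⋆[ℂ] H} (hs : IsSymmKernel M)
    {ℒ : Submodule ℝ H} {v φ : H} (hv : IsAdmissible M ℒ v) (hφ : φ ∈ ℒ) :
    (1 - ‖M‖) * ‖v‖ ≤ ‖v + M v + φ‖ := by
  have hsq : ‖v‖ ^ 2 - ‖M v‖ ^ 2 ≤ (‖v‖ + ‖M v‖) * ‖v + M v + φ‖ :=
    calc ‖v‖ ^ 2 - ‖M v‖ ^ 2 = ⟪v - M v, v + M v + φ⟫_ℝ := by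
          rw [hv.real_inner_sub_add hs hφ, real_inner_self_eq_norm_sq, real_inner_self_eq_norm_sq]
      _ ≤ ‖v - M v‖ * ‖v + M v + φ‖ := real_inner_le_norm _ _
      _ ≤ (‖v‖ + ‖M v‖) * ‖v + M v + φ‖ := by gcongr; exact norm_sub_le _ _
  rcases eq_or_ne v 0 with rfl | hv0
  · simp
  have hpos : 0 < ‖v‖ + ‖M v‖ := add_pos_of_pos_of_nonneg (norm_pos_iff.2 hv0) (norm_nonneg _)
  have hsub : ‖v‖ - ‖M v‖ ≤ ‖v + M v + φ‖ :=
    le_of_mul_le_mul_left (by linear_combination hsq) hpos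
  linarith [M.le_opNorm v]

theorem isAdmissible_of_real_inner_eq_zero {M : H →L⋆[ℂ] H} (hs : IsSymmKernel M)
    {ℒ : Submodule ℝ H} {v : H} (hv : v + M v ∈ skewOrthogonal ℒ)
    (h : ∀ φ ∈ ℒ, ⟪v, φ - M φ⟫_ℝ = 0) : IsAdmissible M ℒ v := by
  intro φ hφ
  refine Complex.ext (h φ hφ) ?_
  have him := mem_skewOrthogonal.1 hv φ hφ
  rw [inner_add_right, Complex.add_im, hs φ v, ← inner_conj_symm φ v, Complex.conj_im] at him
  rw [inner_sub_right, Complex.sub_im, Complex.zero_im]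
  linarith

-- For `v = (1 + M)⁻¹ (χ - φ)` the conditions `Re (v, ψ - M ψ*) = 0`, `ψ ∈ ℒ`, are `dim ℒ` real
-- linear equations for `φ ∈ ℒ`, nondegenerate because `‖v‖² - ‖M v*‖²` is coercive.
theorem exists_isReduction [CompleteSpace H] {M : H →L⋆[ℂ] H} (hM : ‖M‖ < 1)
    (hs : IsSymmKernel M) (ℒ : Submodule ℝ H) [FiniteDimensional ℝ ℒ]
    (hiso : ∀ φ ∈ ℒ, ∀ ψ ∈ ℒ, sympl φ ψ = 0) : ∃ V : H →L[ℝ] H, IsReduction M ℒ V := by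
  obtain ⟨G, hG⟩ := exists_rightInverse_one_add ((norm_toRealCLM_le M).trans_lt hM)
  simp only [toRealCLM_apply] at hG
  let Λ : H →L[ℝ] ℒ →L[ℝ] ℝ := (innerSL ℝ).bilinearComp G
    ((ContinuousLinearMap.id ℝ H - toRealCLM M) ∘L ℒ.subtypeL)
  have hadm : ∀ χ ∈ skewOrthogonal ℒ, Λ χ = 0 → IsAdmissible M ℒ (G χ) := fun χ hχ h₀ =>
    isAdmissible_of_real_inner_eq_zero hs (by rwa [hG]) fun φ hφ => congrArg (· ⟨φ, hφ⟩) h₀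
  have hinj : ∀ φ ∈ ℒ, Λ φ = 0 → φ = 0 := by
    intro φ hφ h₀
    have hle := (hadm φ (hiso φ hφ) h₀).one_sub_norm_mul_norm_le hs (ℒ.neg_mem hφ)
    rw [hG, add_neg_cancel, norm_zero] at hle
    have hGφ : G φ = 0 := norm_le_zero_iff.1 (nonpos_of_mul_nonpos_right hle (sub_pos.2 hM))
    rw [← hG φ, hGφ, map_zero, add_zero]
  have hdim : Module.finrank ℝ ℒ = Module.finrank ℝ (ℒ →L[ℝ] ℝ) := by
    rw [← (LinearMap.toContinuousLinearMap (E := ℒ) (F' := ℝ) (𝕜 := ℝ)).finrank_eq]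
    exact (Subspace.dual_finrank_eq (K := ℝ) (V := ℒ)).symm
  obtain ⟨P, hP⟩ := exists_continuousLinearMap_apply_apply_eq (𝕜 := ℝ) (F := ℒ →L[ℝ] ℝ) Λ hinj hdim
  refine ⟨G ∘L (ContinuousLinearMap.id ℝ H - ℒ.subtypeL ∘L P), fun χ hχ =>
    ⟨hadm (χ - P χ) (Submodule.sub_mem _ hχ (hiso _ (P χ).2)) ?_, P χ, (P χ).2, ?_⟩⟩
  · rw [map_sub, hP, sub_self]
  · have h := hG (χ - P χ)
    exact sub_eq_iff_eq_add.1 h.symm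

end ConjugateLinear

/-! ### Conservation law and stability of the classical system -/

section ClassicalDynamics

attribute [local instance] InnerProductSpace.complexToReal

variable {ι H : Type*} [NormedAddCommGroup H] [InnerProductSpace ℂ H]

theorem generator_apply (B : H →ₗ.[ℂ] H) (A : H →L⋆[ℂ] H) (x : B.domain) :
    generator B A x = -(Complex.I • B x) - Complex.I • A x := rfl

/-- The value at `v*` of the Riccati operator `A + B M + M B̄ + M A* M : H* → H`. -/
def riccatiDefect (B : H →ₗ.[ℂ] H) (A M : H →L⋆[ℂ] H) (hMd : ∀ f, M f ∈ B.domain)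
    (v : B.domain) : H :=
  A v + B ⟨M v, hMd v⟩ + M (B v) + M (A (M v))

theorem real_inner_sub_generator_eq_zero [CompleteSpace H] {B : H →ₗ.[ℂ] H}
    (hB : IsSelfAdjoint B) {A M : H →L⋆[ℂ] H} (hA : IsSymmKernel A) (hs : IsSymmKernel M)
    (hMd : ∀ f, M f ∈ B.domain) {v : B.domain}
    (hv : ⟪(v : H), riccatiDefect B A M hMd v⟫_ℂ = 0) :
    ⟪(v : H) - M v, generator B A (v + ⟨M v, hMd v⟩)⟫_ℝ = 0 := by
  have hvB := im_inner_apply_self_of_isSelfAdjoint hB v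
  have hmB := im_inner_apply_self_of_isSelfAdjoint hB ⟨M v, hMd v⟩
  have hcross : (⟪(v : H), M (B v)⟫_ℂ).im = -(⟪M v, B v⟫_ℂ).im := by
    rw [hs, ← inner_conj_symm, Complex.conj_im]
  have hAM : (⟪(v : H), M (A (M v))⟫_ℂ).im = -(⟪M v, A (M v)⟫_ℂ).im := by
    rw [hs, ← inner_conj_symm, Complex.conj_im]
  have hAv : ⟪(v : H), A (M v)⟫_ℂ = ⟪M v, A v⟫_ℂ := hA _ _
  have hric := congrArg Complex.im hv
  simp only [riccatiDefect, inner_add_right, Complex.add_im, Complex.zero_im, hcross, hAM] at hric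
  rw [generator_apply, ← neg_add', ← smul_add, B.map_add, Submodule.coe_add, map_add,
    inner_neg_right, real_inner_eq_re, inner_smul_right, Complex.I_mul_re, neg_neg]
  simp only [inner_sub_left, inner_add_right, Complex.sub_im, Complex.add_im, hAv]
  linear_combination hric + hvB - hmB

theorem one_sub_norm_mul_norm_le_of_norm_sq_sub_eq {M : H →L⋆[ℂ] H} (hM : ‖M‖ ≤ 1) {v w : H}
    (h : ‖v‖ ^ 2 - ‖M v‖ ^ 2 = ‖w‖ ^ 2 - ‖M w‖ ^ 2) : (1 - ‖M‖) * ‖v‖ ≤ ‖w‖ := by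
  have hMv : ‖M v‖ ^ 2 ≤ (‖M‖ * ‖v‖) ^ 2 := by gcongr; exact M.le_opNorm v
  have hcross : 0 ≤ ‖M‖ * (1 - ‖M‖) * ‖v‖ ^ 2 := by have := sub_nonneg.2 hM; positivity
  refine le_of_sq_le_sq ?_ (norm_nonneg _)
  nlinarith [sq_nonneg ‖M w‖]

namespace QuadraticSystem

variable [CompleteSpace H] {b : HilbertBasis ι ℂ H} {Q : QuadraticSystem b}

variable (Q) in
/-- The restriction `L|_ℒ` of the classical generator to the constraint plane. -/
def constraintGenerator : Q.ℒ →ₗ[ℝ] Q.ℒ :=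
  LinearMap.codRestrict Q.ℒ
    (generator Q.B Q.A ∘ₗ LinearMap.codRestrict (Q.B.domain.restrictScalars ℝ) Q.ℒ.subtype
      fun φ => Q.le_domain φ φ.2)
    Q.invariant

theorem coe_constraintGenerator (φ : Q.ℒ) :
    (Q.constraintGenerator φ : H) = generator Q.B Q.A ⟨φ, Q.le_domain φ φ.2⟩ := rfl

theorem IsSolution.hasDerivAt_imInner {χ : ℝ → H} (hχ : Q.IsSolution χ) (φ : Q.ℒ) (t : ℝ) :
    HasDerivAt (fun s => imInner (φ : H) (χ s))
      (imInner (-Q.constraintGenerator φ : H) (χ t)) t := by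
  have h := Complex.imCLM.hasFDerivAt.comp_hasDerivAt t
    (hχ.2 ⟨φ, Q.le_domain φ φ.2⟩ t)
  refine h.congr_deriv ?_
  rw [imInner_apply, coe_constraintGenerator, generator_apply, Q.symmA, ← inner_conj_symm (χ t)]
  simp only [inner_sub_left, inner_neg_left, inner_smul_left, Complex.conj_I, Complex.imCLM_apply]
  simp only [Complex.sub_im, Complex.neg_im, Complex.I_mul_im, Complex.conj_re, neg_mul,
    neg_neg]
  ring

-- The functionals `φ ↦ Im (φ, χ t)` on `ℒ` solve a linear differential equation, because `ℒ` is
-- invariant under the generator.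
theorem IsSolution.mem_skewOrthogonal {χ : ℝ → H} (hχ : Q.IsSolution χ)
    (h₀ : χ 0 ∈ skewOrthogonal Q.ℒ) (t : ℝ) : χ t ∈ skewOrthogonal Q.ℒ := by
  have := Q.finiteDimensional
  let x : ℝ → Module.Dual ℝ Q.ℒ := fun s =>
    -((imInner (χ s)).toLinearMap ∘ₗ Q.ℒ.subtype)
  have hx_apply : ∀ s φ, x s φ = imInner (φ : H) (χ s) := fun s φ => by
    simp only [x, LinearMap.neg_apply, LinearMap.comp_apply, Submodule.subtype_apply,
      ContinuousLinearMap.coe_coe, imInner_apply]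
    rw [← inner_conj_symm, Complex.conj_im, neg_neg]
  have hx : ∀ s φ, HasDerivAt (fun s => x s φ) (x s ((-Q.constraintGenerator) φ)) s := fun s φ => by
    simpa only [hx_apply, LinearMap.neg_apply, Submodule.coe_neg] using
      hχ.hasDerivAt_imInner φ s
  have hx₀ : x 0 = 0 := LinearMap.ext fun φ => by
    rw [hx_apply]
    exact ConstrainedFock.mem_skewOrthogonal.1 h₀ φ φ.2
  have hzero := dual_eq_zero_of_hasDerivAt _ hx hx₀
  refine ConstrainedFock.mem_skewOrthogonal.2 fun φ hφ => ?_
  rw [← imInner_apply, ← hx_apply t ⟨φ, hφ⟩, hzero]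
  rfl

variable (Q) in
/-- Classical (norm-differentiable, `D(B)`-valued) solutions of `χ' = L χ`. -/
def IsStrongSolution (X : ℝ → H) : Prop :=
  ∀ t, ∃ h : X t ∈ Q.B.domain, HasDerivAt X (generator Q.B Q.A ⟨X t, h⟩) t

theorem IsSolution.inner_sub_eq {χ : ℝ → H} (hχ : Q.IsSolution χ) (h : Q.B.domain) (a c : ℝ) :
    ⟪(h : H), χ c - χ a⟫_ℂ = -(Complex.I * ⟪Q.B h, ∫ s in a..c, χ s⟫_ℂ) -
      Complex.I * ⟪(h : H), Q.A (∫ s in a..c, χ s)⟫_ℂ := by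
  have hc := hχ.1
  have hin : ∀ (w : H) {f : ℝ → H}, Continuous f →
      ⟪w, ∫ s in a..c, f s⟫_ℂ = ∫ s in a..c, ⟪w, f s⟫_ℂ := fun w f hf =>
    ((innerSL ℂ w).intervalIntegral_comp_comm (hf.intervalIntegrable _ _)).symm
  have hA : Q.A (∫ s in a..c, χ s) = ∫ s in a..c, Q.A (χ s) :=
    ((toRealCLM Q.A).intervalIntegral_comp_comm (hc.intervalIntegrable _ _)).symm
  have hAc : Continuous fun s => Q.A (χ s) := Q.A.continuous.comp hc
  rw [hA, hin _ hc, hin _ hAc, inner_sub_right,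
    ← intervalIntegral.integral_eq_sub_of_hasDerivAt (fun s _ => hχ.2 h s)
      (Continuous.intervalIntegrable (by fun_prop) _ _),
    intervalIntegral.integral_sub (Continuous.intervalIntegrable (by fun_prop) _ _)
      (Continuous.intervalIntegrable (by fun_prop) _ _),
    intervalIntegral.integral_neg, intervalIntegral.integral_const_mul,
    intervalIntegral.integral_const_mul]

theorem exists_generator_eq_of_inner_eq {x y : H}
    (h : ∀ w : Q.B.domain,
      ⟪(w : H), y⟫_ℂ = -(Complex.I * ⟪Q.B w, x⟫_ℂ) - Complex.I * ⟪(w : H), Q.A x⟫_ℂ) :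
    ∃ hx : x ∈ Q.B.domain, generator Q.B Q.A ⟨x, hx⟩ = y := by
  obtain ⟨hx, hBx⟩ := exists_apply_eq_of_isSelfAdjoint Q.selfAdjoint (x := x)
    (w := Complex.I • y - Q.A x) fun w => by
      have hw := congrArg (starRingEnd ℂ) (h w)
      rw [inner_conj_symm] at hw
      simp only [map_sub, map_neg, map_mul, Complex.conj_I, inner_conj_symm] at hw
      rw [inner_sub_left, inner_smul_left, Complex.conj_I, hw]
      linear_combination (⟪x, Q.B w⟫_ℂ + ⟪Q.A x, w⟫_ℂ) * (-Complex.I_mul_I)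
  refine ⟨hx, ?_⟩
  rw [generator_apply, hBx, smul_sub, smul_smul, Complex.I_mul_I]
  module

theorem IsSolution.isStrongSolution_integral {χ : ℝ → H} (hχ : Q.IsSolution χ) (ε : ℝ) :
    Q.IsStrongSolution fun t => ∫ s in t..t + ε, χ s := by
  intro t
  obtain ⟨hdom, hgen⟩ := exists_generator_eq_of_inner_eq fun h => hχ.inner_sub_eq h t (t + ε)
  exact ⟨hdom, (hasDerivAt_integral_add_const hχ.1 ε t).congr_deriv hgen.symm⟩

variable {M : H →L⋆[ℂ] H} {V : H →L[ℝ] H}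

theorem real_inner_reduction_generator_eq
    (hs : IsSymmKernel M) (hMd : ∀ f, M f ∈ Q.B.domain)
    (hR : ∀ v : Q.B.domain, IsAdmissible M Q.ℒ v →
      ⟪(v : H), riccatiDefect Q.B Q.A M hMd v⟫_ℂ = 0)
    (hV : IsReduction M Q.ℒ V) {x : Q.B.domain} (hx : (x : H) ∈ skewOrthogonal Q.ℒ) :
    ⟪V x - M (V x), generator Q.B Q.A x⟫_ℝ = 0 := by
  obtain ⟨hadm, φ, hφ, hdec⟩ := hV _ hx
  have hv : V x ∈ Q.B.domain := by
    rw [show V x = x - M (V x) - φ by rw [sub_sub, eq_sub_iff_add_eq, ← add_assoc, ← hdec]]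
    exact sub_mem (sub_mem x.2 (hMd _)) (Q.le_domain φ hφ)
  have hx_eq : x = (⟨V x, hv⟩ + ⟨M (V x), hMd _⟩) + ⟨φ, Q.le_domain φ hφ⟩ := Subtype.ext hdec
  have hgen : generator Q.B Q.A x = generator Q.B Q.A (⟨V x, hv⟩ + ⟨M (V x), hMd _⟩) +
      generator Q.B Q.A ⟨φ, Q.le_domain φ hφ⟩ := by
    conv_lhs => rw [hx_eq, map_add]
  rw [hgen, inner_add_right, hadm.real_inner_sub_apply hs (Q.invariant ⟨φ, hφ⟩), add_zero]
  exact real_inner_sub_generator_eq_zero Q.selfAdjoint Q.symmA hs hMd (hR ⟨V x, hv⟩ hadm)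

theorem IsStrongSolution.norm_sq_sub_norm_sq_eq
    (hs : IsSymmKernel M) (hMd : ∀ f, M f ∈ Q.B.domain)
    (hR : ∀ v : Q.B.domain, IsAdmissible M Q.ℒ v →
      ⟪(v : H), riccatiDefect Q.B Q.A M hMd v⟫_ℂ = 0)
    (hV : IsReduction M Q.ℒ V) {X : ℝ → H} (hX : Q.IsStrongSolution X)
    (hmem : ∀ t, X t ∈ skewOrthogonal Q.ℒ) (t : ℝ) :
    ‖V (X t)‖ ^ 2 - ‖M (V (X t))‖ ^ 2 = ‖V (X 0)‖ ^ 2 - ‖M (V (X 0))‖ ^ 2 := by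
  have hderiv : ∀ t, HasDerivAt (fun t => ‖V (X t)‖ ^ 2 - ‖M (V (X t))‖ ^ 2) 0 t := by
    intro t
    obtain ⟨hdom, hX'⟩ := hX t
    set X' := generator Q.B Q.A ⟨X t, hdom⟩ with hX'_def
    have hv : HasDerivAt (fun t => V (X t)) (V X') t := V.hasFDerivAt.comp_hasDerivAt t hX'
    have hMv : HasDerivAt (fun t => M (V (X t))) (M (V X')) t :=
      (toRealCLM M).hasFDerivAt.comp_hasDerivAt t hv
    obtain ⟨-, φ, hφ, hdec⟩ := hV _ (mem_skewOrthogonal_of_hasDerivAt hX' hmem)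
    have hzero := real_inner_reduction_generator_eq hs hMd hR hV (x := ⟨X t, hdom⟩) (hmem t)
    rw [← hX'_def, hdec, (hV _ (hmem t)).1.real_inner_sub_add hs hφ] at hzero
    exact (hv.norm_sq.sub hMv.norm_sq).congr_deriv (by linear_combination 2 * hzero)
  exact is_const_of_deriv_eq_zero (fun t => (hderiv t).differentiableAt)
    (fun t => (hderiv t).deriv) t 0

theorem IsSolution.norm_sq_sub_norm_sq_eq
    (hs : IsSymmKernel M) (hMd : ∀ f, M f ∈ Q.B.domain)
    (hR : ∀ v : Q.B.domain, IsAdmissible M Q.ℒ v →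
      ⟪(v : H), riccatiDefect Q.B Q.A M hMd v⟫_ℂ = 0)
    (hV : IsReduction M Q.ℒ V) {χ : ℝ → H} (hχ : Q.IsSolution χ)
    (h₀ : χ 0 ∈ skewOrthogonal Q.ℒ) (t : ℝ) :
    ‖V (χ t)‖ ^ 2 - ‖M (V (χ t))‖ ^ 2 = ‖V (χ 0)‖ ^ 2 - ‖M (V (χ 0))‖ ^ 2 := by
  have hcont : Continuous fun x : H => ‖V x‖ ^ 2 - ‖M (V x)‖ ^ 2 := by fun_prop
  have hsmul : ∀ (c : ℝ) (x : H),
      ‖V (c • x)‖ ^ 2 - ‖M (V (c • x))‖ ^ 2 = c ^ 2 * (‖V x‖ ^ 2 - ‖M (V x)‖ ^ 2) := fun c x => by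
    rw [map_smul, ← toRealCLM_apply M (c • V x), map_smul, toRealCLM_apply, norm_smul, norm_smul,
      Real.norm_eq_abs, mul_pow, mul_pow, sq_abs]
    ring
  have hlim := fun t => (hcont.tendsto _).comp (tendsto_inv_smul_integral_add hχ.1 t)
  refine tendsto_nhds_unique (hlim t) ((hlim 0).congr fun ε => ?_)
  simp only [Function.comp_apply, hsmul]
  rw [(hχ.isStrongSolution_integral ε).norm_sq_sub_norm_sq_eq hs hMd hR hV
    (fun t => intervalIntegral_mem_skewOrthogonal hχ.1 (hχ.mem_skewOrthogonal h₀) t (t + ε)) t]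

theorem one_sub_norm_mul_le_norm_toReduced (hs : IsSymmKernel M) (hV : IsReduction M Q.ℒ V)
    {χ : H} (hχ : χ ∈ skewOrthogonal Q.ℒ) :
    (1 - ‖M‖) * ‖V χ‖ ≤ ‖toReduced Q.ℒ χ hχ‖ := by
  refine le_of_forall_pos_lt_add fun r hr => ?_
  obtain ⟨⟨y, hy⟩, hyχ, hlt⟩ := Submodule.Quotient.norm_mk_lt (toReduced Q.ℒ χ hχ) hr
  have hmem : y - χ ∈ Q.ℒ :=
    (Submodule.Quotient.eq (Q.ℒ.submoduleOf (skewOrthogonal Q.ℒ))).1 hyχ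
  obtain ⟨hadm, φ, hφ, hdec⟩ := hV _ hχ
  have h := hadm.one_sub_norm_mul_norm_le hs (Q.ℒ.add_mem hφ hmem)
  rw [← add_assoc, ← hdec, add_sub_cancel] at h
  exact h.trans_lt hlt

theorem norm_toReduced_le (hM : ‖M‖ ≤ 1) (hV : IsReduction M Q.ℒ V) {χ : H}
    (hχ : χ ∈ skewOrthogonal Q.ℒ) : ‖toReduced Q.ℒ χ hχ‖ ≤ 2 * ‖V χ‖ := by
  obtain ⟨-, φ, hφ, hdec⟩ := hV _ hχ
  have hsub : V χ + M (V χ) = χ - φ := by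
    rw [eq_sub_iff_add_eq, ← hdec]
  have hmem : V χ + M (V χ) ∈ skewOrthogonal Q.ℒ := by
    rw [hsub]
    exact sub_mem hχ (Q.isotropic φ hφ)
  have hclass : toReduced Q.ℒ χ hχ = Submodule.Quotient.mk ⟨_, hmem⟩ := by
    refine (Submodule.Quotient.eq _).2 ?_
    change χ - (V χ + M (V χ)) ∈ Q.ℒ
    rwa [hsub, sub_sub_cancel]
  calc ‖toReduced Q.ℒ χ hχ‖ ≤ ‖V χ + M (V χ)‖ := by
        rw [hclass]
        exact Submodule.Quotient.norm_mk_le _ _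
    _ ≤ ‖V χ‖ + ‖M‖ * ‖V χ‖ := (norm_add_le _ _).trans (by gcongr; exact M.le_opNorm _)
    _ ≤ 2 * ‖V χ‖ := by nlinarith [norm_nonneg (V χ)]

theorem isStable_of_inner_riccatiDefect_eq_zero (hM : ‖M‖ < 1) (hs : IsSymmKernel M)
    (hMd : ∀ f, M f ∈ Q.B.domain)
    (hR : ∀ v : Q.B.domain, IsAdmissible M Q.ℒ v →
      ⟪(v : H), riccatiDefect Q.B Q.A M hMd v⟫_ℂ = 0) : Q.IsStable := by
  have := Q.finiteDimensional
  obtain ⟨V, hV⟩ := exists_isReduction hM hs Q.ℒ Q.isotropic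
  intro r hr
  have : 0 < 1 - ‖M‖ := sub_pos.2 hM
  refine ⟨r * (1 - ‖M‖) ^ 2 / 2, by positivity, fun χ hχ h₀ hδ t => ?_⟩
  have ht := hχ.mem_skewOrthogonal h₀ t
  refine ⟨ht, ?_⟩
  have hcons : (1 - ‖M‖) * ‖V (χ t)‖ ≤ ‖V (χ 0)‖ :=
    one_sub_norm_mul_norm_le_of_norm_sq_sub_eq hM.le
      (hχ.norm_sq_sub_norm_sq_eq hs hMd hR hV h₀ t)
  have hsmall : (1 - ‖M‖) ^ 2 * ‖V (χ t)‖ < (1 - ‖M‖) ^ 2 * (r / 2) :=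
    calc (1 - ‖M‖) ^ 2 * ‖V (χ t)‖ = (1 - ‖M‖) * ((1 - ‖M‖) * ‖V (χ t)‖) := by ring
      _ ≤ (1 - ‖M‖) * ‖V (χ 0)‖ := by gcongr
      _ ≤ ‖toReduced Q.ℒ (χ 0) h₀‖ := one_sub_norm_mul_le_norm_toReduced hs hV h₀
      _ < (1 - ‖M‖) ^ 2 * (r / 2) := hδ.trans_eq (by ring)
  have hVt := lt_of_mul_lt_mul_left hsmall (by positivity)
  linarith [norm_toReduced_le hM.le hV ht]

end QuadraticSystem

end ClassicalDynamics

/-! ### Square-summable functions and tensors -/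

section SquareSummable

variable {α β E : Type*} [NormedAddCommGroup E]

/-- Square-summable functions; unlike `Memℓp · 2` the definition matches the norms of Fock space. -/
def SquareSummable (f : α → E) : Prop := Summable fun a => ‖f a‖ ^ 2

/-- The square of the `ℓ²` norm. -/
def sqNorm (f : α → E) : ℝ := ∑' a, ‖f a‖ ^ 2

theorem sqNorm_nonneg (f : α → E) : 0 ≤ sqNorm f := tsum_nonneg fun _ => by positivity

theorem squareSummable_iff_memℓp {f : α → E} : SquareSummable f ↔ Memℓp f 2 := by
  rw [memℓp_gen_iff (by norm_num)]
  simp [SquareSummable]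

theorem SquareSummable.add {f g : α → E} (hf : SquareSummable f) (hg : SquareSummable g) :
    SquareSummable (f + g) :=
  squareSummable_iff_memℓp.2 ((squareSummable_iff_memℓp.1 hf).add (squareSummable_iff_memℓp.1 hg))

theorem SquareSummable.sub {f g : α → E} (hf : SquareSummable f) (hg : SquareSummable g) :
    SquareSummable (f - g) :=
  squareSummable_iff_memℓp.2 ((squareSummable_iff_memℓp.1 hf).sub (squareSummable_iff_memℓp.1 hg))

theorem squareSummable_zero : SquareSummable (0 : α → E) :=
  squareSummable_iff_memℓp.2 zero_memℓp

theorem SquareSummable.const_smul {𝕜 : Type*} [NormedField 𝕜] [NormedSpace 𝕜 E] {f : α → E}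
    (hf : SquareSummable f) (c : 𝕜) : SquareSummable (c • f) :=
  squareSummable_iff_memℓp.2 ((squareSummable_iff_memℓp.1 hf).const_smul c)

theorem squareSummable_sum {κ : Type*} {s : Finset κ} {f : κ → α → E}
    (hf : ∀ k ∈ s, SquareSummable (f k)) : SquareSummable (∑ k ∈ s, f k) :=
  Finset.sum_induction f SquareSummable (fun _ _ => SquareSummable.add) squareSummable_zero hf

theorem SquareSummable.of_le {f : α → E} {g : α → ℝ} (hg : Summable g)
    (h : ∀ a, ‖f a‖ ^ 2 ≤ g a) : SquareSummable f :=
  Summable.of_nonneg_of_le (fun _ => by positivity) h hg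

@[simp]
theorem sqNorm_zero : sqNorm (0 : α → E) = 0 := by simp [sqNorm]

theorem sqNorm_smul {𝕜 : Type*} [NormedField 𝕜] [NormedSpace 𝕜 E] (c : 𝕜) (f : α → E) :
    sqNorm (c • f) = ‖c‖ ^ 2 * sqNorm f := by
  simp only [sqNorm, Pi.smul_apply, norm_smul, mul_pow, tsum_mul_left]

theorem sqNorm_sum_le {κ : Type*} {s : Finset κ} {f : κ → α → E}
    (hf : ∀ k ∈ s, SquareSummable (f k)) :
    sqNorm (∑ k ∈ s, f k) ≤ s.card * ∑ k ∈ s, sqNorm (f k) := by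
  have hle : ∀ a, ‖(∑ k ∈ s, f k) a‖ ^ 2 ≤ s.card * ∑ k ∈ s, ‖f k a‖ ^ 2 := fun a => by
    rw [Finset.sum_apply]
    refine (pow_le_pow_left₀ (norm_nonneg _) (norm_sum_le _ _) 2).trans ?_
    exact sq_sum_le_card_mul_sum_sq
  have hsum : Summable fun a => (s.card : ℝ) * ∑ k ∈ s, ‖f k a‖ ^ 2 :=
    (summable_sum hf).mul_left _
  calc sqNorm (∑ k ∈ s, f k) ≤ ∑' a, s.card * ∑ k ∈ s, ‖f k a‖ ^ 2 :=
        (squareSummable_sum hf).tsum_le_tsum hle hsum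
    _ = s.card * ∑ k ∈ s, sqNorm (f k) := by
        rw [tsum_mul_left, Summable.tsum_finsetSum hf]
        rfl

theorem sqNorm_add_le {f g : α → E} (hf : SquareSummable f) (hg : SquareSummable g) :
    sqNorm (f + g) ≤ 2 * (sqNorm f + sqNorm g) := by
  simpa using sqNorm_sum_le (s := Finset.univ) (f := ![f, g])
    (by simp [Fin.forall_fin_two, hf, hg])

theorem SquareSummable.comp_injective {f : α → E} (hf : SquareSummable f) {e : β → α}
    (he : Function.Injective e) : SquareSummable fun x => f (e x) :=
  Summable.comp_injective hf he

theorem squareSummable_comp_equiv {f : α → E} (e : β ≃ α) :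
    (SquareSummable fun x => f (e x)) ↔ SquareSummable f :=
  e.summable_iff (f := fun a => ‖f a‖ ^ 2)

theorem sqNorm_comp_equiv (f : α → E) (e : β ≃ α) : sqNorm (fun x => f (e x)) = sqNorm f :=
  e.tsum_eq fun a => ‖f a‖ ^ 2

theorem squareSummable_prod_of_fiberwise {f : α × β → E}
    (h₁ : ∀ a, SquareSummable fun y => f (a, y)) (h₂ : Summable fun a => sqNorm fun y => f (a, y)) :
    SquareSummable f :=
  (summable_prod_of_nonneg fun _ => by positivity).2 ⟨h₁, h₂⟩

theorem SquareSummable.prod_mk_right {f : α × β → E} (hf : SquareSummable f) (y : β) :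
    SquareSummable fun a => f (a, y) :=
  hf.comp_injective (Prod.mk_left_injective y)

theorem SquareSummable.hasSum_sqNorm_prod_mk_right {f : α × β → E} (hf : SquareSummable f) :
    HasSum (fun y => sqNorm fun a => f (a, y)) (sqNorm f) := by
  have hswap : SquareSummable fun x : β × α => f x.swap :=
    (squareSummable_comp_equiv (Equiv.prodComm β α)).2 hf
  have h := (Summable.hasSum hswap).prod_fiberwise fun y => (hf.prod_mk_right y).hasSum
  rw [← sqNorm_comp_equiv f (Equiv.prodComm β α)]
  exact h

theorem tsum_prod_comm {F : α × β → E} [CompleteSpace E] (hF : Summable F) :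
    ∑' x, F x = ∑' y, ∑' x, F (x, y) := by
  rw [← (Equiv.prodComm β α).tsum_eq]
  exact Summable.tsum_prod ((Equiv.prodComm β α).summable_iff.2 hF)

end SquareSummable

section RCLikeValued

variable {α β 𝕜 : Type*} [RCLike 𝕜] {f g : α → 𝕜}

theorem squareSummable_lp (x : lp (fun _ : α => 𝕜) 2) : SquareSummable (x : α → 𝕜) :=
  squareSummable_iff_memℓp.2 (lp.memℓp x)

theorem sqNorm_lp (x : lp (fun _ : α => 𝕜) 2) : sqNorm (x : α → 𝕜) = ‖x‖ ^ 2 := by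
  have h := lp.norm_rpow_eq_tsum (p := 2) (by norm_num) x
  simp only [ENNReal.toReal_ofNat, Real.rpow_ofNat] at h
  exact h.symm

/-- A square-summable function as an element of `ℓ²`. -/
def SquareSummable.toLp (hf : SquareSummable f) : lp (fun _ : α => 𝕜) 2 :=
  ⟨f, squareSummable_iff_memℓp.1 hf⟩

@[simp]
theorem SquareSummable.toLp_apply (hf : SquareSummable f) (a : α) : hf.toLp a = f a := rfl

theorem SquareSummable.norm_toLp_sq (hf : SquareSummable f) : ‖hf.toLp‖ ^ 2 = sqNorm f :=
  (sqNorm_lp hf.toLp).symm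

theorem SquareSummable.conj (hf : SquareSummable f) :
    SquareSummable fun a => starRingEnd 𝕜 (f a) := by
  simpa [SquareSummable] using hf

theorem sqNorm_conj (f : α → 𝕜) : sqNorm (fun a => starRingEnd 𝕜 (f a)) = sqNorm f := by
  simp [sqNorm]

theorem SquareSummable.summable_mul (hf : SquareSummable f) (hg : SquareSummable g) :
    Summable fun a => f a * g a := by
  refine Summable.of_norm_bounded (Summable.add hf hg) fun a => ?_
  rw [norm_mul]
  nlinarith [two_mul_le_add_sq ‖f a‖ ‖g a‖, mul_nonneg (norm_nonneg (f a)) (norm_nonneg (g a))]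

theorem SquareSummable.norm_tsum_mul_sq_le (hf : SquareSummable f) (hg : SquareSummable g) :
    ‖∑' a, f a * g a‖ ^ 2 ≤ sqNorm f * sqNorm g := by
  have hinner : ∑' a, f a * g a = ⟪hf.conj.toLp, hg.toLp⟫_𝕜 := by
    rw [lp.inner_eq_tsum]
    refine tsum_congr fun a => ?_
    simp [mul_comm]
  rw [hinner, ← sqNorm_conj f, ← hf.conj.norm_toLp_sq, ← hg.norm_toLp_sq, ← mul_pow]
  exact pow_le_pow_left₀ (norm_nonneg _) (norm_inner_le_norm _ _) 2

theorem SquareSummable.tensor {g : β → 𝕜} (hf : SquareSummable f) (hg : SquareSummable g) :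
    SquareSummable fun x : α × β => f x.1 * g x.2 := by
  have h := Summable.mul_of_nonneg hf hg (fun _ => by positivity) (fun _ => by positivity)
  simpa [SquareSummable, mul_pow] using h

theorem SquareSummable.sqNorm_tensor {g : β → 𝕜} (hf : SquareSummable f)
    (hg : SquareSummable g) : sqNorm (fun x : α × β => f x.1 * g x.2) = sqNorm f * sqNorm g := by
  have h := Summable.mul_of_nonneg hf hg (fun _ => by positivity) (fun _ => by positivity)
  rw [sqNorm, sqNorm, sqNorm, Summable.tsum_mul_tsum hf hg h]
  simp [mul_pow]

end RCLikeValued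

section Coordinates

variable {ι 𝕜 H : Type*} [RCLike 𝕜] [NormedAddCommGroup H] [InnerProductSpace 𝕜 H]
  (b : HilbertBasis ι 𝕜 H)

theorem squareSummable_coord (x : H) : SquareSummable fun p => ⟪b p, x⟫_𝕜 := by
  simpa only [← HilbertBasis.repr_apply_apply] using squareSummable_lp (b.repr x)

theorem sqNorm_coord (x : H) : sqNorm (fun p => ⟪b p, x⟫_𝕜) = ‖x‖ ^ 2 := by
  simpa [← HilbertBasis.repr_apply_apply] using sqNorm_lp (b.repr x)

theorem squareSummable_coord_left (x : H) : SquareSummable fun p => ⟪x, b p⟫_𝕜 := by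
  simpa using (squareSummable_coord b x).conj

theorem sqNorm_coord_left (x : H) : sqNorm (fun p => ⟪x, b p⟫_𝕜) = ‖x‖ ^ 2 := by
  rw [← sqNorm_coord b x, ← sqNorm_conj]
  simp

theorem tsum_inner_basis_mul (q : ι) (c : ι → 𝕜) : ∑' p, ⟪b q, b p⟫_𝕜 * c p = c q := by
  classical
  simp [orthonormal_iff_ite.1 b.orthonormal]

end Coordinates

section Tensors

variable {ι 𝕜 : Type*} {n : ℕ}

section Insertion

variable [Mul 𝕜]

/-- The tensor `x ⊗ T` with the factor `x` moved to position `j`. -/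
def tensorAt (x : ι → 𝕜) (T : (Fin n → ι) → 𝕜) (j : Fin (n + 1)) : (Fin (n + 1) → ι) → 𝕜 :=
  fun i => x (i j) * T fun l => i (j.succAbove l)

theorem tensorAt_insertNthEquiv (x : ι → 𝕜) (T : (Fin n → ι) → 𝕜) (j : Fin (n + 1))
    (y : ι × (Fin n → ι)) :
    tensorAt x T j (Fin.insertNthEquiv (fun _ => ι) j y) = x y.1 * T y.2 := by
  simp [tensorAt]

end Insertion

theorem cons_comp_succAbove_succ (p : ι) (i : Fin (n + 1) → ι) (j : Fin (n + 1)) :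
    (fun l => (Fin.cons p i : Fin (n + 2) → ι) (j.succ.succAbove l)) =
      Fin.cons p fun l => i (j.succAbove l) := by
  funext l
  refine Fin.cases ?_ (fun l => ?_) l <;> simp

variable [RCLike 𝕜]

/-- The contraction of the first index of `T` with `y`. -/
def contract (y : ι → 𝕜) (T : (Fin (n + 1) → ι) → 𝕜) : (Fin n → ι) → 𝕜 :=
  fun i => ∑' p, y p * T (Fin.cons p i)

theorem tensorAt_smul (x : ι → 𝕜) (c : 𝕜) (T : (Fin n → ι) → 𝕜) (j : Fin (n + 1)) :
    tensorAt x (c • T) j = c • tensorAt x T j := by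
  funext i
  simp only [tensorAt, Pi.smul_apply, smul_eq_mul, mul_left_comm]

theorem SquareSummable.tensorAt {x : ι → 𝕜} {T : (Fin n → ι) → 𝕜} (hx : SquareSummable x)
    (hT : SquareSummable T) (j : Fin (n + 1)) : SquareSummable (tensorAt x T j) := by
  rw [← squareSummable_comp_equiv (Fin.insertNthEquiv (fun _ => ι) j)]
  simpa only [tensorAt_insertNthEquiv] using hx.tensor hT

theorem SquareSummable.sqNorm_tensorAt {x : ι → 𝕜} {T : (Fin n → ι) → 𝕜} (hx : SquareSummable x)
    (hT : SquareSummable T) (j : Fin (n + 1)) :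
    sqNorm (ConstrainedFock.tensorAt x T j) = sqNorm x * sqNorm T := by
  rw [← sqNorm_comp_equiv _ (Fin.insertNthEquiv (fun _ => ι) j), ← hx.sqNorm_tensor hT]
  simp only [tensorAt_insertNthEquiv]

theorem squareSummable_comp_cons {T : (Fin (n + 1) → ι) → 𝕜} (hT : SquareSummable T)
    (i : Fin n → ι) : SquareSummable fun p => T (Fin.cons p i) :=
  hT.comp_injective (Fin.cons_left_injective (α := fun _ => ι) i)

theorem summable_mul_cons {y : ι → 𝕜} {T : (Fin (n + 1) → ι) → 𝕜} (hy : SquareSummable y)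
    (hT : SquareSummable T) (i : Fin n → ι) : Summable fun p => y p * T (Fin.cons p i) :=
  hy.summable_mul (squareSummable_comp_cons hT i)

theorem contract_smul (y : ι → 𝕜) (c : 𝕜) (T : (Fin (n + 1) → ι) → 𝕜) :
    contract y (c • T) = c • contract y T := by
  funext i
  simp only [contract, Pi.smul_apply, smul_eq_mul, mul_left_comm _ c, tsum_mul_left]

theorem contract_add {y : ι → 𝕜} {S T : (Fin (n + 1) → ι) → 𝕜} (hy : SquareSummable y)
    (hS : SquareSummable S) (hT : SquareSummable T) :
    contract y (S + T) = contract y S + contract y T := by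
  funext i
  simp only [contract, Pi.add_apply, mul_add]
  exact (summable_mul_cons hy hS i).tsum_add (summable_mul_cons hy hT i)

theorem contract_add_left {x y : ι → 𝕜} {T : (Fin (n + 1) → ι) → 𝕜} (hx : SquareSummable x)
    (hy : SquareSummable y) (hT : SquareSummable T) :
    contract (x + y) T = contract x T + contract y T := by
  funext i
  simp only [contract, Pi.add_apply, add_mul]
  exact (summable_mul_cons hx hT i).tsum_add (summable_mul_cons hy hT i)

theorem contract_sum {κ : Type*} {s : Finset κ} {y : ι → 𝕜} {T : κ → (Fin (n + 1) → ι) → 𝕜}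
    (hy : SquareSummable y) (hT : ∀ k, SquareSummable (T k)) :
    contract y (∑ k ∈ s, T k) = ∑ k ∈ s, contract y (T k) := by
  funext i
  simp only [contract, Finset.sum_apply, Finset.mul_sum]
  exact Summable.tsum_finsetSum fun k _ => summable_mul_cons hy (hT k) i

theorem contract_tensorAt_zero (y x : ι → 𝕜) (T : (Fin n → ι) → 𝕜) :
    contract y (tensorAt x T 0) = (∑' p, y p * x p) • T := by
  funext i
  simp only [contract, tensorAt, Fin.cons_zero, Fin.zero_succAbove, Fin.cons_succ, ← mul_assoc,
    tsum_mul_right, Pi.smul_apply, smul_eq_mul]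

theorem contract_tensorAt_succ (y x : ι → 𝕜) (T : (Fin (n + 1) → ι) → 𝕜) (j : Fin (n + 1)) :
    contract y (tensorAt x T j.succ) = tensorAt x (contract y T) j := by
  funext i
  simp only [contract, tensorAt, Fin.cons_succ, cons_comp_succAbove_succ, mul_left_comm (y _),
    tsum_mul_left]

theorem SquareSummable.norm_contract_sq_le {y : ι → 𝕜} {T : (Fin (n + 1) → ι) → 𝕜}
    (hy : SquareSummable y) (hT : SquareSummable T) (i : Fin n → ι) :
    ‖contract y T i‖ ^ 2 ≤ sqNorm y * sqNorm fun p => T (Fin.cons p i) :=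
  hy.norm_tsum_mul_sq_le (squareSummable_comp_cons hT i)

theorem hasSum_sqNorm_comp_cons {T : (Fin (n + 1) → ι) → 𝕜} (hT : SquareSummable T) :
    HasSum (fun i : Fin n → ι => sqNorm fun p => T (Fin.cons p i)) (sqNorm T) := by
  have h := ((squareSummable_comp_equiv (Fin.consEquiv fun _ => ι)).2
    hT).hasSum_sqNorm_prod_mk_right
  rwa [sqNorm_comp_equiv] at h

theorem SquareSummable.contract {y : ι → 𝕜} {T : (Fin (n + 1) → ι) → 𝕜} (hy : SquareSummable y)
    (hT : SquareSummable T) : SquareSummable (contract y T) :=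
  .of_le ((hasSum_sqNorm_comp_cons hT).summable.mul_left _) (hy.norm_contract_sq_le hT)

theorem SquareSummable.sqNorm_contract_le {y : ι → 𝕜} {T : (Fin (n + 1) → ι) → 𝕜}
    (hy : SquareSummable y) (hT : SquareSummable T) :
    sqNorm (ConstrainedFock.contract y T) ≤ sqNorm y * sqNorm T := by
  have hsum := (hasSum_sqNorm_comp_cons hT).mul_left (sqNorm y)
  exact ((hy.contract hT).tsum_le_tsum (hy.norm_contract_sq_le hT) hsum.summable).trans_eq
    hsum.tsum_eq

theorem squareSummable_comp_cons_cons {T : (Fin (n + 2) → ι) → 𝕜} (hT : SquareSummable T)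
    (i : Fin n → ι) : SquareSummable fun x : ι × ι => T (Fin.cons x.1 (Fin.cons x.2 i)) := by
  refine hT.comp_injective
    (e := fun x : ι × ι => (Fin.cons x.1 (Fin.cons x.2 i) : Fin (n + 2) → ι)) ?_
  rintro ⟨p, q⟩ ⟨p', q'⟩ h
  have h := Fin.cons_injective2 h
  exact Prod.ext h.1 (Fin.cons_injective2 h.2).1

theorem contract_contract {x y : ι → 𝕜} {T : (Fin (n + 2) → ι) → 𝕜} (hx : SquareSummable x)
    (hy : SquareSummable y) (hT : SquareSummable T) (i : Fin n → ι) :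
    contract x (contract y T) i =
      ∑' p : ι × ι, (y p.1 * x p.2) * T (Fin.cons p.1 (Fin.cons p.2 i)) := by
  rw [tsum_prod_comm ((hy.tensor hx).summable_mul (squareSummable_comp_cons_cons hT i))]
  refine tsum_congr fun q => ?_
  rw [contract, ← tsum_mul_left]
  exact tsum_congr fun p => by ring

end Tensors

/-! ### Creation and annihilation of families -/

section CreationAnnihilation

variable {ι H : Type*} [NormedAddCommGroup H] [InnerProductSpace ℂ H] (b : HilbertBasis ι ℂ H)

/-- All `n`-particle components are square-summable; the norms need not be summable in `n`. -/
def HasSquareSummableSectors (Ψ : Family ι) : Prop := ∀ n, SquareSummable (Ψ n)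

/-- All `n`-particle components are symmetric functions. -/
def IsSymmFamily (Ψ : Family ι) : Prop :=
  ∀ (n : ℕ) (σ : Equiv.Perm (Fin n)) (i : Fin n → ι), Ψ n (i ∘ σ) = Ψ n i

theorem HasSquareSummableSectors.add {Ψ Φ : Family ι} (hΨ : HasSquareSummableSectors Ψ)
    (hΦ : HasSquareSummableSectors Φ) : HasSquareSummableSectors (Ψ + Φ) :=
  fun n => (hΨ n).add (hΦ n)

theorem HasSquareSummableSectors.sub {Ψ Φ : Family ι} (hΨ : HasSquareSummableSectors Ψ)
    (hΦ : HasSquareSummableSectors Φ) : HasSquareSummableSectors (Ψ - Φ) :=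
  fun n => (hΨ n).sub (hΦ n)

theorem HasSquareSummableSectors.const_smul {Ψ : Family ι} (hΨ : HasSquareSummableSectors Ψ)
    (c : ℂ) : HasSquareSummableSectors (c • Ψ) :=
  fun n => (hΨ n).const_smul c

theorem creation_succ (f : H) (Ψ : Family ι) (n : ℕ) (i : Fin (n + 1) → ι) :
    creation b f Ψ (n + 1) i = ((√(n + 1 : ℝ))⁻¹ : ℝ) *
      ∑ j : Fin (n + 1), ⟪b (i j), f⟫_ℂ * Ψ n (fun l => i (j.succAbove l)) := rfl

theorem creation_succ_eq_sum_tensorAt (f : H) (Ψ : Family ι) (n : ℕ) :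
    creation b f Ψ (n + 1) =
      (√(n + 1 : ℝ) : ℂ)⁻¹ • ∑ j, tensorAt (fun p => ⟪b p, f⟫_ℂ) (Ψ n) j := by
  funext i
  simp [creation_succ, tensorAt]

theorem annihilation_apply (f : H) (Ψ : Family ι) (n : ℕ) (i : Fin n → ι) :
    annihilation b f Ψ n i =
      (√(n + 1 : ℝ) : ℝ) * ∑' p : ι, ⟪f, b p⟫_ℂ * Ψ (n + 1) (Fin.cons p i) := rfl

theorem annihilation_eq_contract (f : H) (Ψ : Family ι) (n : ℕ) :
    annihilation b f Ψ n = (√(n + 1 : ℝ) : ℂ) • contract (fun p => ⟪f, b p⟫_ℂ) (Ψ (n + 1)) := rfl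

theorem sqrt_succ_ne_zero (n : ℕ) : (√(n + 1 : ℝ) : ℂ) ≠ 0 := by
  exact_mod_cast (Real.sqrt_pos.2 (by positivity : (0 : ℝ) < n + 1)).ne'

theorem norm_sqrt_succ_sq (n : ℕ) : ‖(√(n + 1 : ℝ) : ℂ)‖ ^ 2 = n + 1 := by
  rw [Complex.norm_real, Real.norm_eq_abs, sq_abs, Real.sq_sqrt (by positivity)]

theorem creation_add (f : H) (Ψ Φ : Family ι) :
    creation b f (Ψ + Φ) = creation b f Ψ + creation b f Φ := by
  funext n i
  cases n with
  | zero => simp [creation]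
  | succ n => simp [creation, mul_add, Finset.sum_add_distrib]

theorem creation_smul (f : H) (c : ℂ) (Ψ : Family ι) :
    creation b f (c • Ψ) = c • creation b f Ψ := by
  funext n i
  cases n with
  | zero => simp [creation]
  | succ n => simp [creation, Finset.mul_sum, mul_left_comm]

theorem creation_add_left (f g : H) (Ψ : Family ι) :
    creation b (f + g) Ψ = creation b f Ψ + creation b g Ψ := by
  funext n i
  cases n with
  | zero => simp [creation]
  | succ n => simp [creation, add_mul, mul_add, Finset.sum_add_distrib]

theorem annihilation_add (f : H) {Ψ Φ : Family ι} (hΨ : HasSquareSummableSectors Ψ)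
    (hΦ : HasSquareSummableSectors Φ) :
    annihilation b f (Ψ + Φ) = annihilation b f Ψ + annihilation b f Φ := by
  refine funext fun n => ?_
  simp only [annihilation_eq_contract, Pi.add_apply,
    contract_add (squareSummable_coord_left b f) (hΨ _) (hΦ _), smul_add]

theorem annihilation_smul (f : H) (c : ℂ) (Ψ : Family ι) :
    annihilation b f (c • Ψ) = c • annihilation b f Ψ := by
  refine funext fun n => ?_
  simp only [annihilation_eq_contract, Pi.smul_apply, contract_smul, smul_comm c]

theorem annihilation_add_left (f g : H) {Ψ : Family ι} (hΨ : HasSquareSummableSectors Ψ) :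
    annihilation b (f + g) Ψ = annihilation b f Ψ + annihilation b g Ψ := by
  refine funext fun n => ?_
  simp only [annihilation_eq_contract, Pi.add_apply, inner_add_left]
  rw [← smul_add, ← contract_add_left (squareSummable_coord_left b f)
    (squareSummable_coord_left b g) (hΨ _)]
  rfl

theorem squareSummable_creation_succ (f : H) {Ψ : Family ι} {n : ℕ} (hΨ : SquareSummable (Ψ n)) :
    SquareSummable (creation b f Ψ (n + 1)) := by
  rw [creation_succ_eq_sum_tensorAt]
  exact (squareSummable_sum fun j _ => (squareSummable_coord b f).tensorAt hΨ j).const_smul _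

theorem sqNorm_creation_succ_le (f : H) {Ψ : Family ι} {n : ℕ} (hΨ : SquareSummable (Ψ n)) :
    sqNorm (creation b f Ψ (n + 1)) ≤ (n + 1) * ‖f‖ ^ 2 * sqNorm (Ψ n) := by
  have hf := squareSummable_coord b f
  have hpos : (0 : ℝ) < n + 1 := by positivity
  have hsum := sqNorm_sum_le (s := Finset.univ) fun j _ => hf.tensorAt hΨ j
  simp only [hf.sqNorm_tensorAt hΨ, sqNorm_coord, Finset.sum_const, Finset.card_univ,
    Fintype.card_fin, nsmul_eq_mul, Nat.cast_succ] at hsum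
  rw [creation_succ_eq_sum_tensorAt, sqNorm_smul, norm_inv, inv_pow, norm_sqrt_succ_sq,
    inv_mul_le_iff₀ hpos]
  linarith

theorem sqNorm_annihilation_le (f : H) {Ψ : Family ι} {n : ℕ} (hΨ : SquareSummable (Ψ (n + 1))) :
    sqNorm (annihilation b f Ψ n) ≤ (n + 1) * ‖f‖ ^ 2 * sqNorm (Ψ (n + 1)) := by
  rw [annihilation_eq_contract, sqNorm_smul, norm_sqrt_succ_sq, mul_assoc, ← sqNorm_coord_left b f]
  gcongr
  exact (squareSummable_coord_left b f).sqNorm_contract_le hΨ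

theorem HasSquareSummableSectors.creation (f : H) {Ψ : Family ι}
    (hΨ : HasSquareSummableSectors Ψ) : HasSquareSummableSectors (creation b f Ψ)
  | 0 => squareSummable_zero
  | n + 1 => squareSummable_creation_succ b f (hΨ n)

theorem HasSquareSummableSectors.annihilation (f : H) {Ψ : Family ι}
    (hΨ : HasSquareSummableSectors Ψ) : HasSquareSummableSectors (annihilation b f Ψ) := by
  intro n
  rw [annihilation_eq_contract]
  exact ((squareSummable_coord_left b f).contract (hΨ (n + 1))).const_smul _

theorem creation_annihilation_succ (x f : H) (Ψ : Family ι) (n : ℕ) :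
    creation b f (annihilation b x Ψ) (n + 1) =
      ∑ j, tensorAt (fun p => ⟪b p, f⟫_ℂ) (contract (fun p => ⟪x, b p⟫_ℂ) (Ψ (n + 1))) j := by
  simp only [creation_succ_eq_sum_tensorAt, annihilation_eq_contract, tensorAt_smul,
    ← Finset.smul_sum]
  exact inv_smul_smul₀ (sqrt_succ_ne_zero n) _

-- In `a⁻[x] a⁺[f]` the contraction meets the inserted factor for one of the `n + 1` insertions,
-- which gives `(x, f)`; the others give `a⁺[f] a⁻[x]`.
theorem annihilation_creation (x f : H) {Ψ : Family ι} (hΨ : HasSquareSummableSectors Ψ) :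
    annihilation b x (creation b f Ψ) = creation b f (annihilation b x Ψ) + ⟪x, f⟫_ℂ • Ψ := by
  refine funext fun n => ?_
  have hcontract : annihilation b x (creation b f Ψ) n = ⟪x, f⟫_ℂ • Ψ n +
      ∑ j : Fin n, contract (fun p => ⟪x, b p⟫_ℂ)
        (tensorAt (fun p => ⟪b p, f⟫_ℂ) (Ψ n) j.succ) := by
    rw [annihilation_eq_contract, creation_succ_eq_sum_tensorAt, contract_smul,
      smul_inv_smul₀ (sqrt_succ_ne_zero n), contract_sum (squareSummable_coord_left b x)
        fun j => (squareSummable_coord b f).tensorAt (hΨ n) j,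
      Fin.sum_univ_succ, contract_tensorAt_zero, (b.hasSum_inner_mul_inner x f).tsum_eq]
  rw [hcontract, add_comm]
  cases n with
  | zero => rfl
  | succ n =>
    simp only [contract_tensorAt_succ, Pi.add_apply, creation_annihilation_succ]
    rfl

theorem creation_comm (f g : H) (Ψ : Family ι) :
    creation b f (creation b g Ψ) = creation b g (creation b f Ψ) := by
  funext n i
  match n with
  | 0 => rfl
  | 1 => simp [creation]
  | n + 2 =>
    simp only [creation_succ, Finset.mul_sum]
    rw [← Finset.sum_product', ← Finset.sum_product']
    refine Finset.sum_bij' (fun x _ => (x.1.succAbove x.2, x.2.predAbove x.1))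
      (fun x _ => (x.1.succAbove x.2, x.2.predAbove x.1)) (by simp) (by simp) ?_ ?_ ?_
    · rintro ⟨j, k⟩ -
      simp [Fin.succAbove_succAbove_predAbove, Fin.predAbove_predAbove_succAbove]
    · rintro ⟨j, k⟩ -
      simp [Fin.succAbove_succAbove_predAbove, Fin.predAbove_predAbove_succAbove]
    · rintro ⟨j, k⟩ -
      simp only [Fin.succAbove_succAbove_predAbove, Fin.succAbove_succAbove_succAbove_predAbove]
      ring

/-- The permutation of the remaining indices when `j` is removed from the source of `σ` and `σ j`
from its target. -/
def removePerm {n : ℕ} (σ : Equiv.Perm (Fin (n + 1))) (j : Fin (n + 1)) : Equiv.Perm (Fin n) :=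
  (finSuccAboveEquiv j).trans ((σ.subtypeEquiv fun a => by simp).trans
    (finSuccAboveEquiv (σ j)).symm)

theorem succAbove_removePerm {n : ℕ} (σ : Equiv.Perm (Fin (n + 1))) (j : Fin (n + 1)) (l : Fin n) :
    (σ j).succAbove (removePerm σ j l) = σ (j.succAbove l) :=
  congrArg Subtype.val ((finSuccAboveEquiv (σ j)).apply_symm_apply
    ((σ.subtypeEquiv (p := fun x => x ≠ j) (q := fun x => x ≠ σ j) fun a => by simp)
      (finSuccAboveEquiv j l)))

variable {b}

theorem IsSymmFamily.creation (f : H) {Ψ : Family ι} (hΨ : IsSymmFamily Ψ) :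
    IsSymmFamily (creation b f Ψ) := by
  intro n σ i
  cases n with
  | zero => rfl
  | succ n =>
    rw [creation_succ, creation_succ]
    congr 1
    refine Fintype.sum_equiv σ _ _ fun j => ?_
    rw [← hΨ n (removePerm σ j) fun l => i ((σ j).succAbove l)]
    simp only [Function.comp_def, succAbove_removePerm]

theorem cons_comp_perm {n : ℕ} (σ : Equiv.Perm (Fin n)) (p : ι) (i : Fin n → ι) :
    (Fin.cons p (i ∘ σ) : Fin (n + 1) → ι) =
      (Fin.cons p i : Fin (n + 1) → ι) ∘ (Equiv.Perm.decomposeFin.symm (0, σ)) := by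
  funext l
  refine Fin.cases ?_ (fun l => ?_) l <;> simp

theorem IsSymmFamily.annihilation (f : H) {Ψ : Family ι} (hΨ : IsSymmFamily Ψ) :
    IsSymmFamily (annihilation b f Ψ) := by
  intro n σ i
  rw [annihilation_apply, annihilation_apply]
  simp only [cons_comp_perm, hΨ (n + 1)]

theorem IsSymmFamily.apply_insertNth {Ψ : Family ι} (hΨ : IsSymmFamily Ψ) {n : ℕ}
    (j : Fin (n + 1)) (p : ι) (i : Fin n → ι) :
    Ψ (n + 1) (j.insertNth p i) = Ψ (n + 1) (Fin.cons p i) := by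
  have hperm : (j.insertNth p i : Fin (n + 1) → ι) = (Fin.cons p i : Fin (n + 1) → ι) ∘
      ((finSuccEquiv' j).trans (finSuccEquiv' 0).symm) := by
    funext l
    refine Fin.succAboveCases j ?_ (fun l => ?_) l <;> simp
  rw [hperm, hΨ]

theorem cons_cons_comp_swap {n : ℕ} (p q : ι) (i : Fin n → ι) :
    (Fin.cons q (Fin.cons p i) : Fin (n + 2) → ι) ∘ (Equiv.swap 0 1) =
      Fin.cons p (Fin.cons q i) := by
  funext l
  refine Fin.cases ?_ (fun l => Fin.cases ?_ (fun l => ?_) l) l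
  · simp
  · simp
  · rw [Function.comp_apply, Equiv.swap_apply_of_ne_of_ne (Fin.succ_ne_zero _)]
    · simp
    · exact fun h => Fin.succ_ne_zero l (Fin.succ_injective _ h)

theorem IsSymmFamily.apply_cons_cons {Ψ : Family ι} (hΨ : IsSymmFamily Ψ) {n : ℕ} (p q : ι)
    (i : Fin n → ι) :
    Ψ (n + 2) (Fin.cons p (Fin.cons q i)) = Ψ (n + 2) (Fin.cons q (Fin.cons p i)) := by
  rw [← cons_cons_comp_swap, hΨ]

variable (b)

theorem annihilation_annihilation (f g : H) {Ψ : Family ι} (hΨ : HasSquareSummableSectors Ψ)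
    (n : ℕ) (i : Fin n → ι) : annihilation b f (annihilation b g Ψ) n i =
      (√(n + 1 : ℝ) * √(n + 1 + 1 : ℝ) : ℝ) * ∑' x : ι × ι, (⟪g, b x.1⟫_ℂ * ⟪f, b x.2⟫_ℂ) *
        Ψ (n + 2) (Fin.cons x.1 (Fin.cons x.2 i)) := by
  rw [annihilation_eq_contract, annihilation_eq_contract, contract_smul, smul_smul, Pi.smul_apply,
    contract_contract (squareSummable_coord_left b f) (squareSummable_coord_left b g) (hΨ _)]
  push_cast
  rfl

theorem annihilation_comm (f g : H) {Ψ : Family ι} (hΨ : HasSquareSummableSectors Ψ)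
    (hs : IsSymmFamily Ψ) :
    annihilation b f (annihilation b g Ψ) = annihilation b g (annihilation b f Ψ) := by
  funext n i
  rw [annihilation_annihilation b f g hΨ, annihilation_annihilation b g f hΨ,
    ← (Equiv.prodComm ι ι).tsum_eq]
  congr 1
  refine tsum_congr fun x => ?_
  simp only [Equiv.prodComm_apply, Prod.fst_swap, Prod.snd_swap]
  rw [hs.apply_cons_cons, mul_comm ⟪g, b x.2⟫_ℂ]

theorem IsSymmFamily.tsum_conj_mul_tensorAt {Φ : Family ι} (hΦ : IsSymmFamily Φ) {n : ℕ}
    (hΦn : SquareSummable (Φ (n + 1))) {x : ι → ℂ} {T : (Fin n → ι) → ℂ} (hx : SquareSummable x)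
    (hT : SquareSummable T) (j : Fin (n + 1)) :
    ∑' i, starRingEnd ℂ (Φ (n + 1) i) * tensorAt x T j i =
      ∑' i, starRingEnd ℂ (contract (fun p => starRingEnd ℂ (x p)) (Φ (n + 1)) i) * T i := by
  have hcons : SquareSummable fun y : ι × (Fin n → ι) =>
      starRingEnd ℂ (Φ (n + 1) (Fin.cons y.1 y.2)) :=
    ((squareSummable_comp_equiv (Fin.consEquiv fun _ => ι)).2 hΦn).conj
  have hinsert : ∀ y : ι × (Fin n → ι),
      Φ (n + 1) (Fin.insertNthEquiv (fun _ => ι) j y) = Φ (n + 1) (Fin.cons y.1 y.2) :=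
    fun y => hΦ.apply_insertNth j y.1 y.2
  rw [← (Fin.insertNthEquiv (fun _ => ι) j).tsum_eq]
  simp only [tensorAt_insertNthEquiv, hinsert]
  rw [tsum_prod_comm (hcons.summable_mul (hx.tensor hT))]
  refine tsum_congr fun i => ?_
  rw [contract, Complex.conj_tsum, ← tsum_mul_right]
  refine tsum_congr fun p => ?_
  simp only [map_mul, Complex.conj_conj]
  ring

theorem tsum_conj_mul_creation (f : H) {Φ Ψ : Family ι} (hΦ : IsSymmFamily Φ) {n : ℕ}
    (hΦn : SquareSummable (Φ (n + 1))) (hΨn : SquareSummable (Ψ n)) :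
    ∑' i, starRingEnd ℂ (Φ (n + 1) i) * creation b f Ψ (n + 1) i =
      ∑' i, starRingEnd ℂ (annihilation b f Φ n i) * Ψ n i := by
  have hf := squareSummable_coord b f
  have hsum : ∀ j ∈ Finset.univ, Summable fun i =>
      starRingEnd ℂ (Φ (n + 1) i) * tensorAt (fun p => ⟪b p, f⟫_ℂ) (Ψ n) j i := fun j _ =>
    hΦn.conj.summable_mul (hf.tensorAt hΨn j)
  simp only [creation_succ_eq_sum_tensorAt, annihilation_eq_contract, Pi.smul_apply,
    Finset.sum_apply, smul_eq_mul, map_mul, Complex.conj_ofReal, mul_assoc, tsum_mul_left,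
    mul_left_comm _ (_⁻¹ : ℂ)]
  simp only [Finset.mul_sum]
  rw [Summable.tsum_finsetSum hsum]
  simp only [hΦ.tsum_conj_mul_tensorAt hΦn hf hΨn, inner_conj_symm, Finset.sum_const,
    Finset.card_univ, Fintype.card_fin, nsmul_eq_mul, ← mul_assoc]
  congr 1
  rw [inv_mul_eq_iff_eq_mul₀ (sqrt_succ_ne_zero n), ← Complex.ofReal_mul,
    Real.mul_self_sqrt (by positivity)]
  push_cast
  rfl

end CreationAnnihilation

/-! ### The space `S` and its operators -/

section SchwartzSpace

variable {ι H : Type*} [NormedAddCommGroup H] [InnerProductSpace ℂ H] (b : HilbertBasis ι ℂ H)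

theorem sectorNorm_sq (Ψ : Family ι) (n : ℕ) : sectorNorm Ψ n ^ 2 = sqNorm (Ψ n) :=
  Real.sq_sqrt (sqNorm_nonneg _)

theorem sectorNorm_nonneg (Ψ : Family ι) (n : ℕ) : 0 ≤ sectorNorm Ψ n := Real.sqrt_nonneg _

theorem IsFock.hasSquareSummableSectors {Ψ : Family ι} (h : IsFock Ψ) :
    HasSquareSummableSectors Ψ := fun n =>
  h.summable.sigma_factor n

theorem IsSchwartz.hasSquareSummableSectors {Ψ : Family ι} (h : IsSchwartz Ψ) :
    HasSquareSummableSectors Ψ :=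
  h.toIsFock.hasSquareSummableSectors

theorem IsSchwartz.isSymmFamily {Ψ : Family ι} (h : IsSchwartz Ψ) : IsSymmFamily Ψ := h.symm

theorem succ_pow_le_two_pow_mul_add {x : ℝ} (hx : 0 ≤ x) (m : ℕ) :
    (x + 1) ^ m ≤ 2 ^ m * (x ^ m + 1) := by
  rcases le_total x 1 with h | h
  · calc (x + 1) ^ m ≤ 2 ^ m := pow_le_pow_left₀ (by positivity) (by linarith) m
      _ ≤ 2 ^ m * (x ^ m + 1) := le_mul_of_one_le_right (by positivity) (by simp [pow_nonneg hx])
  · calc (x + 1) ^ m ≤ (2 * x) ^ m := pow_le_pow_left₀ (by positivity) (by linarith) m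
      _ ≤ 2 ^ m * (x ^ m + 1) := by rw [mul_pow]; gcongr; linarith

theorem IsSchwartz.exists_pow_mul_sqNorm_le {Ψ : Family ι} (h : IsSchwartz Ψ) (m : ℕ) :
    ∃ C : ℝ, ∀ n : ℕ, ((n : ℝ) + 1) ^ m * sqNorm (Ψ n) ≤ C := by
  obtain ⟨C, hC⟩ := h.decay m
  obtain ⟨D, hD⟩ := h.decay 0
  simp only [pow_zero, one_mul] at hD
  refine ⟨2 ^ m * (C + D) * D, fun n => ?_⟩
  have hs := sectorNorm_nonneg Ψ n
  calc ((n : ℝ) + 1) ^ m * sqNorm (Ψ n)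
      ≤ 2 ^ m * ((n : ℝ) ^ m + 1) * sectorNorm Ψ n ^ 2 := by
        rw [← sectorNorm_sq]
        gcongr
        exact succ_pow_le_two_pow_mul_add n.cast_nonneg m
    _ = 2 ^ m * ((n : ℝ) ^ m * sectorNorm Ψ n + sectorNorm Ψ n) * sectorNorm Ψ n := by ring
    _ ≤ 2 ^ m * (C + D) * D := by
        have hCD : (n : ℝ) ^ m * sectorNorm Ψ n + sectorNorm Ψ n ≤ C + D :=
          add_le_add (hC n) (hD n)
        have hCD0 : 0 ≤ C + D := le_trans (by positivity) hCD
        gcongr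
        exact hD n

theorem isSchwartz_of_pow_mul_sqNorm_le {Ψ : Family ι} (hs : IsSymmFamily Ψ)
    (hsq : HasSquareSummableSectors Ψ)
    (hd : ∀ m : ℕ, ∃ C : ℝ, ∀ n : ℕ, ((n : ℝ) + 1) ^ m * sqNorm (Ψ n) ≤ C) : IsSchwartz Ψ where
  symm := hs
  summable := by
    rw [summable_sigma_of_nonneg fun _ => by positivity]
    obtain ⟨C, hC⟩ := hd 2
    have hinv : Summable fun n : ℕ => (((n : ℝ) + 1) ^ 2)⁻¹ := by
      exact_mod_cast (summable_nat_add_iff 1).2 (Real.summable_nat_pow_inv.2 one_lt_two)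
    refine ⟨hsq, (hinv.mul_left C).of_nonneg_of_le (fun n => sqNorm_nonneg (Ψ n)) fun n => ?_⟩
    change sqNorm (Ψ n) ≤ _
    rw [← div_eq_mul_inv, le_div_iff₀ (by positivity), mul_comm]
    exact hC n
  decay m := by
    obtain ⟨C, hC⟩ := hd (2 * m)
    refine ⟨√C, fun n => Real.le_sqrt_of_sq_le ((?_ : _ ≤ _).trans (hC n))⟩
    have := sqNorm_nonneg (Ψ n)
    rw [mul_pow, sectorNorm_sq, ← pow_mul, mul_comm m 2]
    gcongr
    linarith

theorem IsSchwartz.add {Ψ Φ : Family ι} (hΨ : IsSchwartz Ψ) (hΦ : IsSchwartz Φ) :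
    IsSchwartz (Ψ + Φ) := by
  have qΨ := hΨ.hasSquareSummableSectors
  have qΦ := hΦ.hasSquareSummableSectors
  refine isSchwartz_of_pow_mul_sqNorm_le (fun n σ i => ?_) (fun n => (qΨ n).add (qΦ n)) fun m => ?_
  · simp only [Pi.add_apply, hΨ.symm n σ i, hΦ.symm n σ i]
  · obtain ⟨C, hC⟩ := hΨ.exists_pow_mul_sqNorm_le m
    obtain ⟨D, hD⟩ := hΦ.exists_pow_mul_sqNorm_le m
    refine ⟨2 * (C + D), fun n => ?_⟩
    calc ((n : ℝ) + 1) ^ m * sqNorm (Ψ n + Φ n)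
        ≤ ((n : ℝ) + 1) ^ m * (2 * (sqNorm (Ψ n) + sqNorm (Φ n))) := by
          gcongr
          exact sqNorm_add_le (qΨ n) (qΦ n)
      _ ≤ 2 * (C + D) := by linarith [hC n, hD n]

theorem IsSchwartz.const_smul (c : ℂ) {Ψ : Family ι} (hΨ : IsSchwartz Ψ) :
    IsSchwartz (c • Ψ) := by
  refine isSchwartz_of_pow_mul_sqNorm_le (fun n σ i => ?_)
    (fun n => (hΨ.hasSquareSummableSectors n).const_smul c) fun m => ?_
  · simp only [Pi.smul_apply, hΨ.symm n σ i]
  · obtain ⟨C, hC⟩ := hΨ.exists_pow_mul_sqNorm_le m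
    refine ⟨‖c‖ ^ 2 * C, fun n => ?_⟩
    rw [Pi.smul_apply, sqNorm_smul, mul_left_comm]
    gcongr
    exact hC n

theorem isSchwartz_zero : IsSchwartz (0 : Family ι) :=
  isSchwartz_of_pow_mul_sqNorm_le (fun _ _ _ => rfl) (fun _ => squareSummable_zero)
    fun _ => ⟨0, fun n => by simp [sqNorm_zero]⟩

theorem IsSchwartz.creation (f : H) {Ψ : Family ι} (hΨ : IsSchwartz Ψ) :
    IsSchwartz (creation b f Ψ) := by
  have hsq := hΨ.hasSquareSummableSectors
  refine isSchwartz_of_pow_mul_sqNorm_le (hΨ.isSymmFamily.creation f) (hsq.creation b f)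
    fun m => ?_
  obtain ⟨C, hC⟩ := hΨ.exists_pow_mul_sqNorm_le (m + 1)
  have hC0 : 0 ≤ C := le_trans (mul_nonneg (by positivity) (sqNorm_nonneg _)) (hC 0)
  refine ⟨2 ^ m * ‖f‖ ^ 2 * C, fun n => ?_⟩
  cases n with
  | zero =>
    have hzero : sqNorm (ConstrainedFock.creation b f Ψ 0) = 0 := sqNorm_zero
    rw [hzero, mul_zero]
    positivity
  | succ n =>
    have hpow : (((n + 1 : ℕ) : ℝ) + 1) ^ m ≤ (2 * ((n : ℝ) + 1)) ^ m :=
      pow_le_pow_left₀ (by positivity) (by push_cast; linarith [n.cast_nonneg (α := ℝ)]) m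
    calc _ ≤ (2 * ((n : ℝ) + 1)) ^ m * ((n + 1) * ‖f‖ ^ 2 * sqNorm (Ψ n)) :=
          mul_le_mul hpow (sqNorm_creation_succ_le b f (hsq n)) (sqNorm_nonneg _) (by positivity)
      _ = 2 ^ m * ‖f‖ ^ 2 * (((n : ℝ) + 1) ^ (m + 1) * sqNorm (Ψ n)) := by
          rw [mul_pow]
          ring
      _ ≤ _ := by gcongr; exact hC n

theorem IsSchwartz.annihilation (f : H) {Ψ : Family ι} (hΨ : IsSchwartz Ψ) :
    IsSchwartz (annihilation b f Ψ) := by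
  have hsq := hΨ.hasSquareSummableSectors
  refine isSchwartz_of_pow_mul_sqNorm_le (hΨ.isSymmFamily.annihilation f) (hsq.annihilation b f)
    fun m => ?_
  obtain ⟨C, hC⟩ := hΨ.exists_pow_mul_sqNorm_le (m + 1)
  refine ⟨‖f‖ ^ 2 * C, fun n => ?_⟩
  have hn := sqNorm_nonneg (Ψ (n + 1))
  calc _ ≤ ((n : ℝ) + 1) ^ m * ((n + 1) * ‖f‖ ^ 2 * sqNorm (Ψ (n + 1))) := by
        gcongr
        exact sqNorm_annihilation_le b f (hsq (n + 1))
    _ = ‖f‖ ^ 2 * (((n : ℝ) + 1) ^ (m + 1) * sqNorm (Ψ (n + 1))) := by ring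
    _ ≤ ‖f‖ ^ 2 * ((((n + 1 : ℕ) : ℝ) + 1) ^ (m + 1) * sqNorm (Ψ (n + 1))) := by
        gcongr
        linarith
    _ ≤ _ := by gcongr; exact hC (n + 1)

theorem truncate_apply (N : ℕ) (Ψ : Family ι) (n : ℕ) :
    truncate N Ψ n = if n ≤ N then Ψ n else 0 := by
  funext i
  simp only [truncate]
  split_ifs <;> rfl

theorem IsSchwartz.truncate (N : ℕ) {Ψ : Family ι} (hΨ : IsSchwartz Ψ) :
    IsSchwartz (truncate N Ψ) := by
  refine isSchwartz_of_pow_mul_sqNorm_le (fun n σ i => ?_) (fun n => ?_) fun m => ?_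
  · simp only [ConstrainedFock.truncate, hΨ.symm n σ i]
  · rw [truncate_apply]
    split_ifs
    exacts [hΨ.hasSquareSummableSectors n, squareSummable_zero]
  · obtain ⟨C, hC⟩ := hΨ.exists_pow_mul_sqNorm_le m
    refine ⟨C, fun n => le_trans ?_ (hC n)⟩
    rw [truncate_apply]
    split_ifs
    · exact le_rfl
    · rw [sqNorm_zero, mul_zero]
      exact mul_nonneg (by positivity) (sqNorm_nonneg _)

variable (ι) in
/-- The space `S` as a subspace of the space of families. -/
def schwartzSubspace : Submodule ℂ (Family ι) where
  carrier := {Ψ | IsSchwartz Ψ}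
  zero_mem' := isSchwartz_zero
  add_mem' := IsSchwartz.add
  smul_mem' c _ := IsSchwartz.const_smul c

-- Without this shortcut `rw [mul_sub]` fails in `Module.End ℂ (schwartzSubspace ι)`: the additions
-- of `Submodule.addCommMonoid` and `Submodule.addCommGroup` are not identified.
instance : AddCommGroup (schwartzSubspace ι) := Submodule.addCommGroup _

theorem isSchwartz_coe (x : schwartzSubspace ι) : IsSchwartz (x : Family ι) := x.2

end SchwartzSpace

section Operators

variable {ι H : Type*} [NormedAddCommGroup H] [InnerProductSpace ℂ H] (b : HilbertBasis ι ℂ H)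

/-- The creation operator `a⁺[f]` on `S`. -/
def creationOp (f : H) : Module.End ℂ (schwartzSubspace ι) where
  toFun x := ⟨creation b f x, (isSchwartz_coe x).creation b f⟩
  map_add' x y := Subtype.ext (creation_add b f x y)
  map_smul' c x := Subtype.ext (creation_smul b f c x)

/-- The annihilation operator `a⁻[f]` on `S`. -/
def annihilationOp (f : H) : Module.End ℂ (schwartzSubspace ι) where
  toFun x := ⟨annihilation b f x, (isSchwartz_coe x).annihilation b f⟩
  map_add' x y := Subtype.ext (annihilation_add b f (isSchwartz_coe x).hasSquareSummableSectors
    (isSchwartz_coe y).hasSquareSummableSectors)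
  map_smul' c x := Subtype.ext (annihilation_smul b f c x)

/-- The truncation to at most `N` particles on `S`. -/
def truncateOp (N : ℕ) : Module.End ℂ (schwartzSubspace ι) where
  toFun x := ⟨truncate N x, (isSchwartz_coe x).truncate N⟩
  map_add' x y := by
    refine Subtype.ext (funext fun n => funext fun i => ?_)
    simp only [truncate, Submodule.coe_add, Pi.add_apply]
    split_ifs <;> simp
  map_smul' c x := by
    refine Subtype.ext (funext fun n => funext fun i => ?_)
    simp only [truncate, Submodule.coe_smul, Pi.smul_apply, RingHom.id_apply]
    split_ifs <;> simp

/-- The skew-symmetric operator `i Ω[f] = a⁺[f] - a⁻[f]` on `S`. -/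
def skewOp (f : H) : Module.End ℂ (schwartzSubspace ι) := creationOp b f - annihilationOp b f

theorem annihilationOp_mul_creationOp (f g : H) :
    annihilationOp b f * creationOp b g = creationOp b g * annihilationOp b f + ⟪f, g⟫_ℂ • 1 :=
  LinearMap.ext fun x => Subtype.ext
    (annihilation_creation b f g (isSchwartz_coe x).hasSquareSummableSectors)

theorem creationOp_mul_comm (f g : H) :
    creationOp b f * creationOp b g = creationOp b g * creationOp b f :=
  LinearMap.ext fun x => Subtype.ext (creation_comm b f g (x : Family ι))

theorem annihilationOp_mul_comm (f g : H) :
    annihilationOp b f * annihilationOp b g = annihilationOp b g * annihilationOp b f :=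
  LinearMap.ext fun x => Subtype.ext (annihilation_comm b f g
    (isSchwartz_coe x).hasSquareSummableSectors (isSchwartz_coe x).isSymmFamily)

theorem annihilationOp_mul_skewOp (f g : H) :
    annihilationOp b f * skewOp b g = skewOp b g * annihilationOp b f + ⟪f, g⟫_ℂ • 1 := by
  rw [skewOp, mul_sub, sub_mul, annihilationOp_mul_creationOp, annihilationOp_mul_comm b f g]
  abel

theorem creationOp_mul_skewOp (f g : H) :
    creationOp b f * skewOp b g = skewOp b g * creationOp b f + ⟪g, f⟫_ℂ • 1 := by
  rw [skewOp, mul_sub, sub_mul, annihilationOp_mul_creationOp, creationOp_mul_comm b f g]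
  abel

theorem commute_skewOp {f g : H} (h : sympl f g = 0) : Commute (skewOp b f) (skewOp b g) := by
  have hinner : ⟪f, g⟫_ℂ = ⟪g, f⟫_ℂ := by
    rw [sympl, mul_eq_zero, or_iff_right Complex.I_ne_zero, sub_eq_zero] at h
    exact h
  change skewOp b f * skewOp b g = skewOp b g * skewOp b f
  conv_lhs => rw [skewOp, sub_mul, creationOp_mul_skewOp, annihilationOp_mul_skewOp, hinner]
  conv_rhs => rw [skewOp.eq_1 b f, mul_sub]
  abel

theorem creationOp_sub (f g : H) : creationOp b (f - g) = creationOp b f - creationOp b g := by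
  rw [eq_sub_iff_add_eq]
  refine LinearMap.ext fun x => Subtype.ext ?_
  exact (creation_add_left b _ _ _).symm.trans (by rw [sub_add_cancel]; rfl)

theorem annihilationOp_sub (f g : H) :
    annihilationOp b (f - g) = annihilationOp b f - annihilationOp b g := by
  rw [eq_sub_iff_add_eq]
  refine LinearMap.ext fun x => Subtype.ext ?_
  exact (annihilation_add_left b _ _ (isSchwartz_coe x).hasSquareSummableSectors).symm.trans
    (by rw [sub_add_cancel]; rfl)

theorem skewOp_sub (f g : H) : skewOp b (f - g) = skewOp b f - skewOp b g := by
  simp only [skewOp, creationOp_sub, annihilationOp_sub]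
  abel

end Operators

section FullFock

variable {ι H : Type*} [NormedAddCommGroup H] [InnerProductSpace ℂ H] (b : HilbertBasis ι ℂ H)

variable (ι) in
/-- The Hilbert space `⊕ₙ H^{⊗n}` in coordinates. -/
abbrev FullFock := lp (fun _ : (n : ℕ) × (Fin n → ι) => ℂ) 2

theorem IsFock.squareSummable {Ψ : Family ι} (h : IsFock Ψ) :
    SquareSummable fun y : (n : ℕ) × (Fin n → ι) => Ψ y.1 y.2 :=
  h.summable

/-- The embedding of `S` into `⊕ₙ H^{⊗n}`. -/
def toFullFock : schwartzSubspace ι →ₗ[ℂ] FullFock ι where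
  toFun x := (isSchwartz_coe x).squareSummable.toLp
  map_add' _ _ := rfl
  map_smul' _ _ := rfl

theorem inner_toFullFock (x : schwartzSubspace ι) (y : FullFock ι) :
    ⟪toFullFock x, y⟫_ℂ = fockInner (x : Family ι) fun n i => y ⟨n, i⟩ := by
  rw [lp.inner_eq_tsum, fockInner]
  refine tsum_congr fun z => ?_
  rw [RCLike.inner_apply, mul_comm]
  rfl

theorem hasSum_inner_toFullFock (x y : schwartzSubspace ι) :
    HasSum (fun n => ∑' i, starRingEnd ℂ ((x : Family ι) n i) * (y : Family ι) n i)
      ⟪toFullFock x, toFullFock y⟫_ℂ := by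
  rw [inner_toFullFock]
  exact ((isSchwartz_coe x).squareSummable.conj.summable_mul
    (isSchwartz_coe y).squareSummable).hasSum.sigma fun n =>
      (((isSchwartz_coe x).hasSquareSummableSectors n).conj.summable_mul
        ((isSchwartz_coe y).hasSquareSummableSectors n)).hasSum

theorem hasSum_sqNorm (x : schwartzSubspace ι) :
    HasSum (fun n => sqNorm ((x : Family ι) n)) (‖toFullFock x‖ ^ 2) := by
  have hnorm : ‖toFullFock x‖ ^ 2 = _ := (isSchwartz_coe x).squareSummable.norm_toLp_sq
  rw [hnorm]
  exact (isSchwartz_coe x).summable.hasSum.sigma fun n =>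
    ((isSchwartz_coe x).hasSquareSummableSectors n).hasSum

theorem coe_creationOp_zero (f : H) (x : schwartzSubspace ι) :
    (creationOp b f x : Family ι) 0 = 0 := rfl

theorem inner_toFullFock_annihilationOp (f : H) (x y : schwartzSubspace ι) :
    ⟪toFullFock (annihilationOp b f x), toFullFock y⟫_ℂ =
      ⟪toFullFock x, toFullFock (creationOp b f y)⟫_ℂ := by
  have h := hasSum_inner_toFullFock x (creationOp b f y)
  rw [← hasSum_nat_add_iff' 1, Finset.sum_range_one] at h
  simp only [coe_creationOp_zero, Pi.zero_apply, mul_zero, tsum_zero, sub_zero] at h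
  refine (hasSum_inner_toFullFock (annihilationOp b f x) y).unique (h.congr_fun fun n => ?_)
  exact (tsum_conj_mul_creation b f (isSchwartz_coe x).isSymmFamily
    ((isSchwartz_coe x).hasSquareSummableSectors (n + 1))
    ((isSchwartz_coe y).hasSquareSummableSectors n)).symm

theorem inner_toFullFock_creationOp (f : H) (x y : schwartzSubspace ι) :
    ⟪toFullFock (creationOp b f x), toFullFock y⟫_ℂ =
      ⟪toFullFock x, toFullFock (annihilationOp b f y)⟫_ℂ := by
  rw [← inner_conj_symm, ← inner_toFullFock_annihilationOp, inner_conj_symm]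

theorem inner_toFullFock_skewOp (f : H) (x y : schwartzSubspace ι) :
    ⟪toFullFock (skewOp b f x), toFullFock y⟫_ℂ =
      -⟪toFullFock x, toFullFock (skewOp b f y)⟫_ℂ := by
  simp only [skewOp, LinearMap.sub_apply, map_sub, inner_sub_left, inner_sub_right,
    inner_toFullFock_creationOp, inner_toFullFock_annihilationOp, neg_sub]

/-- The vectors of `S` whose `n`-particle components vanish for `n > N`. -/
def AtMostParticles (N : ℕ) (x : schwartzSubspace ι) : Prop := ∀ n, N < n → (x : Family ι) n = 0

theorem atMostParticles_truncateOp (N : ℕ) (x : schwartzSubspace ι) :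
    AtMostParticles N (truncateOp N x) := fun n hn => by
  change truncate N (x : Family ι) n = 0
  rw [truncate_apply, if_neg (not_le.2 hn)]

namespace AtMostParticles

variable {N : ℕ} {x y : schwartzSubspace ι}

theorem mono {N' : ℕ} (h : AtMostParticles N x) (hN : N ≤ N') : AtMostParticles N' x :=
  fun n hn => h n (hN.trans_lt hn)

theorem sub (hx : AtMostParticles N x) (hy : AtMostParticles N y) :
    AtMostParticles N (x - y) := fun n hn => by
  rw [Submodule.coe_sub, Pi.sub_apply, hx n hn, hy n hn, sub_zero]

theorem creationOp_apply (f : H) (h : AtMostParticles N x) :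
    AtMostParticles (N + 1) (creationOp b f x) := by
  intro n hn
  cases n with
  | zero => rfl
  | succ n =>
    funext i
    change creation b f (x : Family ι) (n + 1) i = 0
    rw [creation_succ, h n (by omega)]
    simp

theorem annihilationOp_apply (f : H) (h : AtMostParticles N x) :
    AtMostParticles N (annihilationOp b f x) := by
  intro n hn
  funext i
  change annihilation b f (x : Family ι) n i = 0
  rw [annihilation_apply, h (n + 1) (by omega)]
  simp

theorem skewOp_apply (f : H) (h : AtMostParticles N x) :
    AtMostParticles (N + 1) (skewOp b f x) :=
  (h.creationOp_apply b f).sub ((h.annihilationOp_apply b f).mono N.le_succ)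

theorem succ_mul_sqNorm_le (h : AtMostParticles N x) (n : ℕ) :
    ((n : ℝ) + 1) * sqNorm ((x : Family ι) n) ≤ (N + 1) * sqNorm ((x : Family ι) n) := by
  rcases le_or_gt n N with hn | hn
  · have := sqNorm_nonneg ((x : Family ι) n)
    gcongr
  · simp [h n hn, sqNorm_zero]

theorem norm_creationOp_le (f : H) (h : AtMostParticles N x) :
    ‖toFullFock (creationOp b f x)‖ ≤ √(N + 1) * ‖f‖ * ‖toFullFock x‖ := by
  have hsum := hasSum_sqNorm (creationOp b f x)
  rw [← hasSum_nat_add_iff' 1, Finset.sum_range_one] at hsum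
  simp only [coe_creationOp_zero, sqNorm_zero, sub_zero] at hsum
  refine le_of_sq_le_sq ?_ (by positivity)
  rw [mul_pow, mul_pow, Real.sq_sqrt (by positivity)]
  refine hasSum_le (fun n => ?_) hsum ((hasSum_sqNorm x).mul_left ((N + 1) * ‖f‖ ^ 2))
  calc sqNorm ((creationOp b f x : Family ι) (n + 1))
      ≤ (n + 1) * ‖f‖ ^ 2 * sqNorm ((x : Family ι) n) :=
        sqNorm_creation_succ_le b f ((isSchwartz_coe x).hasSquareSummableSectors n)
    _ = ‖f‖ ^ 2 * ((n + 1) * sqNorm ((x : Family ι) n)) := by ring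
    _ ≤ ‖f‖ ^ 2 * ((N + 1) * sqNorm ((x : Family ι) n)) := by
        gcongr ‖f‖ ^ 2 * ?_
        exact h.succ_mul_sqNorm_le n
    _ = (N + 1) * ‖f‖ ^ 2 * sqNorm ((x : Family ι) n) := by ring

theorem norm_annihilationOp_le (f : H) (h : AtMostParticles N x) :
    ‖toFullFock (annihilationOp b f x)‖ ≤ √(N + 1) * ‖f‖ * ‖toFullFock x‖ := by
  have hsum := hasSum_sqNorm x
  rw [← hasSum_nat_add_iff' 1, Finset.sum_range_one] at hsum
  have hle : ‖toFullFock x‖ ^ 2 - sqNorm ((x : Family ι) 0) ≤ ‖toFullFock x‖ ^ 2 :=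
    sub_le_self _ (sqNorm_nonneg _)
  refine le_of_sq_le_sq ?_ (by positivity)
  rw [mul_pow, mul_pow, Real.sq_sqrt (by positivity)]
  refine le_trans ?_ (mul_le_mul_of_nonneg_left hle (by positivity))
  refine hasSum_le (fun n => ?_) (hasSum_sqNorm (annihilationOp b f x))
    (hsum.mul_left ((N + 1) * ‖f‖ ^ 2))
  have hn := sqNorm_nonneg ((x : Family ι) (n + 1))
  have hsucc := h.succ_mul_sqNorm_le (n + 1)
  push_cast at hsucc
  calc sqNorm ((annihilationOp b f x : Family ι) n)
      ≤ (n + 1) * ‖f‖ ^ 2 * sqNorm ((x : Family ι) (n + 1)) :=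
        sqNorm_annihilation_le b f ((isSchwartz_coe x).hasSquareSummableSectors (n + 1))
    _ = ‖f‖ ^ 2 * ((n + 1) * sqNorm ((x : Family ι) (n + 1))) := by ring
    _ ≤ ‖f‖ ^ 2 * ((N + 1) * sqNorm ((x : Family ι) (n + 1))) := by
        gcongr ‖f‖ ^ 2 * ?_
        linarith
    _ = (N + 1) * ‖f‖ ^ 2 * sqNorm ((x : Family ι) (n + 1)) := by ring

theorem norm_skewOp_le (f : H) (h : AtMostParticles N x) :
    ‖toFullFock (skewOp b f x)‖ ≤ 2 * √(N + 1) * ‖f‖ * ‖toFullFock x‖ := by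
  rw [skewOp, LinearMap.sub_apply, map_sub]
  refine (norm_sub_le _ _).trans ?_
  linarith [h.norm_creationOp_le b f, h.norm_annihilationOp_le b f]

end AtMostParticles

end FullFock

/-! ### Weyl operators -/

section CauchyProduct

variable {E : Type*} [NormedAddCommGroup E] [InnerProductSpace ℂ E]

theorem summable_inner_prod {ι κ : Type*} {u : ι → E} {v : κ → E} (hu : Summable fun i => ‖u i‖)
    (hv : Summable fun k => ‖v k‖) : Summable fun p : ι × κ => ⟪u p.1, v p.2⟫_ℂ :=
  Summable.of_norm_bounded (hu.mul_of_nonneg hv (fun _ => norm_nonneg _) fun _ => norm_nonneg _)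
    fun _ => norm_inner_le_norm _ _

theorem inner_tsum_tsum [CompleteSpace E] {ι κ : Type*} {u : ι → E} {v : κ → E}
    (hu : Summable fun i => ‖u i‖) (hv : Summable fun k => ‖v k‖) :
    ⟪∑' i, u i, ∑' k, v k⟫_ℂ = ∑' p : ι × κ, ⟪u p.1, v p.2⟫_ℂ := by
  have hinner : ∀ i, ∑' k, ⟪u i, v k⟫_ℂ = ⟪u i, ∑' k, v k⟫_ℂ := fun i =>
    (hv.of_norm.hasSum.mapL (innerSL ℂ (u i))).tsum_eq
  rw [(summable_inner_prod hu hv).tsum_prod]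
  simp only [hinner]
  have h := Complex.hasSum_conj'.2 (hu.of_norm.hasSum.mapL (innerSL ℂ (∑' k, v k)))
  simp only [innerSL_apply_apply, inner_conj_symm] at h
  exact h.tsum_eq.symm

theorem inner_tsum_tsum_eq_tsum_sum_antidiagonal [CompleteSpace E] {u v : ℕ → E}
    (hu : Summable fun m => ‖u m‖) (hv : Summable fun m => ‖v m‖) :
    ⟪∑' m, u m, ∑' m, v m⟫_ℂ =
      ∑' n, ∑ p ∈ Finset.HasAntidiagonal.antidiagonal n, ⟪u p.1, v p.2⟫_ℂ := by
  rw [inner_tsum_tsum hu hv, ← Finset.HasAntidiagonal.sigmaAntidiagonalEquivProd.tsum_eq]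
  refine ((Finset.HasAntidiagonal.sigmaAntidiagonalEquivProd.summable_iff.2
    (summable_inner_prod hu hv)).tsum_sigma' fun n => (hasSum_fintype _).summable).trans ?_
  refine tsum_congr fun n => ?_
  rw [tsum_fintype]
  exact Finset.sum_coe_sort (Finset.HasAntidiagonal.antidiagonal n) fun p => ⟪u p.1, v p.2⟫_ℂ

end CauchyProduct

section ExponentialSeries

variable {ι H : Type*} [NormedAddCommGroup H] [InnerProductSpace ℂ H] (b : HilbertBasis ι ℂ H)

/-- The bound for the `m`-th power of `i Ω[f]`, `‖f‖ = 1`, on vectors with at most `N`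
particles. -/
def skewPowBound (N m : ℕ) : ℝ := ∏ k ∈ Finset.range m, 2 * √((N + k : ℕ) + 1)

theorem skewPowBound_nonneg (N m : ℕ) : 0 ≤ skewPowBound N m :=
  Finset.prod_nonneg fun _ _ => by positivity

theorem skewPowBound_succ (N m : ℕ) :
    skewPowBound N (m + 1) = skewPowBound N m * (2 * √((N + m : ℕ) + 1)) :=
  Finset.prod_range_succ _ _

theorem two_mul_sqrt_mul_le {N m : ℕ} {r : ℝ} (hr : 0 ≤ r)
    (hm : (4 * r * √(N + 1)) ^ 2 ≤ (m : ℝ) + 1) :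
    2 * √((N + m : ℕ) + 1) * r ≤ 1 / 2 * (m + 1) := by
  have hsplit : √((N + m : ℕ) + 1) ≤ √(N + 1) * √(m + 1) := by
    rw [← Real.sqrt_mul (by positivity)]
    refine Real.sqrt_le_sqrt ?_
    push_cast
    nlinarith [mul_nonneg (N.cast_nonneg (α := ℝ)) (m.cast_nonneg (α := ℝ))]
  calc 2 * √((N + m : ℕ) + 1) * r ≤ 2 * (√(N + 1) * √(m + 1)) * r := by gcongr
    _ = 1 / 2 * (4 * r * √(N + 1) * √(m + 1)) := by ring
    _ ≤ 1 / 2 * (√(m + 1) * √(m + 1)) := by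
        gcongr
        exact Real.le_sqrt_of_sq_le hm
    _ = 1 / 2 * (m + 1) := by rw [Real.mul_self_sqrt (by positivity)]

theorem summable_skewPowBound (N : ℕ) {r : ℝ} (hr : 0 ≤ r) :
    Summable fun m : ℕ => ((m.factorial : ℝ))⁻¹ * (skewPowBound N m * r ^ m) := by
  refine summable_of_ratio_norm_eventually_le (r := 1 / 2) (by norm_num) ?_
  filter_upwards [eventually_ge_atTop ⌈(4 * r * √(N + 1)) ^ 2⌉₊] with m hm
  have hratio : 2 * √((N + m : ℕ) + 1) * r ≤ 1 / 2 * (m + 1) :=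
    two_mul_sqrt_mul_le hr ((Nat.ceil_le.1 hm).trans (by linarith))
  have hterm : ∀ k, 0 ≤ ((k.factorial : ℝ))⁻¹ * (skewPowBound N k * r ^ k) := fun k =>
    mul_nonneg (by positivity) (mul_nonneg (skewPowBound_nonneg N k) (by positivity))
  rw [Real.norm_of_nonneg (hterm _), Real.norm_of_nonneg (hterm _), skewPowBound_succ,
    Nat.factorial_succ]
  calc (((m + 1) * m.factorial : ℕ) : ℝ)⁻¹ *
        (skewPowBound N m * (2 * √((N + m : ℕ) + 1)) * r ^ (m + 1))
      = (m + 1 : ℝ)⁻¹ * (2 * √((N + m : ℕ) + 1) * r) *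
          ((m.factorial : ℝ)⁻¹ * (skewPowBound N m * r ^ m)) := by
        rw [Nat.cast_mul, mul_inv, pow_succ, Nat.cast_succ]
        ring
    _ ≤ 1 / 2 * ((m.factorial : ℝ)⁻¹ * (skewPowBound N m * r ^ m)) := by
        refine mul_le_mul_of_nonneg_right ?_ (hterm m)
        rw [inv_mul_le_iff₀ (by positivity)]
        linarith

theorem AtMostParticles.pow_skewOp_apply (f : H) {N : ℕ} {x : schwartzSubspace ι}
    (h : AtMostParticles N x) (m : ℕ) : AtMostParticles (N + m) ((skewOp b f ^ m) x) := by
  induction m with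
  | zero => exact h
  | succ m ih =>
    rw [pow_succ', Module.End.mul_apply]
    exact ih.skewOp_apply b f

theorem AtMostParticles.norm_pow_skewOp_le (f : H) {N : ℕ} {x : schwartzSubspace ι}
    (h : AtMostParticles N x) (m : ℕ) :
    ‖toFullFock ((skewOp b f ^ m) x)‖ ≤ skewPowBound N m * ‖f‖ ^ m * ‖toFullFock x‖ := by
  induction m with
  | zero => simp [skewPowBound]
  | succ m ih =>
    rw [pow_succ', Module.End.mul_apply]
    calc _ ≤ 2 * √((N + m : ℕ) + 1) * ‖f‖ * ‖toFullFock ((skewOp b f ^ m) x)‖ :=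
          (h.pow_skewOp_apply b f m).norm_skewOp_le b f
      _ ≤ 2 * √((N + m : ℕ) + 1) * ‖f‖ * (skewPowBound N m * ‖f‖ ^ m * ‖toFullFock x‖) := by
          gcongr
      _ = _ := by rw [skewPowBound_succ, pow_succ]; ring

/-- The vectors of `S` with boundedly many particles; they are analytic vectors of the field
operators. -/
def IsFiniteParticle (x : schwartzSubspace ι) : Prop := ∃ N, AtMostParticles N x

theorem isFiniteParticle_truncateOp (N : ℕ) (x : schwartzSubspace ι) :
    IsFiniteParticle (truncateOp N x) :=
  ⟨N, atMostParticles_truncateOp N x⟩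

/-- The terms of the exponential series of `i Ω[f]`. -/
def expTerm (f : H) (x : schwartzSubspace ι) (m : ℕ) : FullFock ι :=
  ((m.factorial : ℂ))⁻¹ • toFullFock ((skewOp b f ^ m) x)

/-- The exponential series of `i Ω[f]`, summable on vectors with boundedly many particles. -/
def expSeries (f : H) (x : schwartzSubspace ι) : FullFock ι := ∑' m : ℕ, expTerm b f x m

theorem expTerm_zero (f : H) (x : schwartzSubspace ι) : expTerm b f x 0 = toFullFock x := by
  simp [expTerm]

theorem expTerm_sub (f : H) (x y : schwartzSubspace ι) (m : ℕ) :
    expTerm b f (x - y) m = expTerm b f x m - expTerm b f y m := by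
  simp only [expTerm, map_sub, smul_sub]

theorem expTerm_smul (f : H) (c : ℂ) (x : schwartzSubspace ι) (m : ℕ) :
    expTerm b f (c • x) m = c • expTerm b f x m := by
  simp only [expTerm, map_smul, smul_comm _ c]

theorem AtMostParticles.norm_expTerm_le (f : H) {N : ℕ} {x : schwartzSubspace ι}
    (h : AtMostParticles N x) (m : ℕ) : ‖expTerm b f x m‖ ≤
      ((m.factorial : ℝ))⁻¹ * (skewPowBound N m * ‖f‖ ^ m) * ‖toFullFock x‖ := by
  rw [expTerm, norm_smul, norm_inv, Complex.norm_natCast, mul_assoc]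
  exact mul_le_mul_of_nonneg_left (h.norm_pow_skewOp_le b f m) (by positivity)

namespace IsFiniteParticle

variable {x y : schwartzSubspace ι}

theorem sub (hx : IsFiniteParticle x) (hy : IsFiniteParticle y) : IsFiniteParticle (x - y) := by
  obtain ⟨N, hN⟩ := hx
  obtain ⟨N', hN'⟩ := hy
  exact ⟨max N N', (hN.mono (le_max_left _ _)).sub (hN'.mono (le_max_right _ _))⟩

theorem summable_norm_expTerm (f : H) (hx : IsFiniteParticle x) :
    Summable fun m => ‖expTerm b f x m‖ := by
  obtain ⟨N, hN⟩ := hx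
  exact Summable.of_nonneg_of_le (fun _ => norm_nonneg _) (hN.norm_expTerm_le b f)
    ((summable_skewPowBound N (norm_nonneg f)).mul_right _)

theorem hasSum_expTerm (f : H) (hx : IsFiniteParticle x) :
    HasSum (fun m => expTerm b f x m) (expSeries b f x) :=
  (hx.summable_norm_expTerm b f).of_norm.hasSum

theorem expSeries_sub (f : H) (hx : IsFiniteParticle x) (hy : IsFiniteParticle y) :
    expSeries b f (x - y) = expSeries b f x - expSeries b f y := by
  simp only [expSeries, expTerm_sub]
  exact HasSum.tsum_eq <| (hx.hasSum_expTerm b f).sub (hy.hasSum_expTerm b f)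

theorem expSeries_smul (f : H) (c : ℂ) (hx : IsFiniteParticle x) :
    expSeries b f (c • x) = c • expSeries b f x := by
  simp only [expSeries, expTerm_smul]
  exact HasSum.tsum_eq <| (hx.hasSum_expTerm b f).const_smul c

end IsFiniteParticle

theorem inner_toFullFock_pow_skewOp (f : H) (x y : schwartzSubspace ι) (m : ℕ) :
    ⟪toFullFock ((skewOp b f ^ m) x), toFullFock y⟫_ℂ =
      ⟪toFullFock x, toFullFock (((-skewOp b f) ^ m) y)⟫_ℂ := by
  induction m generalizing x with
  | zero => simp
  | succ m ih =>
    rw [pow_succ, Module.End.mul_apply, ih, inner_toFullFock_skewOp, pow_succ',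
      Module.End.mul_apply, LinearMap.neg_apply, map_neg, inner_neg_right]

theorem inner_expTerm (f g : H) (x y : schwartzSubspace ι) (m l : ℕ) :
    ⟪expTerm b f x m, expTerm b g y l⟫_ℂ = ((m.factorial : ℂ))⁻¹ * ((l.factorial : ℂ))⁻¹ *
      ⟪toFullFock x, toFullFock (((-skewOp b f) ^ m * skewOp b g ^ l) y)⟫_ℂ := by
  rw [expTerm, expTerm, inner_smul_left, inner_smul_right, inner_toFullFock_pow_skewOp, map_inv₀,
    Complex.conj_natCast, Module.End.mul_apply]
  ring

-- `exp(iΩ[f])* exp(iΩ[g]) = exp(iΩ[g - f])`, degree by degree: the binomial theorem applies because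
-- the field operators of symplectically orthogonal vectors commute.
theorem sum_antidiagonal_inner_expTerm {f g : H} (h : sympl f g = 0)
    (x y : schwartzSubspace ι) (n : ℕ) :
    ∑ p ∈ Finset.HasAntidiagonal.antidiagonal n, ⟪expTerm b f x p.1, expTerm b g y p.2⟫_ℂ =
      ⟪toFullFock x, expTerm b (g - f) y n⟫_ℂ := by
  have hcomm : Commute (-skewOp b f) (skewOp b g) := (commute_skewOp b h).neg_left
  have hskew : skewOp b (g - f) = -skewOp b f + skewOp b g := by rw [skewOp_sub]; abel
  rw [expTerm, hskew, hcomm.add_pow', inner_smul_right, LinearMap.sum_apply, map_sum, inner_sum,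
    Finset.mul_sum]
  refine Finset.sum_congr rfl fun p hp => ?_
  obtain rfl : p.1 + p.2 = n := Finset.HasAntidiagonal.mem_antidiagonal.1 hp
  have hchoose : ((p.1.factorial : ℂ))⁻¹ * ((p.2.factorial : ℂ))⁻¹ =
      (((p.1 + p.2).factorial : ℂ))⁻¹ * ((p.1 + p.2).choose p.1 : ℕ) := by
    rw [Nat.cast_add_choose, div_eq_mul_inv, inv_mul_cancel_left₀, mul_inv]
    exact_mod_cast (p.1 + p.2).factorial_ne_zero
  rw [inner_expTerm, hchoose, LinearMap.smul_apply, map_nsmul, ← Nat.cast_smul_eq_nsmul ℂ,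
    inner_smul_right, mul_assoc]

theorem inner_expSeries {f g : H} (h : sympl f g = 0) {x y : schwartzSubspace ι}
    (hx : IsFiniteParticle x) (hy : IsFiniteParticle y) :
    ⟪expSeries b f x, expSeries b g y⟫_ℂ = ⟪toFullFock x, expSeries b (g - f) y⟫_ℂ := by
  rw [expSeries, expSeries, inner_tsum_tsum_eq_tsum_sum_antidiagonal
    (hx.summable_norm_expTerm b f) (hy.summable_norm_expTerm b g)]
  simp only [sum_antidiagonal_inner_expTerm b h]
  exact ((hy.hasSum_expTerm b (g - f)).mapL (innerSL ℂ (toFullFock x))).tsum_eq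

theorem skewOp_zero : skewOp b (0 : H) = 0 := by
  simpa only [sub_self] using skewOp_sub b (0 : H) 0

theorem expSeries_zero (x : schwartzSubspace ι) : expSeries b (0 : H) x = toFullFock x := by
  rw [expSeries, tsum_eq_single 0, expTerm_zero]
  intro m hm
  rw [expTerm, skewOp_zero, zero_pow hm]
  simp

theorem IsFiniteParticle.norm_expSeries (f : H) {x : schwartzSubspace ι}
    (hx : IsFiniteParticle x) : ‖expSeries b f x‖ = ‖toFullFock x‖ := by
  have h := inner_expSeries b (f := f) (g := f) (by simp [sympl]) hx hx
  rw [sub_self, expSeries_zero, inner_self_eq_norm_sq_to_K, inner_self_eq_norm_sq_to_K] at h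
  have hsq : ‖expSeries b f x‖ ^ 2 = ‖toFullFock x‖ ^ 2 := by exact_mod_cast h
  exact (pow_left_inj₀ (norm_nonneg _) (norm_nonneg _) two_ne_zero).1 hsq

theorem IsFiniteParticle.exists_norm_expSeries_sub_le {x : schwartzSubspace ι}
    (hx : IsFiniteParticle x) :
    ∃ C : ℝ, ∀ f : H, ‖f‖ ≤ 1 → ‖expSeries b f x - toFullFock x‖ ≤ ‖f‖ * C := by
  obtain ⟨N, hN⟩ := hx
  have hsum := (summable_nat_add_iff 1).2
    ((summable_skewPowBound N zero_le_one).mul_right ‖toFullFock x‖)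
  refine ⟨∑' m : ℕ, ((m + 1).factorial : ℝ)⁻¹ * (skewPowBound N (m + 1) * 1 ^ (m + 1)) *
    ‖toFullFock x‖, fun f hf => ?_⟩
  have htail := IsFiniteParticle.hasSum_expTerm b f ⟨N, hN⟩
  rw [← hasSum_nat_add_iff' 1, Finset.sum_range_one, expTerm_zero] at htail
  rw [← htail.tsum_eq]
  refine tsum_of_norm_bounded (hsum.hasSum.mul_left ‖f‖) fun m => ?_
  have hpow : ‖f‖ ^ (m + 1) ≤ ‖f‖ := by
    rw [pow_succ]
    exact mul_le_of_le_one_left (norm_nonneg _) (pow_le_one₀ (norm_nonneg _) hf)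
  have hbound := skewPowBound_nonneg N (m + 1)
  calc ‖expTerm b f x (m + 1)‖
      ≤ ((m + 1).factorial : ℝ)⁻¹ * (skewPowBound N (m + 1) * ‖f‖ ^ (m + 1)) * ‖toFullFock x‖ :=
        hN.norm_expTerm_le b f (m + 1)
    _ ≤ ((m + 1).factorial : ℝ)⁻¹ * (skewPowBound N (m + 1) * ‖f‖) * ‖toFullFock x‖ := by gcongr
    _ = _ := by rw [one_pow]; ring

end ExponentialSeries

section WeylOperators

variable {ι H : Type*} [NormedAddCommGroup H] [InnerProductSpace ℂ H] (b : HilbertBasis ι ℂ H)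

theorem norm_toFullFock_sub_truncateOp_sq (N : ℕ) (x : schwartzSubspace ι) :
    ‖toFullFock (x - truncateOp N x)‖ ^ 2 = ∑' n, sqNorm ((x : Family ι) (n + (N + 1))) := by
  have hcoe : ∀ n, ((x - truncateOp N x : schwartzSubspace ι) : Family ι) n =
      (x : Family ι) n - truncate N (x : Family ι) n := fun _ => rfl
  have hlow : ∀ n ∈ Finset.range (N + 1),
      sqNorm (((x - truncateOp N x : schwartzSubspace ι) : Family ι) n) = 0 := by
    intro n hn
    rw [hcoe, truncate_apply, if_pos (Nat.lt_succ_iff.1 (Finset.mem_range.1 hn)), sub_self,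
      sqNorm_zero]
  have h := hasSum_sqNorm (x - truncateOp N x)
  rw [← hasSum_nat_add_iff' (N + 1), Finset.sum_eq_zero hlow, sub_zero] at h
  rw [← h.tsum_eq]
  refine tsum_congr fun n => ?_
  rw [hcoe, truncate_apply, if_neg (by omega), sub_zero]

theorem tendsto_toFullFock_truncateOp (x : schwartzSubspace ι) :
    Tendsto (fun N => toFullFock (truncateOp N x)) atTop (𝓝 (toFullFock x)) := by
  have hsq : Tendsto (fun N => ‖toFullFock (x - truncateOp N x)‖ ^ 2) atTop (𝓝 0) := by
    simp only [norm_toFullFock_sub_truncateOp_sq]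
    exact (tendsto_sum_nat_add fun n => sqNorm ((x : Family ι) n)).comp (tendsto_add_atTop_nat 1)
  rw [tendsto_iff_norm_sub_tendsto_zero]
  simpa [Real.sqrt_sq, norm_sub_rev] using hsq.sqrt

/-- The Weyl operator `exp(iΩ[f])` on `S`, with values in `⊕ₙ H^{⊗n}`. -/
def weylOp (f : H) (x : schwartzSubspace ι) : FullFock ι :=
  limUnder atTop fun N => expSeries b f (truncateOp N x)

theorem tendsto_expSeries_truncateOp (f : H) (x : schwartzSubspace ι) :
    Tendsto (fun N => expSeries b f (truncateOp N x)) atTop (𝓝 (weylOp b f x)) := by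
  refine CauchySeq.tendsto_limUnder ?_
  have h := (tendsto_toFullFock_truncateOp x).cauchySeq
  have hfin := fun N => isFiniteParticle_truncateOp N x
  rw [Metric.cauchySeq_iff] at h ⊢
  intro ε hε
  obtain ⟨N, hN⟩ := h ε hε
  refine ⟨N, fun m hm n hn => ?_⟩
  rw [dist_eq_norm, ← (hfin m).expSeries_sub b f (hfin n),
    ((hfin m).sub (hfin n)).norm_expSeries, map_sub, ← dist_eq_norm]
  exact hN m hm n hn

theorem tendsto_expSeries (f : H) {α : Type*} {l : Filter α} {z : α → schwartzSubspace ι}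
    (hz : ∀ a, IsFiniteParticle (z a)) {x : schwartzSubspace ι}
    (h : Tendsto (fun a => toFullFock (z a)) l (𝓝 (toFullFock x))) :
    Tendsto (fun a => expSeries b f (z a)) l (𝓝 (weylOp b f x)) := by
  rw [tendsto_iff_norm_sub_tendsto_zero] at h ⊢
  refine h.congr fun a => ?_
  have hexp := ((tendsto_expSeries_truncateOp b f x).const_sub (expSeries b f (z a))).norm
  have hid := ((tendsto_toFullFock_truncateOp x).const_sub (toFullFock (z a))).norm
  refine tendsto_nhds_unique hid (hexp.congr fun N => ?_)
  have hN := isFiniteParticle_truncateOp N x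
  rw [← (hz a).expSeries_sub b f hN, ((hz a).sub hN).norm_expSeries, map_sub]

theorem IsFiniteParticle.weylOp_eq (f : H) {x : schwartzSubspace ι} (hx : IsFiniteParticle x) :
    weylOp b f x = expSeries b f x :=
  tendsto_nhds_unique (tendsto_expSeries b f (fun _ : ℕ => hx) (tendsto_const_nhds (f := atTop)))
    tendsto_const_nhds

theorem inner_weylOp {f g : H} (h : sympl f g = 0) (x y : schwartzSubspace ι) :
    ⟪weylOp b f x, weylOp b g y⟫_ℂ = ⟪toFullFock x, weylOp b (g - f) y⟫_ℂ := by
  refine tendsto_nhds_unique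
    ((tendsto_expSeries_truncateOp b f x).inner (tendsto_expSeries_truncateOp b g y)) ?_
  simp only [inner_expSeries b h (isFiniteParticle_truncateOp _ _)
    (isFiniteParticle_truncateOp _ _)]
  exact (tendsto_toFullFock_truncateOp x).inner (tendsto_expSeries_truncateOp b (g - f) y)

theorem weylOp_zero (x : schwartzSubspace ι) : weylOp b (0 : H) x = toFullFock x := by
  refine tendsto_nhds_unique (tendsto_expSeries_truncateOp b 0 x) ?_
  simp only [expSeries_zero]
  exact tendsto_toFullFock_truncateOp x

theorem norm_weylOp (f : H) (x : schwartzSubspace ι) : ‖weylOp b f x‖ = ‖toFullFock x‖ := by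
  refine tendsto_nhds_unique (tendsto_expSeries_truncateOp b f x).norm ?_
  simp only [(isFiniteParticle_truncateOp _ _).norm_expSeries]
  exact (tendsto_toFullFock_truncateOp x).norm

theorem weylOp_sub (f : H) (x y : schwartzSubspace ι) :
    weylOp b f (x - y) = weylOp b f x - weylOp b f y := by
  refine tendsto_nhds_unique (tendsto_expSeries_truncateOp b f (x - y)) ?_
  simp only [map_sub, (isFiniteParticle_truncateOp _ x).expSeries_sub b f
    (isFiniteParticle_truncateOp _ y)]
  exact (tendsto_expSeries_truncateOp b f x).sub (tendsto_expSeries_truncateOp b f y)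

theorem weylOp_smul (f : H) (c : ℂ) (x : schwartzSubspace ι) :
    weylOp b f (c • x) = c • weylOp b f x := by
  refine tendsto_nhds_unique (tendsto_expSeries_truncateOp b f (c • x)) ?_
  simp only [map_smul, (isFiniteParticle_truncateOp _ x).expSeries_smul]
  exact (tendsto_expSeries_truncateOp b f x).const_smul c

theorem iterate_I_smul_fieldOp (f : H) (x : schwartzSubspace ι) (m : ℕ) :
    (fun Φ : Family ι => Complex.I • fieldOp b f Φ)^[m] (x : Family ι) =
      ((skewOp b f ^ m) x : schwartzSubspace ι) := by
  have hfield : ∀ Ψ, Complex.I • fieldOp b f Ψ = creation b f Ψ - annihilation b f Ψ := fun Ψ => by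
    rw [fieldOp, smul_smul]
    simp
  induction m with
  | zero => rfl
  | succ m ih =>
    rw [Function.iterate_succ_apply', ih, hfield, pow_succ']
    rfl

theorem weyl_coe (f : H) (x : schwartzSubspace ι) (n : ℕ) (i : Fin n → ι) :
    weyl b f (x : Family ι) n i = weylOp b f x ⟨n, i⟩ := by
  let coord : FullFock ι →L[ℂ] ℂ := lp.evalCLM ℂ (fun _ : (n : ℕ) × (Fin n → ι) => ℂ) 2 ⟨n, i⟩
  have h := (coord.continuous.tendsto _).comp (tendsto_expSeries_truncateOp b f x)
  refine Tendsto.limUnder_eq (h.congr fun N => ?_)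
  refine (((isFiniteParticle_truncateOp N x).hasSum_expTerm b f).mapL coord).tsum_eq.symm.trans
    (tsum_congr fun m => ?_)
  have hiter : (fun Φ : Family ι => Complex.I • fieldOp b f Φ)^[m] (truncate N (x : Family ι)) =
      ((skewOp b f ^ m) (truncateOp N x) : schwartzSubspace ι) :=
    iterate_I_smul_fieldOp b f (truncateOp N x) m
  rw [hiter]
  rfl

theorem fockInner_weyl (f : H) (x y : schwartzSubspace ι) :
    fockInner (x : Family ι) (weyl b f (y : Family ι)) = ⟪toFullFock x, weylOp b f y⟫_ℂ := by
  simp only [inner_toFullFock, ← weyl_coe]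

theorem tendsto_weylOp_zero (x : schwartzSubspace ι) :
    Tendsto (fun f : H => weylOp b f x) (𝓝 0) (𝓝 (toFullFock x)) := by
  rw [Metric.tendsto_nhds]
  intro ε hε
  obtain ⟨N, hN⟩ :=
    (Metric.tendsto_nhds.1 (tendsto_toFullFock_truncateOp x) (ε / 3) (by positivity)).exists
  have hfin := isFiniteParticle_truncateOp N x
  obtain ⟨C, hC⟩ := hfin.exists_norm_expSeries_sub_le b
  have hlim : Tendsto (fun f : H => ‖f‖ * C) (𝓝 0) (𝓝 0) := by
    simpa using (tendsto_norm_zero (E := H)).mul_const C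
  filter_upwards [hlim.eventually_lt_const (by positivity : 0 < ε / 3),
    Metric.closedBall_mem_nhds (0 : H) zero_lt_one] with f hfC hf
  have htruncate : dist (weylOp b f x) (weylOp b f (truncateOp N x)) =
      dist (toFullFock (truncateOp N x)) (toFullFock x) := by
    rw [dist_eq_norm, ← weylOp_sub, norm_weylOp, map_sub, dist_comm, dist_eq_norm]
  have hseries : dist (weylOp b f (truncateOp N x)) (toFullFock (truncateOp N x)) < ε / 3 := by
    rw [dist_eq_norm, hfin.weylOp_eq]
    exact (hC f (by simpa using hf)).trans_lt hfC
  calc dist (weylOp b f x) (toFullFock x)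
      ≤ dist (weylOp b f x) (weylOp b f (truncateOp N x)) +
        dist (weylOp b f (truncateOp N x)) (toFullFock (truncateOp N x)) +
        dist (toFullFock (truncateOp N x)) (toFullFock x) := dist_triangle4 _ _ _ _
    _ < ε := by rw [htruncate]; linarith

theorem norm_weylOp_sub_weylOp_sq {f g : H} (h : sympl f g = 0) (x : schwartzSubspace ι) :
    ‖weylOp b f x - weylOp b g x‖ ^ 2 =
      2 * ‖toFullFock x‖ ^ 2 - 2 * (⟪toFullFock x, weylOp b (g - f) x⟫_ℂ).re := by
  rw [@norm_sub_sq ℂ, norm_weylOp, norm_weylOp, inner_weylOp b h, RCLike.re_eq_complex_re]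
  ring

theorem continuous_weylOp (ℒ : Submodule ℝ H) (hiso : ∀ φ ∈ ℒ, ∀ ψ ∈ ℒ, sympl φ ψ = 0)
    (x : schwartzSubspace ι) : Continuous fun φ : ℒ => weylOp b (φ : H) x := by
  rw [continuous_iff_continuousAt]
  intro φ
  have hsub : Tendsto (fun ψ : ℒ => (φ : H) - ψ) (𝓝 φ) (𝓝 0) := by
    simpa using (continuous_subtype_val.tendsto φ).const_sub (φ : H)
  have hinner : Tendsto (fun ψ : ℒ => (⟪toFullFock x, weylOp b ((φ : H) - ψ) x⟫_ℂ).re) (𝓝 φ)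
      (𝓝 (‖toFullFock x‖ ^ 2)) := by
    rw [← inner_self_eq_norm_sq (𝕜 := ℂ) (toFullFock x)]
    exact (Complex.continuous_re.tendsto _).comp
      (tendsto_const_nhds.inner ((tendsto_weylOp_zero b x).comp hsub))
  have hsq : Tendsto (fun ψ : ℒ => ‖weylOp b (ψ : H) x - weylOp b (φ : H) x‖ ^ 2) (𝓝 φ) (𝓝 0) := by
    simp only [fun ψ : ℒ => norm_weylOp_sub_weylOp_sq b (hiso ψ ψ.2 φ φ.2) x]
    have h := (hinner.const_mul 2).const_sub (2 * ‖toFullFock x‖ ^ 2)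
    rwa [sub_self] at h
  rw [ContinuousAt, tendsto_iff_norm_sub_tendsto_zero]
  simpa [Real.sqrt_sq] using hsq.sqrt

end WeylOperators

section Intertwining

variable {ι H : Type*} [NormedAddCommGroup H] [InnerProductSpace ℂ H] (b : HilbertBasis ι ℂ H)

theorem mul_pow_succ_of_mul_eq {R : Type*} [Ring R] [Algebra ℂ R] {P T : R} {c : ℂ}
    (h : P * T = T * P + c • 1) (m : ℕ) :
    P * T ^ (m + 1) = T ^ (m + 1) * P + ((m + 1 : ℂ) * c) • T ^ m := by
  induction m with
  | zero => simpa using h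
  | succ m ih =>
    rw [pow_succ T (m + 1), ← mul_assoc, ih, add_mul, mul_assoc, h, smul_mul_assoc, ← pow_succ,
      mul_add, ← mul_assoc, mul_smul_comm, mul_one, add_assoc, ← add_smul]
    congr 2
    push_cast
    ring

variable {P P' : Module.End ℂ (schwartzSubspace ι)} {c : ℂ} {f : H}

theorem inner_expTerm_succ_of_adjoint
    (hadj : ∀ x y, ⟪toFullFock (P x), toFullFock y⟫_ℂ = ⟪toFullFock x, toFullFock (P' y)⟫_ℂ)
    (hcomm : P' * skewOp b f = skewOp b f * P' + c • 1) (x y : schwartzSubspace ι) (m : ℕ) :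
    ⟪toFullFock (P x), expTerm b f y (m + 1)⟫_ℂ =
      ⟪toFullFock x, expTerm b f (P' y) (m + 1)⟫_ℂ + c * ⟪toFullFock x, expTerm b f y m⟫_ℂ := by
  have hpow : P' ((skewOp b f ^ (m + 1)) y) = (skewOp b f ^ (m + 1)) (P' y) +
      ((m + 1 : ℂ) * c) • (skewOp b f ^ m) y :=
    congrArg (fun T : Module.End ℂ (schwartzSubspace ι) => T y) (mul_pow_succ_of_mul_eq hcomm m)
  simp only [expTerm, inner_smul_right, hadj]
  rw [hpow, map_add, map_smul, inner_add_right, inner_smul_right, Nat.factorial_succ]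
  have hfactorial : (m.factorial : ℂ) ≠ 0 := by exact_mod_cast m.factorial_ne_zero
  have hm : (m : ℂ) + 1 ≠ 0 := by exact_mod_cast m.succ_ne_zero
  push_cast
  field_simp

theorem inner_expSeries_of_adjoint
    (hadj : ∀ x y, ⟪toFullFock (P x), toFullFock y⟫_ℂ = ⟪toFullFock x, toFullFock (P' y)⟫_ℂ)
    (hcomm : P' * skewOp b f = skewOp b f * P' + c • 1) (x : schwartzSubspace ι)
    {y : schwartzSubspace ι} (hy : IsFiniteParticle y) (hy' : IsFiniteParticle (P' y)) :
    ⟪toFullFock (P x), expSeries b f y⟫_ℂ =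
      ⟪toFullFock x, expSeries b f (P' y)⟫_ℂ + c * ⟪toFullFock x, expSeries b f y⟫_ℂ := by
  have hsum := (hy.hasSum_expTerm b f).mapL (innerSL ℂ (toFullFock (P x)))
  have hsum' := (hy'.hasSum_expTerm b f).mapL (innerSL ℂ (toFullFock x))
  have hsumc := ((hy.hasSum_expTerm b f).mapL (innerSL ℂ (toFullFock x))).mul_left c
  simp only [innerSL_apply_apply] at hsum hsum' hsumc
  have hdiff := hsum.sub hsum'
  rw [← hasSum_nat_add_iff' 1, Finset.sum_range_one, expTerm_zero, expTerm_zero, hadj, sub_self,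
    sub_zero] at hdiff
  simp only [inner_expTerm_succ_of_adjoint b hadj hcomm, add_sub_cancel_left] at hdiff
  exact sub_eq_iff_eq_add'.1 (hdiff.unique hsumc)

theorem inner_weylOp_of_adjoint
    (hadj : ∀ x y, ⟪toFullFock (P x), toFullFock y⟫_ℂ = ⟪toFullFock x, toFullFock (P' y)⟫_ℂ)
    (hcomm : P' * skewOp b f = skewOp b f * P' + c • 1)
    (hfin : ∀ x, IsFiniteParticle x → IsFiniteParticle (P' x))
    (hlim : ∀ x, Tendsto (fun N => toFullFock (P' (truncateOp N x))) atTop (𝓝 (toFullFock (P' x))))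
    (x y : schwartzSubspace ι) : ⟪toFullFock (P x), weylOp b f y⟫_ℂ =
      ⟪toFullFock x, weylOp b f (P' y)⟫_ℂ + c * ⟪toFullFock x, weylOp b f y⟫_ℂ := by
  have hN := fun N => isFiniteParticle_truncateOp N y
  have htruncate := tendsto_expSeries_truncateOp b f y
  refine tendsto_nhds_unique (tendsto_const_nhds.inner htruncate)
    (((tendsto_const_nhds.inner (tendsto_expSeries b f (fun N => hfin _ (hN N)) (hlim y))).add
      ((tendsto_const_nhds.inner htruncate).const_mul c)).congr fun N => ?_)
  exact (inner_expSeries_of_adjoint b hadj hcomm x (hN N) (hfin _ (hN N))).symm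

theorem annihilationOp_truncateOp_succ (g : H) (N : ℕ) (x : schwartzSubspace ι) :
    annihilationOp b g (truncateOp (N + 1) x) = truncateOp N (annihilationOp b g x) := by
  refine Subtype.ext (funext fun n => funext fun i => ?_)
  change annihilation b g (truncate (N + 1) (x : Family ι)) n i =
    truncate N (annihilation b g (x : Family ι)) n i
  rw [annihilation_apply, truncate_apply, truncate_apply]
  by_cases h : n ≤ N
  · rw [if_pos h, if_pos (Nat.succ_le_succ h)]
    rfl
  · rw [if_neg h, if_neg (by omega)]
    simp

theorem creationOp_truncateOp (g : H) (N : ℕ) (x : schwartzSubspace ι) :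
    creationOp b g (truncateOp N x) = truncateOp (N + 1) (creationOp b g x) := by
  refine Subtype.ext (funext fun n => funext fun i => ?_)
  change creation b g (truncate N (x : Family ι)) n i =
    truncate (N + 1) (creation b g (x : Family ι)) n i
  cases n with
  | zero => rfl
  | succ n =>
    rw [creation_succ, truncate_apply, truncate_apply]
    by_cases h : n ≤ N
    · rw [if_pos h, if_pos (Nat.succ_le_succ h)]
      rfl
    · rw [if_neg h, if_neg (by omega)]
      simp

theorem inner_creationOp_weylOp (f g : H) (x y : schwartzSubspace ι) :
    ⟪toFullFock (creationOp b g x), weylOp b f y⟫_ℂ =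
      ⟪toFullFock x, weylOp b f (annihilationOp b g y)⟫_ℂ +
        ⟪g, f⟫_ℂ * ⟪toFullFock x, weylOp b f y⟫_ℂ := by
  refine inner_weylOp_of_adjoint b (inner_toFullFock_creationOp b g)
    (annihilationOp_mul_skewOp b g f) (fun x ⟨N, hN⟩ => ⟨N, hN.annihilationOp_apply b g⟩)
    (fun x => ?_) x y
  rw [← tendsto_add_atTop_iff_nat 1]
  simp only [annihilationOp_truncateOp_succ]
  exact tendsto_toFullFock_truncateOp _

theorem inner_annihilationOp_weylOp (f g : H) (x y : schwartzSubspace ι) :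
    ⟪toFullFock (annihilationOp b g x), weylOp b f y⟫_ℂ =
      ⟪toFullFock x, weylOp b f (creationOp b g y)⟫_ℂ +
        ⟪f, g⟫_ℂ * ⟪toFullFock x, weylOp b f y⟫_ℂ := by
  refine inner_weylOp_of_adjoint b (inner_toFullFock_annihilationOp b g)
    (creationOp_mul_skewOp b g f) (fun x ⟨N, hN⟩ => ⟨N + 1, hN.creationOp_apply b g⟩)
    (fun x => ?_) x y
  simp only [creationOp_truncateOp]
  exact (tendsto_toFullFock_truncateOp _).comp (tendsto_add_atTop_nat 1)

end Intertwining

/-! ### The physical inner product -/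

section Decay

variable {E F : Type*} [NormedAddCommGroup E] [NormedSpace ℝ E] [FiniteDimensional ℝ E]
  [MeasurableSpace E] [BorelSpace E] (μ : Measure E) [μ.IsAddHaarMeasure]

theorem integrable_of_pow_mul_norm_le [NormedAddCommGroup F] {f : E → F} (hf : Continuous f)
    (h : ∀ m : ℕ, ∃ C : ℝ, ∀ x, ‖x‖ ^ m * ‖f x‖ ≤ C) : Integrable f μ := by
  set k := Module.finrank ℝ E + 1 with hk
  obtain ⟨C, hC⟩ := h 0
  obtain ⟨D, hD⟩ := h k
  have hint : Integrable (fun x : E => (1 + ‖x‖) ^ (-(k : ℝ))) μ :=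
    integrable_one_add_norm (by rw [hk]; exact_mod_cast Nat.lt_succ_self _)
  refine (hint.const_mul (2 ^ (k - 1) * (C + D))).mono' hf.aestronglyMeasurable
    (Eventually.of_forall fun x => ?_)
  rw [Real.rpow_neg (by positivity), Real.rpow_natCast, ← div_eq_mul_inv,
    le_div_iff₀ (by positivity)]
  have hone : ‖f x‖ ≤ C := by simpa using hC x
  calc ‖f x‖ * (1 + ‖x‖) ^ k ≤ ‖f x‖ * (2 ^ (k - 1) * (1 ^ k + ‖x‖ ^ k)) := by
        gcongr
        exact add_pow_le zero_le_one (norm_nonneg x) k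
    _ = 2 ^ (k - 1) * (‖f x‖ + ‖x‖ ^ k * ‖f x‖) := by rw [one_pow]; ring
    _ ≤ 2 ^ (k - 1) * (C + D) := by gcongr; exact hD x

end Decay

section PositiveDefinite

theorem inner_integral_integral {α F : Type*} [MeasurableSpace α] (μ : Measure α)
    [NormedAddCommGroup F] [InnerProductSpace ℂ F] [CompleteSpace F] {u v : α → F}
    (hu : Integrable u μ) (hv : Integrable v μ) :
    ⟪∫ x, u x ∂μ, ∫ y, v y ∂μ⟫_ℂ = ∫ x, ∫ y, ⟪u x, v y⟫_ℂ ∂μ ∂μ := by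
  simp only [integral_inner hv]
  rw [← inner_conj_symm, ← integral_inner hu, ← integral_conj]
  simp only [inner_conj_symm]

variable {E F : Type*} [NormedAddCommGroup E]

/-- The Gaussian weight `exp(-s ‖x‖²)`, used to regularize integrals over the constraint plane. -/
def gaussWeight (s : ℝ) (x : E) : ℝ := Real.exp (-s * ‖x‖ ^ 2)

theorem gaussWeight_pos (s : ℝ) (x : E) : 0 < gaussWeight s x := Real.exp_pos _

theorem norm_gaussWeight (s : ℝ) (x : E) : ‖gaussWeight s x‖ = gaussWeight s x :=
  Real.norm_of_nonneg (gaussWeight_pos s x).le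

theorem gaussWeight_le_one {s : ℝ} (hs : 0 ≤ s) (x : E) : gaussWeight s x ≤ 1 :=
  Real.exp_le_one_iff.2 (mul_nonpos_of_nonpos_of_nonneg (neg_nonpos.2 hs) (sq_nonneg _))

@[fun_prop]
theorem continuous_gaussWeight (s : ℝ) : Continuous (gaussWeight s : E → ℝ) := by
  unfold gaussWeight
  fun_prop

theorem tendsto_gaussWeight_zero (x : E) : Tendsto (fun s => gaussWeight s x) (𝓝 0) (𝓝 1) := by
  have hcont : Continuous fun s : ℝ => gaussWeight s x := by
    unfold gaussWeight
    fun_prop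
  simpa [gaussWeight] using hcont.tendsto 0

variable [InnerProductSpace ℝ E]

theorem gaussWeight_mul_gaussWeight_add (s : ℝ) (x y : E) :
    gaussWeight s x * gaussWeight s (y + x) =
      gaussWeight (s / 2) y * gaussWeight (2 * s) (x + (2⁻¹ : ℝ) • y) := by
  simp only [gaussWeight]
  rw [← Real.exp_add, ← Real.exp_add, @norm_add_sq_real, @norm_add_sq_real, inner_smul_right,
    norm_smul, Real.norm_of_nonneg (by norm_num), real_inner_comm]
  congr 1
  ring

variable [MeasurableSpace E] [BorelSpace E] (μ : Measure E) [μ.IsAddHaarMeasure]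

theorem integral_gaussWeight_mul_gaussWeight_add (s : ℝ) (y : E) :
    ∫ x, gaussWeight s x * gaussWeight s (y + x) ∂μ =
      gaussWeight (s / 2) y * ∫ x, gaussWeight (2 * s) x ∂μ := by
  simp only [gaussWeight_mul_gaussWeight_add]
  rw [integral_const_mul, integral_add_right_eq_self (fun x => gaussWeight (2 * s) x)]

variable [FiniteDimensional ℝ E]

theorem integrable_gaussWeight {s : ℝ} (hs : 0 < s) : Integrable (gaussWeight s : E → ℝ) μ := by
  have heven : ∀ (m : ℕ) (x : E), ‖x‖ ^ (2 * m) * gaussWeight s x ≤ m.factorial / s ^ m := by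
    intro m x
    have h := Real.pow_div_factorial_le_exp (s * ‖x‖ ^ 2) (by positivity) m
    have hfactorial : (0 : ℝ) < m.factorial := by exact_mod_cast m.factorial_pos
    rw [gaussWeight, neg_mul, Real.exp_neg, ← div_eq_mul_inv,
      div_le_div_iff₀ (Real.exp_pos _) (by positivity)]
    rw [div_le_iff₀ hfactorial, mul_pow, ← pow_mul] at h
    linarith
  refine integrable_of_pow_mul_norm_le μ (continuous_gaussWeight s) fun m =>
    ⟨1 + m.factorial / s ^ m, fun x => ?_⟩
  have hpow : ‖x‖ ^ m ≤ 1 + ‖x‖ ^ (2 * m) := by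
    rw [mul_comm, pow_mul]
    nlinarith [sq_nonneg (‖x‖ ^ m - 1), sq_nonneg (‖x‖ ^ m)]
  calc ‖x‖ ^ m * ‖gaussWeight s x‖ ≤ (1 + ‖x‖ ^ (2 * m)) * gaussWeight s x := by
        rw [norm_gaussWeight]
        exact mul_le_mul_of_nonneg_right hpow (gaussWeight_pos s x).le
    _ = gaussWeight s x + ‖x‖ ^ (2 * m) * gaussWeight s x := by ring
    _ ≤ 1 + m.factorial / s ^ m := add_le_add (gaussWeight_le_one hs.le x) (heven m x)

variable {κ : E → ℂ}

theorem integrable_gaussWeight_mul_gaussWeight_add_mul {s : ℝ} (hs : 0 < s) (hκ : Continuous κ)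
    (hκi : Integrable κ μ) : Integrable (fun z : E × E =>
      ((gaussWeight s z.1 * gaussWeight s (z.2 + z.1) : ℝ) : ℂ) * κ z.2) (μ.prod μ) := by
  refine ((integrable_gaussWeight μ hs).mul_prod hκi.norm).mono'
    (Continuous.aestronglyMeasurable (by fun_prop)) (Eventually.of_forall fun z => ?_)
  rw [norm_mul, Complex.norm_real, norm_mul, norm_gaussWeight, norm_gaussWeight]
  exact mul_le_mul_of_nonneg_right
    (mul_le_of_le_one_right (gaussWeight_pos _ _).le (gaussWeight_le_one hs.le _)) (norm_nonneg _)

variable [NormedAddCommGroup F] [InnerProductSpace ℂ F] [CompleteSpace F] {W : E → F}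

-- The integral is, up to a positive factor, the squared norm of `∫ exp(-s ‖x‖²) W x`.
theorem re_integral_gaussWeight_mul_nonneg (hW : Continuous W) {C : ℝ} (hC : ∀ x, ‖W x‖ ≤ C)
    (hWκ : ∀ x y, ⟪W x, W y⟫_ℂ = κ (y - x)) (hκ : Continuous κ) (hκi : Integrable κ μ)
    {s : ℝ} (hs : 0 < s) : 0 ≤ (∫ y, (gaussWeight (s / 2) y : ℂ) * κ y ∂μ).re := by
  have hint : Integrable (fun x => (gaussWeight s x : ℂ) • W x) μ := by
    refine ((integrable_gaussWeight μ hs).mul_const C).mono'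
      (Continuous.aestronglyMeasurable (by fun_prop)) (Eventually.of_forall fun x => ?_)
    rw [norm_smul, Complex.norm_real, norm_gaussWeight]
    exact mul_le_mul_of_nonneg_left (hC x) (gaussWeight_pos s x).le
  have hinner : ∀ x y, ⟪(gaussWeight s x : ℂ) • W x, (gaussWeight s (y + x) : ℂ) • W (y + x)⟫_ℂ =
      ((gaussWeight s x * gaussWeight s (y + x) : ℝ) : ℂ) * κ y := fun x y => by
    rw [inner_smul_left, inner_smul_right, hWκ, add_sub_cancel_right, Complex.conj_ofReal,
      Complex.ofReal_mul, mul_assoc]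
  have hsq : ⟪∫ x, (gaussWeight s x : ℂ) • W x ∂μ, ∫ x, (gaussWeight s x : ℂ) • W x ∂μ⟫_ℂ =
      (∫ x, gaussWeight (2 * s) x ∂μ : ℝ) * ∫ y, (gaussWeight (s / 2) y : ℂ) * κ y ∂μ := by
    calc _ = ∫ x, ∫ y, ⟪(gaussWeight s x : ℂ) • W x, (gaussWeight s y : ℂ) • W y⟫_ℂ ∂μ ∂μ :=
          inner_integral_integral μ hint hint
      _ = ∫ x, ∫ y, ((gaussWeight s x * gaussWeight s (y + x) : ℝ) : ℂ) * κ y ∂μ ∂μ := by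
          refine integral_congr_ae (Eventually.of_forall fun x => ?_)
          simp only [← hinner]
          exact (integral_add_right_eq_self
            (fun y => ⟪(gaussWeight s x : ℂ) • W x, (gaussWeight s y : ℂ) • W y⟫_ℂ) x).symm
      _ = ∫ y, ∫ x, ((gaussWeight s x * gaussWeight s (y + x) : ℝ) : ℂ) * κ y ∂μ ∂μ :=
          integral_integral_swap (integrable_gaussWeight_mul_gaussWeight_add_mul μ hs hκ hκi)
      _ = _ := by
          simp only [integral_mul_const, integral_complex_ofReal,
            integral_gaussWeight_mul_gaussWeight_add]
          rw [← integral_const_mul]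
          refine integral_congr_ae (Eventually.of_forall fun y => ?_)
          push_cast
          ring
  have hnonneg := inner_self_nonneg (𝕜 := ℂ) (x := ∫ x, (gaussWeight s x : ℂ) • W x ∂μ)
  rw [hsq, RCLike.re_eq_complex_re, Complex.re_ofReal_mul] at hnonneg
  exact nonneg_of_mul_nonneg_right hnonneg
    (integral_exp_pos (integrable_gaussWeight μ (mul_pos two_pos hs)))

theorem re_integral_nonneg_of_inner_eq (hW : Continuous W) {C : ℝ} (hC : ∀ x, ‖W x‖ ≤ C)
    (hWκ : ∀ x y, ⟪W x, W y⟫_ℂ = κ (y - x)) (hκ : Continuous κ) (hκi : Integrable κ μ) :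
    0 ≤ (∫ y, κ y ∂μ).re := by
  have hs : ∀ n : ℕ, 0 < 1 / ((n : ℝ) + 1) := fun n => by positivity
  have hlim : Tendsto (fun n : ℕ => ∫ y, (gaussWeight (1 / ((n : ℝ) + 1) / 2) y : ℂ) * κ y ∂μ)
      atTop (𝓝 (∫ y, κ y ∂μ)) := by
    refine tendsto_integral_of_dominated_convergence _
      (fun n => Continuous.aestronglyMeasurable (by fun_prop)) hκi.norm
      (fun n => Eventually.of_forall fun y => ?_) (Eventually.of_forall fun y => ?_)
    · rw [norm_mul, Complex.norm_real, norm_gaussWeight]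
      exact mul_le_of_le_one_left (norm_nonneg _) (gaussWeight_le_one (half_pos (hs n)).le y)
    · have hzero : Tendsto (fun n : ℕ => 1 / ((n : ℝ) + 1) / 2) atTop (𝓝 0) := by
        simpa using tendsto_one_div_add_atTop_nhds_zero_nat (𝕜 := ℝ).div_const 2
      simpa using ((Complex.continuous_ofReal.tendsto 1).comp
        ((tendsto_gaussWeight_zero y).comp hzero)).mul_const (κ y)
  exact ge_of_tendsto' ((Complex.continuous_re.tendsto _).comp hlim) fun n =>
    re_integral_gaussWeight_mul_nonneg μ hW hC hWκ hκ hκi (hs n)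

end PositiveDefinite

section PhysicalForm

variable {ι H : Type*} [NormedAddCommGroup H] [InnerProductSpace ℂ H] (b : HilbertBasis ι ℂ H)

attribute [local instance] InnerProductSpace.complexToReal

theorem exists_norm_le_sum_inner (ℒ : Submodule ℝ H) [FiniteDimensional ℝ ℒ] :
    ∃ (n : ℕ) (e : Fin n → ℒ), ∀ φ : ℒ, ‖φ‖ ≤ ∑ j, ‖⟪(e j : H), (φ : H)⟫_ℂ‖ := by
  let e := stdOrthonormalBasis ℝ ℒ
  refine ⟨_, e, fun φ => ?_⟩
  calc ‖φ‖ = ‖∑ j, ⟪e j, φ⟫_ℝ • e j‖ := by rw [e.sum_repr']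
    _ ≤ ∑ j, ‖⟪e j, φ⟫_ℝ • e j‖ := norm_sum_le _ _
    _ ≤ _ := by
      refine Finset.sum_le_sum fun j _ => ?_
      rw [norm_smul, e.norm_eq_one, mul_one]
      exact Complex.abs_re_le_norm _

-- Each factor `(e, φ)` is absorbed by commuting `a⁺[e]` through the Weyl operator.
theorem exists_pow_mul_norm_inner_weylOp_le (ℒ : Submodule ℝ H) [FiniteDimensional ℝ ℒ] (m : ℕ)
    (x y : schwartzSubspace ι) :
    ∃ C : ℝ, ∀ φ : ℒ, ‖φ‖ ^ m * ‖⟪toFullFock x, weylOp b (φ : H) y⟫_ℂ‖ ≤ C := by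
  obtain ⟨n, e, he⟩ := exists_norm_le_sum_inner ℒ
  induction m generalizing x y with
  | zero =>
    refine ⟨‖toFullFock x‖ * ‖toFullFock y‖, fun φ => ?_⟩
    rw [pow_zero, one_mul, ← norm_weylOp b (φ : H) y]
    exact norm_inner_le_norm _ _
  | succ m ih =>
    choose C hC using ih
    refine ⟨∑ j, (C (creationOp b (e j) x) y + C x (annihilationOp b (e j) y)), fun φ => ?_⟩
    set k := ⟪toFullFock x, weylOp b (φ : H) y⟫_ℂ
    have hterm : ∀ j, ‖φ‖ ^ m * (‖⟪(e j : H), (φ : H)⟫_ℂ‖ * ‖k‖) ≤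
        C (creationOp b (e j) x) y + C x (annihilationOp b (e j) y) := fun j => by
      rw [← norm_mul, ← sub_eq_iff_eq_add'.2 (inner_creationOp_weylOp b φ (e j) x y)]
      calc _ ≤ ‖φ‖ ^ m * (‖⟪toFullFock (creationOp b (e j) x), weylOp b φ y⟫_ℂ‖ +
            ‖⟪toFullFock x, weylOp b φ (annihilationOp b (e j) y)⟫_ℂ‖) := by
            gcongr
            exact norm_sub_le _ _
        _ ≤ _ := by
            rw [mul_add]
            exact add_le_add (hC _ _ φ) (hC _ _ φ)
    calc ‖φ‖ ^ (m + 1) * ‖k‖ = ‖φ‖ ^ m * (‖φ‖ * ‖k‖) := by ring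
      _ ≤ ‖φ‖ ^ m * ((∑ j, ‖⟪(e j : H), (φ : H)⟫_ℂ‖) * ‖k‖) := by
        gcongr
        exact he φ
      _ = ∑ j, ‖φ‖ ^ m * (‖⟪(e j : H), (φ : H)⟫_ℂ‖ * ‖k‖) := by
        rw [Finset.sum_mul, Finset.mul_sum]
      _ ≤ _ := Finset.sum_le_sum fun j _ => hterm j

theorem continuous_inner_weylOp {ℒ : Submodule ℝ H}
    (hiso : ∀ φ ∈ ℒ, ∀ ψ ∈ ℒ, sympl φ ψ = 0) (x y : schwartzSubspace ι) :
    Continuous fun φ : ℒ => ⟪toFullFock x, weylOp b (φ : H) y⟫_ℂ :=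
  continuous_const.inner (continuous_weylOp b ℒ hiso y)

theorem inner_weylOp_neg (f : H) (x y : schwartzSubspace ι) :
    ⟪toFullFock x, weylOp b (-f) y⟫_ℂ = starRingEnd ℂ ⟪toFullFock y, weylOp b f x⟫_ℂ := by
  have h := inner_weylOp b (f := f) (g := 0) (by simp [sympl]) x y
  rw [weylOp_zero, zero_sub] at h
  rw [inner_conj_symm, h]

variable [MeasurableSpace H] {ℒ : Submodule ℝ H} (μ : Measure ℒ)

/-- The physical inner product `⟨x, y⟩ = ∫_ℒ dμ(φ) (x, exp(iΩ[φ]) y)` as a form on the space `S`. -/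
def physForm (x y : schwartzSubspace ι) : ℂ :=
  ∫ φ : ℒ, ⟪toFullFock x, weylOp b (φ : H) y⟫_ℂ ∂μ

theorem physForm_smul_right (c : ℂ) (x y : schwartzSubspace ι) :
    physForm b μ x (c • y) = c * physForm b μ x y := by
  simp only [physForm, weylOp_smul, inner_smul_right, integral_const_mul]

theorem physForm_smul_left (c : ℂ) (x y : schwartzSubspace ι) :
    physForm b μ (c • x) y = starRingEnd ℂ c * physForm b μ x y := by
  simp only [physForm, map_smul, inner_smul_left, integral_const_mul]

variable [BorelSpace H] [FiniteDimensional ℝ ℒ] [μ.IsAddHaarMeasure]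

theorem conj_physForm (x y : schwartzSubspace ι) :
    starRingEnd ℂ (physForm b μ y x) = physForm b μ x y := by
  rw [physForm, physForm,
    ← integral_neg_eq_self fun φ : ℒ => ⟪toFullFock x, weylOp b (φ : H) y⟫_ℂ, ← integral_conj]
  simp only [NegMemClass.coe_neg, inner_weylOp_neg]

theorem integrable_inner_weylOp (hiso : ∀ φ ∈ ℒ, ∀ ψ ∈ ℒ, sympl φ ψ = 0)
    (x y : schwartzSubspace ι) :
    Integrable (fun φ : ℒ => ⟪toFullFock x, weylOp b (φ : H) y⟫_ℂ) μ :=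
  integrable_of_pow_mul_norm_le μ (continuous_inner_weylOp b hiso x y)
    fun m => exists_pow_mul_norm_inner_weylOp_le b ℒ m x y

theorem physForm_add_left (hiso : ∀ φ ∈ ℒ, ∀ ψ ∈ ℒ, sympl φ ψ = 0)
    (x y z : schwartzSubspace ι) :
    physForm b μ (x + y) z = physForm b μ x z + physForm b μ y z := by
  simp only [physForm, map_add, inner_add_left]
  exact integral_add (integrable_inner_weylOp b μ hiso x z) (integrable_inner_weylOp b μ hiso y z)

theorem re_physForm_self_nonneg (hiso : ∀ φ ∈ ℒ, ∀ ψ ∈ ℒ, sympl φ ψ = 0)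
    (x : schwartzSubspace ι) : 0 ≤ (physForm b μ x x).re :=
  re_integral_nonneg_of_inner_eq μ (continuous_weylOp b ℒ hiso x) (fun φ => (norm_weylOp b φ x).le)
    (fun φ ψ => inner_weylOp b (hiso φ φ.2 ψ ψ.2) x x) (continuous_inner_weylOp b hiso x x)
    (integrable_inner_weylOp b μ hiso x x)

/-- The positive semidefinite inner product structure of `S` given by `physForm`; it supplies the
Cauchy–Schwarz inequality. -/
@[reducible]
def physCore (hiso : ∀ φ ∈ ℒ, ∀ ψ ∈ ℒ, sympl φ ψ = 0) :
    PreInnerProductSpace.Core ℂ (schwartzSubspace ι) where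
  inner := physForm b μ
  conj_inner_symm := conj_physForm b μ
  re_inner_nonneg := re_physForm_self_nonneg b μ hiso
  add_left := physForm_add_left b μ hiso
  smul_left x y c := physForm_smul_left b μ c x y

theorem physForm_eq_zero_of_self_eq_zero (hiso : ∀ φ ∈ ℒ, ∀ ψ ∈ ℒ, sympl φ ψ = 0)
    {x : schwartzSubspace ι} (hx : physForm b μ x x = 0) (y : schwartzSubspace ι) :
    physForm b μ y x = 0 := by
  have hcauchy : ‖physForm b μ y x‖ * ‖physForm b μ x y‖ ≤
      (physForm b μ y y).re * (physForm b μ x x).re :=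
    @InnerProductSpace.Core.inner_mul_inner_self_le ℂ _ _ _ _ (physCore b μ hiso) y x
  rw [hx, Complex.zero_re, mul_zero, ← conj_physForm b μ x y, RCLike.norm_conj] at hcauchy
  exact norm_eq_zero.1 (mul_self_eq_zero.1 (hcauchy.antisymm (mul_self_nonneg _)))

end PhysicalForm

section Adjoint

variable {ι H : Type*} [NormedAddCommGroup H] [InnerProductSpace ℂ H] (b : HilbertBasis ι ℂ H)

/-- The operator `a⁻[v] - a⁺[M v]`, which annihilates the Gaussian vector `Ψ_M`. -/
def gaussAnnihilator (M : H →L⋆[ℂ] H) (v : H) : Module.End ℂ (schwartzSubspace ι) :=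
  annihilationOp b v - creationOp b (M v)

/-- The operator `a⁺[v] - a⁻[M v]`, adjoint to `gaussAnnihilator` on the Fock space and, for
admissible `v`, also in the physical inner product. -/
def gaussCreator (M : H →L⋆[ℂ] H) (v : H) : Module.End ℂ (schwartzSubspace ι) :=
  creationOp b v - annihilationOp b (M v)

theorem physForm_gaussAnnihilator [MeasurableSpace H] {ℒ : Submodule ℝ H} (μ : Measure ℒ)
    {M : H →L⋆[ℂ] H} (hs : IsSymmKernel M) {v : H} (hv : IsAdmissible M ℒ v)
    (x y : schwartzSubspace ι) :
    physForm b μ x (gaussAnnihilator b M v y) = physForm b μ (gaussCreator b M v x) y := by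
  refine integral_congr_ae (Eventually.of_forall fun φ => ?_)
  have hcreation := inner_creationOp_weylOp b (φ : H) v x y
  have hannihilation := inner_annihilationOp_weylOp b (φ : H) (M v) x y
  have hadmissible := hv φ φ.2
  rw [inner_sub_right, hs] at hadmissible
  simp only [gaussAnnihilator, gaussCreator, LinearMap.sub_apply, map_sub, inner_sub_left,
    weylOp_sub, inner_sub_right]
  linear_combination hannihilation - hcreation -
    hadmissible * ⟪toFullFock x, weylOp b (φ : H) y⟫_ℂ

end Adjoint

/-! ### Pair creation and the Gaussian vector -/

section PairCreation

variable {ι H : Type*} [NormedAddCommGroup H] [InnerProductSpace ℂ H] (b : HilbertBasis ι ℂ H)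

theorem exists_continuousLinearMap_eq_creation (Ψ : Family ι) (n : ℕ) (i : Fin n → ι) :
    ∃ ℓ : H →L[ℂ] ℂ, ∀ f, ℓ f = creation b f Ψ n i := by
  cases n with
  | zero => exact ⟨0, fun _ => rfl⟩
  | succ n =>
    refine ⟨(√(n + 1 : ℝ) : ℂ)⁻¹ •
      ∑ j, Ψ n (fun l => i (j.succAbove l)) • innerSL ℂ (b (i j)), fun f => ?_⟩
    simp [creation_succ, mul_comm (Ψ n _)]

theorem hasSum_creation (f : H) (Ψ : Family ι) (n : ℕ) (i : Fin n → ι) :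
    HasSum (fun q => ⟪b q, f⟫_ℂ * creation b (b q) Ψ n i) (creation b f Ψ n i) := by
  obtain ⟨ℓ, hℓ⟩ := exists_continuousLinearMap_eq_creation b Ψ n i
  simp only [← hℓ]
  simpa [b.repr_apply_apply] using (b.hasSum_repr f).mapL ℓ

theorem hasSum_creation_apply (M : H →L⋆[ℂ] H) (x : H) (Ψ : Family ι) (n : ℕ) (i : Fin n → ι) :
    HasSum (fun p => ⟪x, b p⟫_ℂ * creation b (M (b p)) Ψ n i) (creation b (M x) Ψ n i) := by
  obtain ⟨ℓ, hℓ⟩ := exists_continuousLinearMap_eq_creation b Ψ n i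
  simp only [← hℓ]
  simpa [b.repr_apply_apply] using ((b.hasSum_repr x).mapL M).mapL ℓ

theorem creation_succ_eq_zero (f : H) {Ψ : Family ι} {n : ℕ} (h : Ψ n = 0) :
    creation b f Ψ (n + 1) = 0 := by
  funext i
  simp [creation_succ, h]

theorem hasSum_createPair_succ {M : H →L⋆[ℂ] H} (hs : IsSymmKernel M) (Ψ : Family ι) (n : ℕ)
    (i : Fin (n + 1) → ι) :
    HasSum (fun x : ι × ι => ⟪b x.1, M (b x.2)⟫_ℂ *
        creation b (b x.1) (creation b (b x.2) Ψ) (n + 1) i)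
      (((√(n + 1 : ℝ))⁻¹ : ℝ) * ∑ j, creation b (M (b (i j))) Ψ n fun l => i (j.succAbove l)) := by
  classical
  have hinsert (j : Fin (n + 1)) : HasSum (fun x : ι × ι => ⟪b x.1, M (b x.2)⟫_ℂ *
      (⟪b (i j), b x.1⟫_ℂ * creation b (b x.2) Ψ n fun l => i (j.succAbove l)))
      (creation b (M (b (i j))) Ψ n fun l => i (j.succAbove l)) := by
    rw [← (Prod.mk_right_injective (i j)).hasSum_iff]
    · simpa [Function.comp_def, hs (b (i j)), orthonormal_iff_ite.1 b.orthonormal] using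
        hasSum_creation b (M (b (i j))) Ψ n fun l => i (j.succAbove l)
    · rintro ⟨p, q⟩ hx
      have hne : i j ≠ p := fun h => hx ⟨q, Prod.ext h rfl⟩
      simp [orthonormal_iff_ite.1 b.orthonormal, hne]
  simpa only [creation_succ, mul_left_comm _ (((√(n + 1 : ℝ))⁻¹ : ℝ) : ℂ), Finset.mul_sum] using
    (hasSum_sum fun j (_ : j ∈ Finset.univ) => hinsert j).mul_left (((√(n + 1 : ℝ))⁻¹ : ℝ) : ℂ)

theorem createPair_succ {M : H →L⋆[ℂ] H} (hs : IsSymmKernel M) (Ψ : Family ι) (n : ℕ)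
    (i : Fin (n + 1) → ι) : createPair b M Ψ (n + 1) i =
      ((√(n + 1 : ℝ))⁻¹ : ℝ) * ∑ j, creation b (M (b (i j))) Ψ n fun l => i (j.succAbove l) :=
  (hasSum_createPair_succ b hs Ψ n i).tsum_eq

theorem createPair_zero (M : H →L⋆[ℂ] H) (Ψ : Family ι) : createPair b M Ψ 0 = 0 := by
  funext i
  simp [createPair, creation]

theorem hasSum_createPair {M : H →L⋆[ℂ] H} (hs : IsSymmKernel M) (Ψ : Family ι) (n : ℕ)
    (i : Fin n → ι) :
    HasSum (fun x : ι × ι => ⟪b x.1, M (b x.2)⟫_ℂ *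
        creation b (b x.1) (creation b (b x.2) Ψ) n i) (createPair b M Ψ n i) := by
  cases n with
  | zero => simp [createPair_zero, creation, hasSum_zero]
  | succ n =>
    rw [createPair_succ b hs]
    exact hasSum_createPair_succ b hs Ψ n i

theorem createPair_smul (M : H →L⋆[ℂ] H) (c : ℂ) (Ψ : Family ι) :
    createPair b M (c • Ψ) = c • createPair b M Ψ := by
  funext n i
  simp only [createPair, creation_smul, Pi.smul_apply, smul_eq_mul, mul_left_comm _ c,
    tsum_mul_left]

theorem createPair_creation {M : H →L⋆[ℂ] H} (hs : IsSymmKernel M) (f : H) (Ψ : Family ι) :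
    createPair b M (creation b f Ψ) = creation b f (createPair b M Ψ) := by
  funext n i
  refine (hasSum_createPair b hs _ n i).unique ?_
  simp only [creation_comm b _ f]
  cases n with
  | zero => simp [creation, hasSum_zero]
  | succ n =>
    simpa only [creation_succ, mul_left_comm _ (((√(n + 1 : ℝ))⁻¹ : ℝ) : ℂ), Finset.mul_sum,
      mul_left_comm ⟪b _, M _⟫_ℂ] using
      (hasSum_sum fun j (_ : j ∈ Finset.univ) =>
        (hasSum_createPair b hs Ψ n fun l => i (j.succAbove l)).mul_left ⟪b (i j), f⟫_ℂ).mul_left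
          (((√(n + 1 : ℝ))⁻¹ : ℝ) : ℂ)

theorem squareSummable_creation_apply {M : H →L⋆[ℂ] H} (hM : Summable fun p => ‖M (b p)‖ ^ 2)
    {Ψ : Family ι} (hΨ : HasSquareSummableSectors Ψ) (n : ℕ) :
    SquareSummable fun x : ι × (Fin n → ι) => creation b (M (b x.1)) Ψ n x.2 := by
  refine squareSummable_prod_of_fiberwise (fun q => hΨ.creation b (M (b q)) n) ?_
  cases n with
  | zero => exact summable_zero.congr fun _ => sqNorm_zero.symm
  | succ n =>
    exact .of_nonneg_of_le (fun q => sqNorm_nonneg _)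
      (fun q => sqNorm_creation_succ_le b (M (b q)) (hΨ n)) ((hM.mul_left _).mul_right _)

theorem HasSquareSummableSectors.createPair {M : H →L⋆[ℂ] H} (hs : IsSymmKernel M)
    (hM : Summable fun p => ‖M (b p)‖ ^ 2) {Ψ : Family ι} (hΨ : HasSquareSummableSectors Ψ) :
    HasSquareSummableSectors (createPair b M Ψ) := by
  intro n
  cases n with
  | zero =>
    rw [createPair_zero]
    exact squareSummable_zero
  | succ n =>
    have hinsert (j : Fin (n + 1)) : SquareSummable fun i : Fin (n + 1) → ι =>
        ConstrainedFock.creation b (M (b (i j))) Ψ n fun l => i (j.succAbove l) := by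
      rw [← squareSummable_comp_equiv (Fin.insertNthEquiv (fun _ => ι) j)]
      simpa using squareSummable_creation_apply b hM hΨ n
    have hsum := (squareSummable_sum (s := Finset.univ) fun j _ => hinsert j).const_smul
      (((√(n + 1 : ℝ))⁻¹ : ℝ) : ℂ)
    convert hsum using 1
    funext i
    simp [createPair_succ b hs]

theorem tsum_mul_creation_cons (x f : H) {Ψ : Family ι} (hΨ : HasSquareSummableSectors Ψ) (n : ℕ)
    (i : Fin n → ι) :
    ∑' p, ⟪x, b p⟫_ℂ * creation b f Ψ (n + 1) (Fin.cons p i) =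
      ((√(n + 1 : ℝ))⁻¹ : ℝ) * (creation b f (annihilation b x Ψ) n i + ⟪x, f⟫_ℂ * Ψ n i) := by
  have h := congrFun (congrFun (annihilation_creation b x f hΨ) n) i
  rw [annihilation_apply] at h
  simp only [Pi.add_apply, Pi.smul_apply, smul_eq_mul] at h
  rw [← h, Complex.ofReal_inv, inv_mul_cancel_left₀ (sqrt_succ_ne_zero n)]

theorem tsum_mul_createPair_cons_cons {M : H →L⋆[ℂ] H} (hs : IsSymmKernel M)
    (x : H) {Ψ : Family ι} (hΨ : HasSquareSummableSectors Ψ) (n : ℕ) (i : Fin (n + 1) → ι) :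
    ∑' p, ∑ j, ⟪x, b p⟫_ℂ *
        creation b (M (b (i j))) Ψ (n + 1) (Fin.cons p fun l => i (j.succAbove l)) =
      createPair b M (annihilation b x Ψ) (n + 1) i + creation b (M x) Ψ (n + 1) i := by
  rw [Summable.tsum_finsetSum fun j _ => summable_mul_cons (squareSummable_coord_left b x)
    (hΨ.creation b (M (b (i j))) (n + 1)) fun l => i (j.succAbove l)]
  simp only [tsum_mul_creation_cons b x _ hΨ, hs x]
  rw [createPair_succ b hs, creation_succ, ← Finset.mul_sum, Finset.sum_add_distrib, mul_add]

theorem annihilation_createPair {M : H →L⋆[ℂ] H} (hs : IsSymmKernel M)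
    (x : H) {Ψ : Family ι} (hΨ : HasSquareSummableSectors Ψ) :
    annihilation b x (createPair b M Ψ) =
      createPair b M (annihilation b x Ψ) + (2 : ℂ) • creation b (M x) Ψ := by
  funext n i
  have hexpand (p : ι) : ⟪x, b p⟫_ℂ * createPair b M Ψ (n + 1) (Fin.cons p i) =
      ((√(n + 1 : ℝ))⁻¹ : ℝ) * (⟪x, b p⟫_ℂ * creation b (M (b p)) Ψ n i +
        ∑ j : Fin n, ⟪x, b p⟫_ℂ * creation b (M (b (i j))) Ψ n fun l =>
          (Fin.cons p i : Fin (n + 1) → ι) (j.succ.succAbove l)) := by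
    rw [createPair_succ b hs, Fin.sum_univ_succ, mul_left_comm, mul_add, Finset.mul_sum]
    simp
  have hfirst := hasSum_creation_apply b M x Ψ n i
  simp only [annihilation_apply, hexpand, tsum_mul_left, Pi.add_apply, Pi.smul_apply, smul_eq_mul]
  rw [Complex.ofReal_inv, mul_inv_cancel_left₀ (sqrt_succ_ne_zero n)]
  cases n with
  | zero => simp [creation, createPair_zero]
  | succ n =>
    simp only [cons_comp_succAbove_succ]
    rw [hfirst.summable.tsum_add (summable_sum fun j _ =>
        summable_mul_cons (squareSummable_coord_left b x)
          (hΨ.creation b (M (b (i j))) (n + 1)) fun l => i (j.succAbove l)),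
      hfirst.tsum_eq, tsum_mul_createPair_cons_cons b hs x hΨ]
    ring

end PairCreation

section Gaussian

variable {ι H : Type*} [NormedAddCommGroup H] [InnerProductSpace ℂ H] (b : HilbertBasis ι ℂ H)

/-- The vector `(½ a⁺Ma⁺)^m |0⟩`, so that `Ψ_M = ∑ₘ gaussTerm b M m / m!`. -/
def gaussTerm (M : H →L⋆[ℂ] H) (m : ℕ) : Family ι :=
  (fun Φ : Family ι => (1 / 2 : ℂ) • createPair b M Φ)^[m] vacuum

theorem gaussTerm_succ (M : H →L⋆[ℂ] H) (m : ℕ) :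
    gaussTerm b M (m + 1) = (1 / 2 : ℂ) • createPair b M (gaussTerm b M m) :=
  Function.iterate_succ_apply' _ _ _

theorem vacuum_succ (n : ℕ) : (vacuum : Family ι) (n + 1) = 0 := rfl

theorem hasSquareSummableSectors_vacuum : HasSquareSummableSectors (vacuum : Family ι)
  | 0 => (hasSum_fintype _).summable
  | _ + 1 => squareSummable_zero

theorem annihilation_vacuum (x : H) : annihilation b x (vacuum : Family ι) = 0 := by
  funext n i
  simp [annihilation_apply, vacuum_succ]

theorem gaussTerm_eq_zero {M : H →L⋆[ℂ] H} (hs : IsSymmKernel M) {m n : ℕ} (h : n ≠ 2 * m) :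
    gaussTerm b M m n = 0 := by
  induction m generalizing n with
  | zero =>
    obtain ⟨n, rfl⟩ := Nat.exists_eq_succ_of_ne_zero h
    exact vacuum_succ n
  | succ m ih =>
    rw [gaussTerm_succ]
    funext i
    match n, i with
    | 0, i => simp [createPair_zero]
    | 1, i => simp [createPair_succ b hs, creation]
    | n + 2, i =>
      have hz (f : H) : creation b f (gaussTerm b M m) (n + 1) = 0 :=
        creation_succ_eq_zero b f (ih (by omega))
      simp [createPair_succ b hs, hz]

theorem hasSquareSummableSectors_gaussTerm {M : H →L⋆[ℂ] H} (hs : IsSymmKernel M)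
    (hM : Summable fun p => ‖M (b p)‖ ^ 2) (m : ℕ) :
    HasSquareSummableSectors (gaussTerm b M m) := by
  induction m with
  | zero => exact hasSquareSummableSectors_vacuum
  | succ m ih =>
    rw [gaussTerm_succ]
    exact (ih.createPair b hs hM).const_smul _

theorem annihilation_gaussTerm {M : H →L⋆[ℂ] H} (hs : IsSymmKernel M)
    (hM : Summable fun p => ‖M (b p)‖ ^ 2) (x : H) (m : ℕ) :
    annihilation b x (gaussTerm b M (m + 1)) =
      ((m + 1 : ℕ) : ℂ) • creation b (M x) (gaussTerm b M m) := by
  rw [gaussTerm_succ, annihilation_smul,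
    annihilation_createPair b hs x (hasSquareSummableSectors_gaussTerm b hs hM m)]
  induction m with
  | zero =>
    have hvac : annihilation b x (gaussTerm b M 0) = 0 := annihilation_vacuum b x
    have hzero : createPair b M (0 : Family ι) = 0 := by
      simpa using createPair_smul b M 0 (0 : Family ι)
    simp [hvac, hzero]
  | succ m ih =>
    have hprev : annihilation b x (gaussTerm b M (m + 1)) =
        ((m + 1 : ℕ) : ℂ) • creation b (M x) (gaussTerm b M m) := by
      rw [gaussTerm_succ, annihilation_smul,
        annihilation_createPair b hs x (hasSquareSummableSectors_gaussTerm b hs hM m), ih]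
    rw [hprev, createPair_smul, createPair_creation b hs, smul_add, smul_comm (1 / 2 : ℂ),
      ← creation_smul, ← gaussTerm_succ, smul_smul, ← add_smul]
    congr 1
    push_cast
    ring

theorem gaussian_apply {M : H →L⋆[ℂ] H} (hs : IsSymmKernel M) (n : ℕ) (i : Fin n → ι) :
    gaussian b M n i = ((n / 2).factorial : ℂ)⁻¹ * gaussTerm b M (n / 2) n i := by
  refine tsum_eq_single (n / 2) fun m hm => ?_
  have hz : gaussTerm b M m n = 0 := gaussTerm_eq_zero b hs (by omega)
  exact mul_eq_zero_of_right _ (congrFun hz i)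

theorem annihilation_gaussian {M : H →L⋆[ℂ] H} (hs : IsSymmKernel M)
    (hM : Summable fun p => ‖M (b p)‖ ^ 2) (x : H) :
    annihilation b x (gaussian b M) = creation b (M x) (gaussian b M) := by
  funext n i
  have hterm : annihilation b x (gaussian b M) n i =
      (((n + 1) / 2).factorial : ℂ)⁻¹ * annihilation b x (gaussTerm b M ((n + 1) / 2)) n i := by
    simp only [annihilation_apply, gaussian_apply b hs, mul_left_comm _ ((Nat.factorial _ : ℂ)⁻¹),
      tsum_mul_left]
  rw [hterm]
  cases n with
  | zero =>
    have hvac : annihilation b x (gaussTerm b M 0) = 0 := annihilation_vacuum b x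
    simp [hvac, creation]
  | succ n =>
    rw [show (n + 1 + 1) / 2 = n / 2 + 1 by omega, annihilation_gaussTerm b hs hM]
    simp only [Pi.smul_apply, smul_eq_mul, creation_succ, gaussian_apply b hs,
      mul_left_comm _ ((Nat.factorial _ : ℂ)⁻¹), ← Finset.mul_sum]
    have hm : ((n / 2 + 1 : ℕ) : ℂ) ≠ 0 := Nat.cast_ne_zero.2 (n / 2).succ_ne_zero
    rw [Nat.factorial_succ, Nat.cast_mul, mul_inv_rev, mul_assoc, inv_mul_cancel_left₀ hm]

end Gaussian

/-! ### Pair annihilation -/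

section PairAnnihilation

variable {ι H : Type*} [NormedAddCommGroup H] [InnerProductSpace ℂ H] (b : HilbertBasis ι ℂ H)

theorem annihilation_basis (p : ι) (Ψ : Family ι) (n : ℕ) (i : Fin n → ι) :
    annihilation b (b p) Ψ n i = (√(n + 1 : ℝ) : ℝ) * Ψ (n + 1) (Fin.cons p i) := by
  rw [annihilation_apply, tsum_inner_basis_mul]

theorem annihilation_annihilation_basis (p q : ι) (Ψ : Family ι) (n : ℕ) (i : Fin n → ι) :
    annihilation b (b p) (annihilation b (b q) Ψ) n i =
      (√(n + 1 : ℝ) * √(n + 1 + 1 : ℝ) : ℂ) * Ψ (n + 2) (Fin.cons q (Fin.cons p i)) := by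
  rw [annihilation_basis, annihilation_basis, mul_assoc]
  push_cast
  rfl

theorem squareSummable_kernel {A : H →L⋆[ℂ] H} (hA : Summable fun p => ‖A (b p)‖ ^ 2) :
    SquareSummable fun x : ι × ι => starRingEnd ℂ ⟪b x.1, A (b x.2)⟫_ℂ := by
  rw [← squareSummable_comp_equiv (Equiv.prodComm ι ι)]
  exact (squareSummable_prod_of_fiberwise (f := fun x : ι × ι => ⟪b x.2, A (b x.1)⟫_ℂ)
    (fun q => squareSummable_coord b (A (b q)))
    (hA.congr fun q => (sqNorm_coord b (A (b q))).symm)).conj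

theorem squareSummable_annihilation_annihilation {Ψ : Family ι}
    (hΨ : HasSquareSummableSectors Ψ) (n : ℕ) :
    SquareSummable fun x : (ι × ι) × (Fin n → ι) =>
      annihilation b (b x.1.1) (annihilation b (b x.1.2) Ψ) n x.2 := by
  simp only [annihilation_annihilation_basis]
  refine ((hΨ (n + 2)).comp_injective (e := fun x : (ι × ι) × (Fin n → ι) =>
    (Fin.cons x.1.2 (Fin.cons x.1.1 x.2) : Fin (n + 2) → ι)) ?_).const_smul
      (√(n + 1 : ℝ) * √(n + 1 + 1 : ℝ) : ℂ)
  rintro ⟨⟨p, q⟩, i⟩ ⟨⟨p', q'⟩, i'⟩ h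
  obtain ⟨hq, h⟩ := Fin.cons_injective2 h
  obtain ⟨hp, hi⟩ := Fin.cons_injective2 h
  exact Prod.ext (Prod.ext hp hq) hi

theorem summable_annihilatePair {A : H →L⋆[ℂ] H} (hA : Summable fun p => ‖A (b p)‖ ^ 2)
    {Ψ : Family ι} (hΨ : HasSquareSummableSectors Ψ) (n : ℕ) (i : Fin n → ι) :
    Summable fun x : ι × ι => starRingEnd ℂ ⟪b x.1, A (b x.2)⟫_ℂ *
      annihilation b (b x.1) (annihilation b (b x.2) Ψ) n i :=
  (squareSummable_kernel b hA).summable_mul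
    ((squareSummable_annihilation_annihilation b hΨ n).prod_mk_right i)

theorem HasSquareSummableSectors.annihilatePair {A : H →L⋆[ℂ] H}
    (hA : Summable fun p => ‖A (b p)‖ ^ 2) {Ψ : Family ι} (hΨ : HasSquareSummableSectors Ψ) :
    HasSquareSummableSectors (annihilatePair b A Ψ) := by
  intro n
  have hpair := squareSummable_annihilation_annihilation b hΨ n
  exact .of_le (hpair.hasSum_sqNorm_prod_mk_right.summable.mul_left _)
    fun i => (squareSummable_kernel b hA).norm_tsum_mul_sq_le (hpair.prod_mk_right i)

theorem annihilation_annihilatePair {A : H →L⋆[ℂ] H} (hA : Summable fun p => ‖A (b p)‖ ^ 2)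
    (w : H) {Ψ : Family ι} (hΨ : HasSquareSummableSectors Ψ) (hs : IsSymmFamily Ψ) :
    annihilation b w (annihilatePair b A Ψ) = annihilatePair b A (annihilation b w Ψ) := by
  funext n i
  let F (p : ι) (x : ι × ι) : ℂ := ⟪w, b p⟫_ℂ * starRingEnd ℂ ⟪b x.1, A (b x.2)⟫_ℂ *
    annihilation b (b x.1) (annihilation b (b x.2) Ψ) (n + 1) (Fin.cons p i)
  have hF : Summable (Function.uncurry F) := by
    refine ((squareSummable_coord_left b w).tensor (squareSummable_kernel b hA)).summable_mul
      ((squareSummable_annihilation_annihilation b hΨ (n + 1)).comp_injective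
        (e := fun y : ι × (ι × ι) => (y.2, (Fin.cons y.1 i : Fin (n + 1) → ι))) ?_)
    rintro ⟨r, x⟩ ⟨r', x'⟩ h
    obtain ⟨hx, hcons⟩ := Prod.ext_iff.1 h
    exact Prod.ext (Fin.cons_injective2 (α := fun _ => ι) hcons).1 hx
  have hcomm (x : ι × ι) :
      annihilation b (b x.1) (annihilation b (b x.2) (annihilation b w Ψ)) =
        annihilation b w (annihilation b (b x.1) (annihilation b (b x.2) Ψ)) := by
    rw [annihilation_comm b (b x.2) w hΨ hs,
      annihilation_comm b (b x.1) w (hΨ.annihilation b _) (hs.annihilation _)]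
  calc annihilation b w (annihilatePair b A Ψ) n i
    _ = (√(n + 1 : ℝ) : ℝ) * ∑' p, ∑' x, F p x := by
      simp only [annihilation_apply b w, annihilatePair, ← tsum_mul_left, F, mul_assoc]
    _ = (√(n + 1 : ℝ) : ℝ) * ∑' x, ∑' p, F p x := by rw [hF.tsum_comm]
    _ = annihilatePair b A (annihilation b w Ψ) n i := by
      simp only [annihilatePair, hcomm, ← tsum_mul_left, annihilation_apply b w, F]
      exact tsum_congr fun x => tsum_congr fun p => by ring

theorem hasSum_kernel_mul_annihilation {A : H →L⋆[ℂ] H} (hA : Summable fun p => ‖A (b p)‖ ^ 2)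
    (hs : IsSymmKernel A) (g : H) {Ψ : Family ι} (hΨ : HasSquareSummableSectors Ψ) (n : ℕ)
    (i : Fin n → ι) :
    HasSum (fun x : ι × ι => starRingEnd ℂ ⟪b x.1, A (b x.2)⟫_ℂ *
      (⟪b x.1, g⟫_ℂ * annihilation b (b x.2) Ψ n i)) (annihilation b (A g) Ψ n i) := by
  have hann : SquareSummable fun q => annihilation b (b q) Ψ n i := by
    simp only [annihilation_basis]
    exact (squareSummable_comp_cons (hΨ (n + 1)) i).const_smul ((√(n + 1 : ℝ) : ℝ) : ℂ)
  have hsummable := (squareSummable_kernel b hA).summable_mul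
    ((squareSummable_coord b g).tensor hann)
  have hinner (q : ι) : ∑' p, ⟪A (b q), b p⟫_ℂ * ⟪b p, g⟫_ℂ = ⟪A g, b q⟫_ℂ := by
    rw [(b.hasSum_inner_mul_inner _ _).tsum_eq, ← inner_conj_symm, hs, inner_conj_symm]
  refine hsummable.hasSum_iff.2 ?_
  rw [tsum_prod_comm hsummable]
  simp only [inner_conj_symm, ← mul_assoc, tsum_mul_right, hinner]
  simp only [annihilation_basis, mul_left_comm ⟪A g, _⟫_ℂ, tsum_mul_left]
  rfl

theorem hasSum_kernel_mul_creation {A : H →L⋆[ℂ] H} (hA : Summable fun p => ‖A (b p)‖ ^ 2) (g : H)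
    {Ψ : Family ι} (hΨ : HasSquareSummableSectors Ψ) (n : ℕ) (i : Fin n → ι) :
    HasSum (fun x : ι × ι => starRingEnd ℂ ⟪b x.1, A (b x.2)⟫_ℂ *
      creation b g (annihilation b (b x.1) (annihilation b (b x.2) Ψ)) n i)
      (creation b g (annihilatePair b A Ψ) n i) := by
  cases n with
  | zero => simp [creation, hasSum_zero]
  | succ n =>
    simpa only [creation_succ, mul_left_comm _ (((√(n + 1 : ℝ))⁻¹ : ℝ) : ℂ), Finset.mul_sum,
      mul_left_comm (starRingEnd ℂ _), annihilatePair] using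
      (hasSum_sum fun j (_ : j ∈ Finset.univ) =>
        (summable_annihilatePair b hA hΨ n fun l => i (j.succAbove l)).hasSum.mul_left
          ⟪b (i j), g⟫_ℂ).mul_left (((√(n + 1 : ℝ))⁻¹ : ℝ) : ℂ)

theorem annihilation_annihilation_creation (f h g : H) {Ψ : Family ι}
    (hΨ : HasSquareSummableSectors Ψ) :
    annihilation b f (annihilation b h (creation b g Ψ)) =
      creation b g (annihilation b f (annihilation b h Ψ)) +
        ⟪f, g⟫_ℂ • annihilation b h Ψ + ⟪h, g⟫_ℂ • annihilation b f Ψ := by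
  rw [annihilation_creation b _ g hΨ, annihilation_add b _
    ((hΨ.annihilation b _).creation b g) (hΨ.const_smul _), annihilation_smul,
    annihilation_creation b _ g (hΨ.annihilation b _)]

theorem annihilatePair_creation {A : H →L⋆[ℂ] H} (hA : Summable fun p => ‖A (b p)‖ ^ 2)
    (hs : IsSymmKernel A) (g : H) {Ψ : Family ι} (hΨ : HasSquareSummableSectors Ψ) :
    annihilatePair b A (creation b g Ψ) =
      creation b g (annihilatePair b A Ψ) + (2 : ℂ) • annihilation b (A g) Ψ := by
  funext n i
  have hfst := hasSum_kernel_mul_annihilation b hA hs g hΨ n i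
  have hsnd : HasSum (fun x : ι × ι => starRingEnd ℂ ⟪b x.1, A (b x.2)⟫_ℂ *
      (⟪b x.2, g⟫_ℂ * annihilation b (b x.1) Ψ n i)) (annihilation b (A g) Ψ n i) := by
    rw [← (Equiv.prodComm ι ι).hasSum_iff]
    convert hfst using 2 with x
    simp only [Function.comp_apply, Equiv.prodComm_apply, Prod.fst_swap, Prod.snd_swap,
      hs (b x.2)]
  have hsum := ((hasSum_kernel_mul_creation b hA g hΨ n i).add hfst).add hsnd
  rw [annihilatePair]
  simp only [annihilation_annihilation_creation b _ _ g hΨ, Pi.add_apply, Pi.smul_apply,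
    smul_eq_mul, mul_add, two_mul, ← add_assoc]
  exact hsum.tsum_eq

end PairAnnihilation

/-! ### Second quantization -/

section TensorPairing

variable {ι H : Type*} [NormedAddCommGroup H] [InnerProductSpace ℂ H] (b : HilbertBasis ι ℂ H)

theorem squareSummable_prod_coord_left {n : ℕ} (h : Fin n → H) :
    SquareSummable fun i : Fin n → ι => ∏ l, ⟪h l, b (i l)⟫_ℂ := by
  induction n with
  | zero => exact (hasSum_fintype _).summable
  | succ n ih =>
    rw [← squareSummable_comp_equiv (Fin.consEquiv fun _ => ι)]
    simpa [Fin.prod_univ_succ] using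
      (squareSummable_coord_left b (h 0)).tensor (ih fun l => h l.succ)

theorem summable_tensorPairing {n : ℕ} (h : Fin n → H) {T : (Fin n → ι) → ℂ}
    (hT : SquareSummable T) : Summable fun i => (∏ l, ⟪h l, b (i l)⟫_ℂ) * T i :=
  (squareSummable_prod_coord_left b h).summable_mul hT

theorem tensorPairing_add {n : ℕ} (h : Fin n → H) {T U : (Fin n → ι) → ℂ} (hT : SquareSummable T)
    (hU : SquareSummable U) :
    tensorPairing b h (T + U) = tensorPairing b h T + tensorPairing b h U := by
  simp only [tensorPairing, Pi.add_apply, mul_add]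
  exact (summable_tensorPairing b h hT).tsum_add (summable_tensorPairing b h hU)

theorem tensorPairing_sub {n : ℕ} (h : Fin n → H) {T U : (Fin n → ι) → ℂ} (hT : SquareSummable T)
    (hU : SquareSummable U) :
    tensorPairing b h (T - U) = tensorPairing b h T - tensorPairing b h U := by
  simp only [tensorPairing, Pi.sub_apply, mul_sub]
  exact (summable_tensorPairing b h hT).tsum_sub (summable_tensorPairing b h hU)

theorem tensorPairing_smul {n : ℕ} (h : Fin n → H) (c : ℂ) (T : (Fin n → ι) → ℂ) :
    tensorPairing b h (c • T) = c * tensorPairing b h T := by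
  simp only [tensorPairing, Pi.smul_apply, smul_eq_mul, mul_left_comm _ c, tsum_mul_left]

theorem tensorPairing_sum {κ : Type*} {s : Finset κ} {n : ℕ} (h : Fin n → H)
    {T : κ → (Fin n → ι) → ℂ} (hT : ∀ k, SquareSummable (T k)) :
    tensorPairing b h (∑ k ∈ s, T k) = ∑ k ∈ s, tensorPairing b h (T k) := by
  simp only [tensorPairing, Finset.sum_apply, Finset.mul_sum]
  exact Summable.tsum_finsetSum fun k _ => summable_tensorPairing b h (hT k)

theorem tensorPairing_contract {n : ℕ} (h : Fin n → H) (w : H) {T : (Fin (n + 1) → ι) → ℂ}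
    (hT : SquareSummable T) : tensorPairing b h (contract (fun p => ⟪w, b p⟫_ℂ) T) =
      tensorPairing b (Fin.cons w h : Fin (n + 1) → H) T := by
  have hsummable := (Fin.consEquiv fun _ => ι).summable_iff.2
    (summable_tensorPairing b (Fin.cons w h : Fin (n + 1) → H) hT)
  rw [tensorPairing, tensorPairing, ← (Fin.consEquiv fun _ => ι).tsum_eq]
  refine Eq.trans ?_ (tsum_prod_comm hsummable).symm
  simp only [contract, ← tsum_mul_left]
  refine tsum_congr fun i => tsum_congr fun p => ?_
  simp only [Function.comp_apply, Fin.consEquiv_apply, Fin.prod_univ_succ, Fin.cons_zero,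
    Fin.cons_succ, mul_left_comm, mul_assoc]
  rfl

theorem tensorPairing_tensorAt {n : ℕ} (h : Fin (n + 1) → H) (f : H) {T : (Fin n → ι) → ℂ}
    (hT : SquareSummable T) (j : Fin (n + 1)) :
    tensorPairing b h (tensorAt (fun p => ⟪b p, f⟫_ℂ) T j) =
      ⟪h j, f⟫_ℂ * tensorPairing b (fun l => h (j.succAbove l)) T := by
  have hleft : Summable fun p => ⟪h j, b p⟫_ℂ * ⟪b p, f⟫_ℂ :=
    (b.hasSum_inner_mul_inner (h j) f).summable
  have hright := summable_tensorPairing b (fun l => h (j.succAbove l)) hT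
  rw [tensorPairing, tensorPairing, ← (Fin.insertNthEquiv (fun _ => ι) j).tsum_eq,
    ← (b.hasSum_inner_mul_inner (h j) f).tsum_eq,
    tsum_mul_tsum_of_summable_norm hleft.norm hright.norm]
  refine tsum_congr fun x => ?_
  rw [tensorAt_insertNthEquiv]
  simp only [Fin.insertNthEquiv_apply, Fin.prod_univ_succAbove _ j, Fin.insertNth_apply_same,
    Fin.insertNth_apply_succAbove]
  ring

theorem eq_zero_of_contract_eq_zero {D : Submodule ℂ H} (hD : Dense (D : Set H)) {n : ℕ}
    {T : (Fin (n + 1) → ι) → ℂ} (hT : SquareSummable T)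
    (h : ∀ w ∈ D, contract (fun p => ⟪w, b p⟫_ℂ) T = 0) : T = 0 := by
  funext i
  let u : H := b.repr.symm (squareSummable_comp_cons hT (Fin.tail i)).toLp
  have hcoord (p : ι) : ⟪b p, u⟫_ℂ = T (Fin.cons p (Fin.tail i)) := by
    rw [← b.repr_apply_apply, LinearIsometryEquiv.apply_symm_apply, SquareSummable.toLp_apply]
  have hu : u = 0 := hD.eq_zero_of_inner_right ℂ fun w hw => by
    simpa only [← (b.hasSum_inner_mul_inner w u).tsum_eq, hcoord, contract, Pi.zero_apply] using
      congrFun (h w hw) (Fin.tail i)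
  rw [← Fin.cons_self_tail i, ← hcoord, hu, inner_zero_right, Pi.zero_apply]

theorem coe_cons {D : Submodule ℂ H} {n : ℕ} (w : D) (h : Fin n → D) :
    (fun l => ((Fin.cons w h : Fin (n + 1) → D) l : H)) =
      (Fin.cons (w : H) fun l => (h l : H) : Fin (n + 1) → H) := by
  funext l
  refine Fin.cases ?_ (fun l => ?_) l <;> simp

theorem eq_zero_of_tensorPairing_eq_zero {D : Submodule ℂ H} (hD : Dense (D : Set H)) {n : ℕ}
    {T : (Fin n → ι) → ℂ} (hT : SquareSummable T)
    (h : ∀ h : Fin n → D, tensorPairing b (fun l => (h l : H)) T = 0) : T = 0 := by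
  induction n with
  | zero =>
    funext i
    have hi := h Fin.elim0
    rw [tensorPairing, tsum_fintype, Fintype.sum_unique] at hi
    simpa [Subsingleton.elim i default] using hi
  | succ n ih =>
    refine eq_zero_of_contract_eq_zero b hD hT fun w hw =>
      ih ((squareSummable_coord_left b w).contract hT) fun g => ?_
    rw [tensorPairing_contract b _ w hT, ← coe_cons ⟨w, hw⟩ g, h]

theorem tensorPairing_annihilation {n : ℕ} (h : Fin n → H) (w : H) {Ψ : Family ι}
    (hΨ : HasSquareSummableSectors Ψ) : tensorPairing b h (annihilation b w Ψ n) =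
      √(n + 1 : ℝ) * tensorPairing b (Fin.cons w h : Fin (n + 1) → H) (Ψ (n + 1)) := by
  rw [annihilation_eq_contract, tensorPairing_smul, tensorPairing_contract b h w (hΨ _)]

theorem tensorPairing_creation {n : ℕ} (h : Fin (n + 1) → H) (f : H) {Ψ : Family ι}
    (hΨ : HasSquareSummableSectors Ψ) : tensorPairing b h (creation b f Ψ (n + 1)) =
      (√(n + 1 : ℝ) : ℂ)⁻¹ * ∑ j, ⟪h j, f⟫_ℂ *
        tensorPairing b (fun l => h (j.succAbove l)) (Ψ n) := by
  rw [creation_succ_eq_sum_tensorAt, tensorPairing_smul,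
    tensorPairing_sum b h fun j => (squareSummable_coord b f).tensorAt (hΨ n) j]
  simp only [tensorPairing_tensorAt b h f (hΨ n)]

end TensorPairing

section SecondQuantization

variable {ι H : Type*} [NormedAddCommGroup H] [InnerProductSpace ℂ H] (b : HilbertBasis ι ℂ H)

/-- The pairing of `a⁺Ba⁻ T` with a product vector `h₁ ⊗ ⋯ ⊗ hₙ` over `D(B)`, with `B` moved to the
product vector; it makes sense for every square-summable `T`. -/
def secondQuantForm (B : H →ₗ.[ℂ] H) {n : ℕ} (h : Fin n → B.domain) (T : (Fin n → ι) → ℂ) : ℂ :=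
  ∑ j, tensorPairing b (Function.update (fun l => (h l : H)) j (B (h j))) T

theorem tensorPairing_annihilation_of_isSecondQuantization {B : H →ₗ.[ℂ] H} {Ψ Ξ : Family ι}
    (hΞ : IsSecondQuantization b B Ψ Ξ) (w : B.domain) {n : ℕ} (h : Fin n → B.domain) :
    tensorPairing b (fun l => (h l : H)) (annihilation b (w : H) Ξ n) =
      tensorPairing b (fun l => (h l : H)) (annihilation b (B w) Ψ n) +
        secondQuantForm b B h (annihilation b (w : H) Ψ n) := by
  obtain ⟨hΨ, hΞF, hform⟩ := hΞ
  have hΨs := hΨ.hasSquareSummableSectors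
  simp only [secondQuantForm, tensorPairing_annihilation b _ _ hΨs,
    tensorPairing_annihilation b _ _ hΞF.hasSquareSummableSectors]
  rw [← coe_cons, ← hform, Fin.sum_univ_succ, mul_add, Finset.mul_sum, coe_cons, Fin.cons_zero,
    Fin.update_cons_zero]
  simp only [Fin.cons_succ, Fin.cons_update]

theorem secondQuantForm_creation [CompleteSpace H] {B : H →ₗ.[ℂ] H} (hB : IsSelfAdjoint B)
    {Ψ Ξ : Family ι} (hΞ : IsSecondQuantization b B Ψ Ξ) (g : B.domain) {n : ℕ}
    (h : Fin n → B.domain) :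
    secondQuantForm b B h (creation b (g : H) Ψ n) =
      tensorPairing b (fun l => (h l : H)) (creation b (B g) Ψ n) +
        tensorPairing b (fun l => (h l : H)) (creation b (g : H) Ξ n) := by
  obtain ⟨hΨ, hΞF, hform⟩ := hΞ
  cases n with
  | zero => simp [secondQuantForm, tensorPairing, creation]
  | succ n =>
    simp only [secondQuantForm, tensorPairing_creation b _ _ hΨ.hasSquareSummableSectors,
      tensorPairing_creation b _ _ hΞF.hasSquareSummableSectors]
    rw [← Finset.mul_sum, ← mul_add, Finset.sum_comm, ← Finset.sum_add_distrib]
    congr 1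
    refine Finset.sum_congr rfl fun k _ => ?_
    rw [Fin.sum_univ_succAbove _ k, ← hform n fun l => h (k.succAbove l), Finset.mul_sum]
    congr 1
    · rw [Function.update_self, inner_apply_of_isSelfAdjoint hB]
      simp only [Function.update_of_ne (Fin.succAbove_ne k _)]
    · refine Finset.sum_congr rfl fun j _ => ?_
      rw [Function.update_of_ne (Fin.succAbove_ne k j).symm]
      congr 2
      exact Function.update_comp_eq_of_injective _ (Fin.succAbove_right_injective (p := k)) _ _

-- Formally `[a⁻[w] - a⁺[g], a⁺Ba⁻] = a⁻[B w] + a⁺[B g]`, applied to a vector on which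
-- `a⁻[w] - a⁺[g]` vanishes.
theorem annihilation_sub_creation_of_isSecondQuantization [CompleteSpace H] {B : H →ₗ.[ℂ] H}
    (hB : IsSelfAdjoint B) {Ψ Ξ : Family ι} (hΞ : IsSecondQuantization b B Ψ Ξ)
    (w g : B.domain) (hw : annihilation b (w : H) Ψ = creation b (g : H) Ψ) :
    annihilation b (w : H) Ξ - creation b (g : H) Ξ =
      annihilation b (B w) Ψ + creation b (B g) Ψ := by
  have hΨs := hΞ.1.hasSquareSummableSectors
  have hΞs := hΞ.2.1.hasSquareSummableSectors
  have hl := hΞs.annihilation b (w : H)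
  have hr := hΞs.creation b (g : H)
  have hl' := hΨs.annihilation b (B w)
  have hr' := hΨs.creation b (B g)
  refine funext fun n => sub_eq_zero.1 (eq_zero_of_tensorPairing_eq_zero b hB.dense_domain
    ((hl.sub hr).sub (hl'.add hr') n) fun h => ?_)
  have hcreation := secondQuantForm_creation b hB hΞ g h
  rw [← hw] at hcreation
  rw [tensorPairing_sub b _ ((hl.sub hr) n) ((hl'.add hr') n), Pi.sub_apply, Pi.add_apply,
    tensorPairing_sub b _ (hl n) (hr n), tensorPairing_add b _ (hl' n) (hr' n)]
  linear_combination tensorPairing_annihilation_of_isSecondQuantization b hΞ w h + hcreation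

end SecondQuantization

/-! ### The Riccati equation of a Gaussian eigenvector -/

section Commutator

variable {ι H : Type*} [NormedAddCommGroup H] [InnerProductSpace ℂ H] {b : HilbertBasis ι ℂ H}

theorem gaussAnnihilator_mul_creationOp (M : H →L⋆[ℂ] H) (v k : H) :
    gaussAnnihilator b M v * creationOp b k =
      creationOp b k * gaussAnnihilator b M v + ⟪v, k⟫_ℂ • 1 := by
  rw [gaussAnnihilator, sub_mul, mul_sub, annihilationOp_mul_creationOp,
    creationOp_mul_comm b (M v) k]
  abel

theorem gaussAnnihilator_sq_apply {M : H →L⋆[ℂ] H} {v k : H} {x y : schwartzSubspace ι}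
    (hx : gaussAnnihilator b M v x = 0) (hy : gaussAnnihilator b M v y = creationOp b k x) (E : ℂ) :
    gaussAnnihilator b M v (gaussAnnihilator b M v (y - E • x)) = ⟪v, k⟫_ℂ • x := by
  have hcomm := LinearMap.congr_fun (gaussAnnihilator_mul_creationOp (b := b) M v k) x
  rw [map_sub, map_smul, hx, smul_zero, sub_zero, hy]
  simpa only [Module.End.mul_apply, LinearMap.add_apply, LinearMap.smul_apply,
    Module.End.one_apply, hx, map_zero, zero_add] using hcomm

end Commutator

section Riccati

variable {ι H : Type*} [NormedAddCommGroup H] [InnerProductSpace ℂ H] [CompleteSpace H]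
  {b : HilbertBasis ι ℂ H} (Q : QuadraticSystem b)

theorem annihilation_hamiltonian {M : H →L⋆[ℂ] H} (hMd : ∀ f, M f ∈ Q.B.domain) {Ψ Θ : Family ι}
    (hΨ : ∀ x, annihilation b x Ψ = creation b (M x) Ψ) (hΘ : Q.IsHamiltonianImage Ψ Θ)
    (v : Q.B.domain) : annihilation b (v : H) Θ =
      creation b (M v) Θ + creation b (riccatiDefect Q.B Q.A M hMd v) Ψ := by
  obtain ⟨hΨS, -, Ξ, hΞ, rfl⟩ := hΘ
  have hA := Q.kernelA.1
  have hΨs := hΨS.hasSquareSummableSectors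
  have hAΨs := (hΨs.createPair b Q.symmA hA).const_smul (1 / 2 : ℂ)
  have hΞs := hΞ.2.1.hasSquareSummableSectors
  have hA'Ψs := (hΨs.annihilatePair b hA).const_smul (1 / 2 : ℂ)
  have hcreate := annihilation_createPair b Q.symmA (v : H) hΨs
  rw [hΨ, createPair_creation b Q.symmA] at hcreate
  have hsecond := annihilation_sub_creation_of_isSecondQuantization b Q.selfAdjoint hΞ v
    ⟨M v, hMd v⟩ (hΨ v)
  rw [hΨ, sub_eq_iff_eq_add] at hsecond
  have hannihilate := annihilation_annihilatePair b hA (v : H) hΨs hΨS.isSymmFamily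
  rw [hΨ, annihilatePair_creation b hA Q.symmA _ hΨs, hΨ] at hannihilate
  rw [annihilation_add b _ ((hAΨs.add hΞs).add hA'Ψs) (hΨs.const_smul _),
    annihilation_add b _ (hAΨs.add hΞs) hA'Ψs, annihilation_add b _ hAΨs hΞs, annihilation_smul,
    annihilation_smul, annihilation_smul, hcreate, hsecond, hannihilate, hΨ]
  simp only [riccatiDefect, creation_add, creation_smul, creation_add_left]
  module

theorem QuadraticSystem.physInner_eq_physForm [MeasurableSpace H] (μ : Measure Q.ℒ)
    (x y : schwartzSubspace ι) : Q.physInner μ (x : Family ι) y = physForm b μ x y := by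
  simp only [QuadraticSystem.physInner, physForm, fockInner_weyl]

theorem inner_riccatiDefect_eq_zero [MeasurableSpace H] [BorelSpace H] (μ : Measure Q.ℒ)
    [μ.IsAddHaarMeasure] {M : H →L⋆[ℂ] H} (hs : IsSymmKernel M) (hMd : ∀ f, M f ∈ Q.B.domain)
    {Ψ : Family ι} (hΨ : ∀ x, annihilation b x Ψ = creation b (M x) Ψ)
    (hE : Q.IsEigenvector μ Ψ) (v : Q.B.domain) (hv : IsAdmissible M Q.ℒ v) :
    ⟪(v : H), riccatiDefect Q.B Q.A M hMd v⟫_ℂ = 0 := by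
  have := Q.finiteDimensional
  obtain ⟨hne, E, Θ, hΘ, hEq⟩ := hE
  let x : schwartzSubspace ι := ⟨Ψ, hΘ.1⟩
  let y : schwartzSubspace ι := ⟨Θ, hΘ.2.1⟩
  have hx : physForm b μ x x ≠ 0 := fun h => hne <| by
    rw [QuadraticSystem.Equivalent, sub_zero]
    exact (Q.physInner_eq_physForm μ x x).trans h
  have hnull : physForm b μ (y - E • x) (y - E • x) = 0 :=
    (Q.physInner_eq_physForm μ _ _).symm.trans hEq
  have hDx : gaussAnnihilator b M (v : H) x = 0 := by
    rw [gaussAnnihilator, LinearMap.sub_apply, sub_eq_zero]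
    exact Subtype.ext (hΨ v)
  have hDy : gaussAnnihilator b M (v : H) y =
      creationOp b (riccatiDefect Q.B Q.A M hMd v) x := by
    rw [gaussAnnihilator, LinearMap.sub_apply, sub_eq_iff_eq_add']
    exact Subtype.ext (annihilation_hamiltonian Q hMd hΨ hΘ v)
  have hmul := physForm_smul_right b μ ⟪(v : H), riccatiDefect Q.B Q.A M hMd v⟫_ℂ x x
  rw [← gaussAnnihilator_sq_apply hDx hDy E, physForm_gaussAnnihilator b μ hs hv,
    physForm_gaussAnnihilator b μ hs hv,
    physForm_eq_zero_of_self_eq_zero b μ Q.isotropic hnull] at hmul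
  exact (mul_eq_zero.1 hmul.symm).resolve_right hx

theorem QuadraticSystem.isStable_of_annihilation_eq_creation [MeasurableSpace H] [BorelSpace H]
    (μ : Measure Q.ℒ) [μ.IsAddHaarMeasure] {M : H →L⋆[ℂ] H} (hs : IsSymmKernel M) (hM : ‖M‖ < 1)
    (hMd : ∀ f, M f ∈ Q.B.domain) {Ψ : Family ι}
    (hΨ : ∀ x, annihilation b x Ψ = creation b (M x) Ψ) (hE : Q.IsEigenvector μ Ψ) : Q.IsStable :=
  Q.isStable_of_inner_riccatiDefect_eq_zero hM hs hMd
    (inner_riccatiDefect_eq_zero Q μ hs hMd hΨ hE)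

end Riccati

end ConstrainedFock

end

theorem lemma23_general {ι H : Type*} [NormedAddCommGroup H] [InnerProductSpace ℂ H]
    [CompleteSpace H] [MeasurableSpace H] [BorelSpace H] (b : HilbertBasis ι ℂ H)
    (Q : ConstrainedFock.QuadraticSystem b)
    (μ : MeasureTheory.Measure Q.ℒ) [μ.IsAddHaarMeasure]
    (M : H →L⋆[ℂ] H) (hMsymm : ConstrainedFock.IsSymmKernel M) (hMnorm : ‖M‖ < 1)
    (hMHS : Summable fun p => ‖M (b p)‖ ^ 2) (hMdom : ∀ f, M f ∈ Q.B.domain)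
    (hM : Q.IsEigenvector μ (ConstrainedFock.gaussian b M)) :
    Q.IsStable :=
  Q.isStable_of_annihilation_eq_creation μ hMsymm hMnorm hMdom
    (ConstrainedFock.annihilation_gaussian b hMsymm hMHS) hM

theorem lemma23 {ι H : Type*} [NormedAddCommGroup H] [InnerProductSpace ℂ H] [CompleteSpace H]
    [MeasurableSpace H] [BorelSpace H] (b : HilbertBasis ι ℂ H)
    (Q : ConstrainedFock.QuadraticSystem b)
    (μ : MeasureTheory.Measure Q.ℒ) [μ.IsAddHaarMeasure]
    (M : H →L⋆[ℂ] H) (hMsymm : ConstrainedFock.IsSymmKernel M) (hMnorm : ‖M‖ < 1)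
    (hMdom : ConstrainedFock.HasKernelInDomain b Q.B M)
    (hM : Q.IsEigenvector μ (ConstrainedFock.gaussian b M)) :
    Q.IsStable :=
  lemma23_general b Q μ M hMsymm hMnorm hMdom.1 hMdom.2.1 hM
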